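/- Let $F(x,y)=a_0x^4+a_1x^3y+a_2x^2y^2+a_3xy^3+a_4y^4$ be a binary quartic form with integer coefficients which is irreducible over $\mathbb{Q}$, has positive discriminant, and splits over $\mathbb{R}$ (that is, $F$ is a product of four linear forms with real coefficients). Put $$I = a_2^2-3a_1a_3+12a_0a_4,\qquad J = 2a_2^3-9a_1a_2a_3+27a_1^2a_4-72a_0a_2a_4+27a_0a_3^2,$$ and let $H=F_{xx}F_{yy}-F_{xy}^2$ be the Hessian of $F$. For such $F$ the polynomial $X^3-3IX-J$ has three distinct real roots; let $\varphi$ be the middle one. There is a unique positive definite real quadratic form $m(x,y)=Ax^2+Bxy+Cy^2$ with $$m(x,y)^2=-\tfrac19H(x,y)+\tfrac43\,\varphi\,F(x,y),$$ and $F$ is called reduced if $|B|\le A\le C$. Suppose that $F$ is reduced and that $J=0$ (so that $\varphi=0$ and $m^2=-\tfrac19H$). Then for every positive integer $h$, the inequality $|F(x,y)|\le h$ has at most $12$ solutions in coprime integers $x,y$ with $$|y|\ \ge\ \frac{h^{3/4}}{(3I)^{1/8}},$$ where $(x,y)$ and $(-x,-y)$ are regarded as the same solution. -/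

import Mathlib

/-- A binary quartic form `a₀x⁴ + a₁x³y + a₂x²y² + a₃xy³ + a₄y⁴` with integer coefficients. -/
structure BinaryQuartic where
  a₀ : ℤ
  a₁ : ℤ
  a₂ : ℤ
  a₃ : ℤ
  a₄ : ℤ

namespace BinaryQuartic

open MvPolynomial in
/-- The form as a polynomial in the two variables `x = X 0`, `y = X 1` over a ring `R`. -/
noncomputable def form (F : BinaryQuartic) (R : Type*) [CommRing R] : MvPolynomial (Fin 2) R :=
  C (F.a₀ : R) * X 0 ^ 4 + C (F.a₁ : R) * X 0 ^ 3 * X 1 + C (F.a₂ : R) * X 0 ^ 2 * X 1 ^ 2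
    + C (F.a₃ : R) * X 0 * X 1 ^ 3 + C (F.a₄ : R) * X 1 ^ 4

/-- The value `F(x, y)` at integers `x`, `y`. -/
def value (F : BinaryQuartic) (x y : ℤ) : ℤ :=
  F.a₀ * x ^ 4 + F.a₁ * x ^ 3 * y + F.a₂ * x ^ 2 * y ^ 2 + F.a₃ * x * y ^ 3 + F.a₄ * y ^ 4

theorem eval_form (F : BinaryQuartic) (x y : ℤ) :
    MvPolynomial.eval ![x, y] (F.form ℤ) = F.value x y := by
  simp [form, value]

/-- The one-variable polynomial `F(x, 1)`. -/
noncomputable def dehomogenize (F : BinaryQuartic) : Polynomial ℤ :=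
  Polynomial.C F.a₀ * Polynomial.X ^ 4 + Polynomial.C F.a₁ * Polynomial.X ^ 3
    + Polynomial.C F.a₂ * Polynomial.X ^ 2 + Polynomial.C F.a₃ * Polynomial.X
    + Polynomial.C F.a₄

/-- The discriminant `D = a₀⁶ ∏_{i < j} (αᵢ - αⱼ)²` of the form, where the `αᵢ` are the roots of
`F(x, 1)`. (Meant for `a₀ ≠ 0`, which holds for every irreducible form.) -/
noncomputable def discriminant (F : BinaryQuartic) : ℤ :=
  F.dehomogenize.discr

/-- The invariant `I` of the form. -/
def invI (F : BinaryQuartic) : ℤ :=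
  F.a₂ ^ 2 - 3 * F.a₁ * F.a₃ + 12 * F.a₀ * F.a₄

/-- The invariant `J` of the form. -/
def invJ (F : BinaryQuartic) : ℤ :=
  2 * F.a₂ ^ 3 - 9 * F.a₁ * F.a₂ * F.a₃ + 27 * F.a₁ ^ 2 * F.a₄ - 72 * F.a₀ * F.a₂ * F.a₄
    + 27 * F.a₀ * F.a₃ ^ 2

/-- The form is irreducible over `ℚ`. -/
def IsIrreducible (F : BinaryQuartic) : Prop :=
  Irreducible (F.form ℚ)

open MvPolynomial in
/-- The form splits over `ℝ`: it is a product of four real linear forms. -/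
def SplitsOverReals (F : BinaryQuartic) : Prop :=
  ∃ p q : Fin 4 → ℝ, F.form ℝ = ∏ i, (C (p i) * X 0 + C (q i) * X 1)

open MvPolynomial in
/-- The Hessian `H = F_xx F_yy - F_xy²`, with real coefficients. -/
noncomputable def hessian (F : BinaryQuartic) : MvPolynomial (Fin 2) ℝ :=
  pderiv 0 (pderiv 0 (F.form ℝ)) * pderiv 1 (pderiv 1 (F.form ℝ))
    - pderiv 0 (pderiv 1 (F.form ℝ)) ^ 2

open MvPolynomial in
/-- A form that splits over `ℝ` and has positive discriminant is *reduced* if its positive definite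
quadratic covariant `m = A x² + B x y + C y²` satisfies `|B| ≤ A ≤ C`. The covariant is given by
`m² = -H / 9 + (4 / 3) φ F`, where `φ` is the middle one of the three real roots of
`X³ - 3 I X - J` (so `φ = 0` when `J = 0`). -/
def IsReduced (F : BinaryQuartic) : Prop :=
  ∃ φ₁ φ φ₃ : ℝ, φ₁ < φ ∧ φ < φ₃ ∧
    (∀ t ∈ ({φ₁, φ, φ₃} : Set ℝ), t ^ 3 - 3 * (F.invI : ℝ) * t - (F.invJ : ℝ) = 0) ∧
    ∃ a b c : ℝ, 0 < a ∧ b ^ 2 < 4 * a * c ∧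
      C (-1 / 9) * F.hessian + C (4 / 3 * φ) * F.form ℝ
        = (C a * X 0 ^ 2 + C b * X 0 * X 1 + C c * X 1 ^ 2) ^ 2 ∧
      |b| ≤ a ∧ a ≤ c

/-- The coprime integer solutions `(x, y)` of `|F(x, y)| ≤ h` with `|y| ≥ h^{3/4} / (3I)^{1/8}`. -/
def largeSolutions (F : BinaryQuartic) (h : ℕ) : Set (ℤ × ℤ) :=
  {v | IsCoprime v.1 v.2 ∧ |F.value v.1 v.2| ≤ (h : ℤ) ∧
    (h : ℝ) ^ (3 / 4 : ℝ) / (3 * (F.invI : ℝ)) ^ (1 / 8 : ℝ) ≤ |(v.2 : ℝ)|}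

end BinaryQuartic

/-!
The proof is the method of Thue and Siegel, carried out with explicit constants for the form `F` that
the vanishing of `J` makes a difference of two fourth powers.

Put `k = I / 3` and `s = √k`. Since `J = 0`, there are a complex linear form `z` and a quartic form `τ`
with `z(x, y) ^ 4 = τ(x, y) + 4 s F(x, y) i` and `|z| ^ 2 = m` (`exists_resolvent`). The coefficients of
`τ` lie in the group `T` generated by those of `m`, and products of two elements of `T` are integers.
If `|F(x, y)| ≤ h`, then `z ^ 4` has a small imaginary part, so the argument of `z` is close to a multiple
of `π / 4`. The nearest such multiple, modulo `π`, sorts the solutions into four classes, and it suffices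
that each of them has at most three elements (`false_of_four_in_class`). After a rotation of the class
all its points are close to the real axis.

* *Gaps.* For two points with determinant `d` one has `Im (conj z' * z) = s d`, hence
  `s ≤ |z| |z'| (|sin θ| + |sin θ'|)`, while `|sin 4θ| |z| ^ 4 ≤ 4 s h`. So the sizes of the points of a
  class grow at least like `|z'| ≫ |z| ^ 3 / h`, and the third point satisfies
  `270000 k ^ 3 h ^ 10 ≤ |z| ^ 8` (`le_third_of_gaps`).
* *Approximation.* Let `A_n` be the diagonal Padé numerators of `(1 - t) ^ (1 / 4)`. The forms
  `G_n(θ) = e ^ (iθ) A_n` (`padeForm`) satisfy `G_n' = K_n sin 4θ G_{n - 1}`, so that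
  `|Im G_n| ≤ (5 / 8) 16 ^ n |θ| ^ (2 n + 1)`, and two consecutive ones are linearly independent over the
  reals. The number `|z'| |z| ^ (4 n + 1) Im (e ^ (-iθ') G_n(θ))` is `s` times the square root of an
  integer (`le_of_im_padeForm_ne_zero`), so it is at least `s` unless it vanishes. Hence a point `z'`
  beyond a point `z` with `270000 k ^ 3 h ^ 10 ≤ |z| ^ 8` is pushed to infinity as `n` grows, which is
  absurd (`false_of_large_of_isResolventPair`). That the form of order one does not vanish follows
  from an identity between covariants (`im_padeForm_one_ne_zero`).

The lower bound for `|y|` and the reduction theory of `m` provide the start of the chain of gaps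
(`isAdmissibleStart_of_mem`). This works directly for `k ≥ 36`; for smaller `k` a finite search shows
that `F = ±(x⁴ + t x³ y - 6 x² y² - t x y³ + y⁴)` (`coeff_eq_of_k_lt`), and for those forms `m` is a
multiple of `x² + y²`.
-/

/-! ### Coefficients of the Padé approximants of the fourth root -/

open Finset in
/-- The coefficient `binom(n + 1/4, m) * binom(2n - m, n)` of the diagonal Padé approximant of
order `n` to `(1 - z)^(1/4)`. For `n ≠ 0` it vanishes when `m > n`. -/
noncomputable def padeCoeff (n m : ℕ) : ℝ :=
  (∏ j ∈ range m, ((4 * ((n : ℝ) - j) + 1) / 4)) / (m.factorial : ℝ) * ((2 * n - m).choose n : ℝ)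

theorem padeCoeff_zero_right (n : ℕ) : padeCoeff n 0 = (n.centralBinom : ℝ) := by
  simp [padeCoeff, Nat.centralBinom]

theorem padeCoeff_eq_zero {n m : ℕ} (hn : n ≠ 0) (h : n < m) : padeCoeff n m = 0 := by
  have : (2 * n - m).choose n = 0 := Nat.choose_eq_zero_of_lt (by omega)
  simp [padeCoeff, this]

open Finset in
/-- The product `4 ^ m * m! * binom(n + 1/4, m)` is divisible by the odd part of `m!`, and the exponent
of `2` in `m!` is at most `m`. -/
theorem factorial_dvd_two_pow_mul_prod (n m : ℕ) :
    (m.factorial : ℤ) ∣ 2 ^ m * ∏ j ∈ range m, (4 * ((n : ℤ) - j) + 1) := by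
  obtain ⟨v, q, hq, hm⟩ := Nat.exists_eq_two_pow_mul_odd (Nat.factorial_ne_zero m)
  have hv : v ≤ m := by
    have h1 : (2 : ℕ) ^ v ∣ m.factorial := ⟨q, hm⟩
    by_cases hm0 : m = 0
    · subst hm0; simpa using h1
    · have h3 := Nat.emultiplicity_two_factorial_lt hm0
      have h4 : (v : ℕ∞) ≤ emultiplicity 2 m.factorial := le_emultiplicity_of_pow_dvd h1
      exact le_of_lt (by exact_mod_cast h4.trans_lt h3)
  have hcop : IsCoprime (4 : ℤ) (q : ℤ) := by
    have : Nat.Coprime 4 q := by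
      have := (Nat.coprime_two_left.2 hq).pow_left 2
      simpa using this
    exact_mod_cast Nat.isCoprime_iff_coprime.2 this
  obtain ⟨a, b, hab⟩ := hcop
  have hqd : (q : ℤ) ∣ ∏ j ∈ range m, (4 * ((n : ℤ) - j) + 1) := by
    -- modulo the odd part `q` of `m!`, the number `1` is `4 a`, and the product becomes
    -- `4 ^ m * m! * binom(n + a, m)`
    have h1 : (∏ j ∈ range m, (4 * ((n : ℤ) - j) + 1)) ≡
        ∏ j ∈ range m, (4 * ((n : ℤ) + a - j)) [ZMOD q] := by
      refine Int.ModEq.prod fun j _ => ?_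
      refine (Int.emod_emod_of_dvd _ (dvd_refl _)).symm.trans ?_
      rw [Int.emod_emod_of_dvd _ (dvd_refl _)]
      refine (Int.modEq_iff_dvd.2 ⟨-b, ?_⟩)
      linear_combination hab
    have h2 : (∏ j ∈ range m, (4 * ((n : ℤ) + a - j))) =
        4 ^ m * (m.factorial * Ring.choose ((n : ℤ) + a) m) := by
      rw [prod_mul_distrib, prod_const, card_range]
      congr 1
      have := Ring.descPochhammer_eq_factorial_smul_choose ((n : ℤ) + a) m
      rw [← nsmul_eq_mul, ← this, ← Polynomial.eval_eq_smeval, descPochhammer_eval_eq_prod_range]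
    have h3 : (q : ℤ) ∣ ∏ j ∈ range m, (4 * ((n : ℤ) + a - j)) := by
      rw [h2]
      refine Dvd.dvd.mul_left (Dvd.dvd.mul_right ?_ _) _
      rw [hm]; push_cast; exact Dvd.intro_left _ rfl
    exact (Int.ModEq.dvd_iff h1).2 h3
  rw [hm]; push_cast
  exact mul_dvd_mul (pow_dvd_pow _ hv) hqd

/-- The denominators of the Padé coefficients are powers of two, and `8 ^ m` clears them. -/
theorem exists_int_eq_eight_pow_mul_padeCoeff (n m : ℕ) :
    ∃ N : ℤ, (N : ℝ) = 8 ^ m * padeCoeff n m := by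
  obtain ⟨t, ht⟩ := factorial_dvd_two_pow_mul_prod n m
  refine ⟨t * (2 * n - m).choose n, ?_⟩
  have hf : (m.factorial : ℝ) ≠ 0 := by positivity
  have ht' : (2 : ℝ) ^ m * ∏ j ∈ Finset.range m, (4 * ((n : ℝ) - j) + 1) = m.factorial * t := by
    exact_mod_cast congrArg (Int.cast : ℤ → ℝ) ht
  rw [padeCoeff, Finset.prod_div_distrib]
  simp only [Finset.prod_const, Finset.card_range]
  push_cast
  rw [← mul_assoc]
  congr 1
  rw [eq_comm, div_div, mul_div_assoc', div_eq_iff (by positivity)]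
  have h8 : (8 : ℝ) ^ m = 4 ^ m * 2 ^ m := by rw [← mul_pow]; norm_num
  rw [h8, mul_assoc, ht']; ring

/-- The relation that makes the leading term of the derivative of `padeForm n` vanish. -/
theorem padeCoeff_contiguous_zero (n : ℕ) (hn : n ≠ 0) :
    (4 * (n : ℝ) + 1) * padeCoeff n 0 - 8 * padeCoeff n 1 = 0 := by
  obtain ⟨r, rfl⟩ := Nat.exists_eq_succ_of_ne_zero hn
  have h1 : ((2 * (r + 1)).choose (r + 1) : ℝ) = 2 * ((2 * r + 1).choose (r + 1) : ℝ) := by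
    have h2 : (2 * r + 1).choose r = (2 * r + 1).choose (r + 1) :=
      Nat.choose_symm_of_eq_add (by omega)
    have h3 : (2 * (r + 1)).choose (r + 1) = 2 * (2 * r + 1).choose (r + 1) := by
      rw [show 2 * (r + 1) = 2 * r + 1 + 1 by ring, Nat.choose_succ_succ, h2]; ring
    exact_mod_cast h3
  simp only [padeCoeff, Finset.range_zero, Finset.prod_empty, Finset.range_one,
    Finset.prod_singleton, Nat.succ_eq_add_one, Nat.sub_zero,
    show 2 * (r + 1) - 1 = 2 * r + 1 by omega, h1]
  simp
  ring

/-- The relation that makes the derivative of `padeForm (n + 1)` a multiple of `padeForm n`. -/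
theorem padeCoeff_contiguous_succ (n m : ℕ) (h : m ≤ n) :
    (4 * ((n : ℝ) + 1) - 8 * (m + 1) + 1) * padeCoeff (n + 1) (m + 1)
      - 8 * (m + 2) * padeCoeff (n + 1) (m + 2)
      = -((16 * ((n : ℝ) + 1) ^ 2 - 1) / (4 * (n + 1))) * padeCoeff n m := by
  obtain ⟨r, rfl⟩ := Nat.exists_eq_add_of_le h
  have e1 : 2 * (m + r + 1) - (m + 1) = (m + r) + r + 1 := by omega
  have e2 : 2 * (m + r + 1) - (m + 2) = (m + r) + r := by omega
  have e3 : 2 * (m + r) - m = (m + r) + r := by omega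
  have c1 : (((m + r) + r + 1).choose (m + r + 1) : ℝ) * (m + r + 1)
      = (m + r + r + 1) * ((m + r) + r).choose (m + r) := by
    have := Nat.add_one_mul_choose_eq (m + r + r) (m + r)
    have := congrArg (Nat.cast : ℕ → ℝ) this
    push_cast at this
    linarith
  have c2 : (((m + r) + r).choose (m + r + 1) : ℝ) * (m + r + 1)
      = r * ((m + r) + r).choose (m + r) := by
    have := Nat.choose_succ_right_eq (m + r + r) (m + r)
    rw [Nat.add_sub_cancel_left] at this
    have := congrArg (Nat.cast : ℕ → ℝ) this
    push_cast at this
    linarith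
  simp only [padeCoeff]
  rw [e1, e2, e3]
  have p1 : ∏ j ∈ Finset.range (m + 1), ((4 * (((m + r + 1 : ℕ) : ℝ) - j) + 1) / 4)
      = (∏ j ∈ Finset.range m, ((4 * (((m + r : ℕ) : ℝ) - j) + 1) / 4))
        * ((4 * ((m : ℝ) + r + 1) + 1) / 4) := by
    rw [Finset.prod_range_succ']
    push_cast
    congr 1
    · refine Finset.prod_congr rfl fun j _ => by ring
    · ring
  have p2 : ∏ j ∈ Finset.range (m + 2), ((4 * (((m + r + 1 : ℕ) : ℝ) - j) + 1) / 4)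
      = (∏ j ∈ Finset.range m, ((4 * (((m + r : ℕ) : ℝ) - j) + 1) / 4))
        * ((4 * ((m : ℝ) + r + 1) + 1) / 4) * ((4 * (r : ℝ) + 1) / 4) := by
    rw [Finset.prod_range_succ, p1]
    push_cast
    congr 2
    ring
  rw [p1, p2]
  set P := ∏ j ∈ Finset.range m, ((4 * (((m + r : ℕ) : ℝ) - j) + 1) / 4)
  set Q : ℝ := ((m + r + r).choose (m + r) : ℝ)
  have hn : (m : ℝ) + r + 1 ≠ 0 := by positivity
  have c1' : (((m + r) + r + 1).choose (m + r + 1) : ℝ) = (m + r + r + 1) * Q / (m + r + 1) := by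
    rw [eq_div_iff hn]; exact c1
  have c2' : (((m + r) + r).choose (m + r + 1) : ℝ) = r * Q / (m + r + 1) := by
    rw [eq_div_iff hn]; exact c2
  rw [c1', c2']
  have f1 : ((m + 1).factorial : ℝ) = (m + 1) * m.factorial := by
    rw [Nat.factorial_succ]; push_cast; ring
  have f2 : ((m + 2).factorial : ℝ) = (m + 2) * ((m + 1) * m.factorial) := by
    rw [Nat.factorial_succ, Nat.factorial_succ]; push_cast; ring
  rw [f1, f2]
  have hf : (m.factorial : ℝ) ≠ 0 := by positivity
  push_cast
  field_simp
  ring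

/-! ### The Padé forms and their derivatives -/

/-- The Padé form `e^{iθ} A_n` of order `n`, where `A_n = ∑ c_{n,m} (-D)^m u^{n-m}` is the
homogenized numerator of the Padé approximant with coefficients `c_{n,m} = padeCoeff n m`, taken at
`u = e^{4iθ}` and `D = u - u⁻¹ = 2i sin 4θ`. Its imaginary part is the remainder of the
approximation. -/
noncomputable def padeForm (n : ℕ) (θ : ℝ) : ℂ :=
  Complex.exp (θ * Complex.I) * ∑ m ∈ Finset.range (n + 1), (padeCoeff n m : ℂ) *
    (-(2 * Complex.I * Real.sin (4 * θ))) ^ m * Complex.exp (4 * θ * Complex.I) ^ (n - m)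

theorem padeForm_zero (θ : ℝ) : padeForm 0 θ = Complex.exp (θ * Complex.I) := by
  simp [padeForm, padeCoeff]

theorem padeForm_at_zero (n : ℕ) : padeForm n 0 = (n.centralBinom : ℂ) := by
  rw [padeForm, Finset.sum_eq_single 0]
  · simp [padeCoeff_zero_right]
  · intro m _ hm; simp [hm]
  · simp

theorem padeForm_neg (n : ℕ) (θ : ℝ) : padeForm n (-θ) = (starRingEnd ℂ) (padeForm n θ) := by
  simp only [padeForm, map_mul, map_sum, map_pow, map_neg, ← Complex.exp_conj, Complex.conj_I,
    Complex.conj_ofReal, map_ofNat]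
  push_cast
  congr 1
  · congr 1; ring
  · refine Finset.sum_congr rfl fun m _ => ?_
    congr 2
    · rw [mul_neg, Complex.sin_neg]; ring
    · congr 1; ring

theorem exp_four_sub_exp_neg_four (θ : ℝ) :
    Complex.exp (4 * θ * Complex.I) - Complex.exp (-(4 * θ * Complex.I))
      = 2 * Complex.I * Real.sin (4 * θ) := by
  rw [Complex.ofReal_sin, Complex.sin]
  push_cast
  have h1 : -((4 : ℂ) * θ) * Complex.I = -(4 * θ * Complex.I) := by ring
  rw [h1]
  linear_combination (Complex.exp (4 * θ * Complex.I) - Complex.exp (-(4 * θ * Complex.I)))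
    * Complex.I_sq

theorem exp_four_add_exp_neg_four (θ : ℝ) :
    Complex.exp (4 * θ * Complex.I) + Complex.exp (-(4 * θ * Complex.I))
      = 2 * Real.cos (4 * θ) := by
  rw [Complex.ofReal_cos, Complex.cos]
  push_cast
  have h1 : -((4 : ℂ) * θ) * Complex.I = -(4 * θ * Complex.I) := by ring
  rw [h1]
  ring

/-- The monomial `e^{iθ} (-D)^m u^j` occurring in `padeForm`. -/
noncomputable def padeMonomial (m j : ℕ) (θ : ℝ) : ℂ :=
  (-(2 * Complex.I * Real.sin (4 * θ))) ^ m * Complex.exp ((4 * j + 1) * θ * Complex.I)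

theorem padeForm_eq_sum (n : ℕ) (θ : ℝ) : padeForm n θ =
    ∑ m ∈ Finset.range (n + 1), (padeCoeff n m : ℂ) * padeMonomial m (n - m) θ := by
  rw [padeForm, Finset.mul_sum]
  refine Finset.sum_congr rfl fun m _ => ?_
  rw [padeMonomial, ← Complex.exp_nat_mul]
  have : Complex.exp ((4 * ((n - m : ℕ) : ℂ) + 1) * θ * Complex.I) =
      Complex.exp (θ * Complex.I) * Complex.exp (((n - m : ℕ) : ℂ) * (4 * θ * Complex.I)) := by
    rw [← Complex.exp_add]; congr 1; ring
  rw [this]; ring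

theorem padeMonomial_succ_left (m j : ℕ) (θ : ℝ) : padeMonomial (m + 1) j θ =
    -(2 * Complex.I * Real.sin (4 * θ)) * padeMonomial m j θ := by
  simp only [padeMonomial]; ring

theorem hasDerivAt_padeMonomial_zero (j : ℕ) (θ : ℝ) :
    HasDerivAt (padeMonomial 0 j) (Complex.I * (4 * j + 1) * padeMonomial 0 j θ) θ := by
  have h1 : HasDerivAt (fun θ : ℝ => (4 * (j : ℂ) + 1) * θ * Complex.I)
      ((4 * (j : ℂ) + 1) * 1 * Complex.I) θ :=
    (((hasDerivAt_id θ).ofReal_comp).const_mul _).mul_const _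
  have h2 := h1.cexp
  have e : padeMonomial 0 j = fun θ : ℝ => Complex.exp ((4 * (j : ℂ) + 1) * θ * Complex.I) := by
    funext t; simp [padeMonomial]
  rw [e]
  convert h2 using 1
  ring

theorem hasDerivAt_padeMonomial_succ (m j : ℕ) (θ : ℝ) :
    HasDerivAt (padeMonomial (m + 1) j) (Complex.I * ((4 * (j : ℂ) + 1 - 4 * (m + 1))
      * padeMonomial (m + 1) j θ - 8 * (m + 1) * padeMonomial m (j + 1) θ)) θ := by
  have h1 : HasDerivAt (fun θ : ℝ => (4 * (j : ℂ) + 1) * θ * Complex.I)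
      ((4 * (j : ℂ) + 1) * 1 * Complex.I) θ :=
    (((hasDerivAt_id θ).ofReal_comp).const_mul _).mul_const _
  have h2 := h1.cexp
  have h3 : HasDerivAt (fun θ : ℝ => Real.sin (4 * θ)) (Real.cos (4 * θ) * (4 * 1)) θ :=
    ((hasDerivAt_id θ).const_mul 4).sin
  have h4 := (((h3.ofReal_comp).const_mul (2 * Complex.I)).neg.pow (m + 1)).mul h2
  have e : padeMonomial (m + 1) j = fun θ : ℝ =>
      (-(2 * Complex.I * ((Real.sin (4 * θ) : ℝ) : ℂ))) ^ (m + 1) *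
        Complex.exp ((4 * (j : ℂ) + 1) * θ * Complex.I) := by
    funext t; simp [padeMonomial]
  rw [e]
  refine HasDerivAt.congr_deriv (f := fun θ : ℝ =>
      (-(2 * Complex.I * ((Real.sin (4 * θ) : ℝ) : ℂ))) ^ (m + 1) *
        Complex.exp ((4 * (j : ℂ) + 1) * θ * Complex.I)) h4 ?_
  have e2 : padeMonomial m (j + 1) θ = (-(2 * Complex.I * Real.sin (4 * θ))) ^ m *
      (Complex.exp ((4 * (j : ℂ) + 1) * θ * Complex.I) * Complex.exp (4 * θ * Complex.I)) := by
    rw [padeMonomial, ← Complex.exp_add]; push_cast; congr 2; ring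
  have e3 : Complex.exp (4 * θ * Complex.I) = Real.cos (4 * θ) + Complex.I * Real.sin (4 * θ) := by
    linear_combination (exp_four_sub_exp_neg_four θ) / 2 + (exp_four_add_exp_neg_four θ) / 2
  rw [e2, e3]
  simp only [Nat.add_sub_cancel, Pi.pow_apply, Pi.neg_apply, Nat.cast_add, Nat.cast_one]
  push_cast
  ring

/-- The derivative of a Padé form is a multiple of the form of the preceding order. The recurrence, the
nonvanishing and both estimates of the forms are read off from this. -/
theorem hasDerivAt_padeForm (n : ℕ) (θ : ℝ) :
    HasDerivAt (padeForm (n + 1)) (((-((16 * ((n : ℝ) + 1) ^ 2 - 1) / (2 * (n + 1)))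
      * Real.sin (4 * θ) : ℝ) : ℂ) * padeForm n θ) θ := by
  have e : padeForm (n + 1) = fun θ => ∑ m ∈ Finset.range (n + 2),
      (padeCoeff (n + 1) m : ℂ) * padeMonomial m (n + 1 - m) θ := by
    funext t; exact padeForm_eq_sum _ _
  rw [e]
  -- the derivative of each term, with the monomial of lower degree in `D` split off
  set a : ℕ → ℂ := fun m => (padeCoeff (n + 1) m : ℂ) * (Complex.I *
    ((4 * ((n : ℂ) + 1) - 8 * m + 1) * padeMonomial m (n + 1 - m) θ)) with ha
  set b : ℕ → ℂ := fun m => (padeCoeff (n + 1) m : ℂ) * (Complex.I *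
    (8 * m * padeMonomial (m - 1) (n + 1 - (m - 1)) θ)) with hb
  have hd : HasDerivAt (fun θ => ∑ m ∈ Finset.range (n + 2),
      (padeCoeff (n + 1) m : ℂ) * padeMonomial m (n + 1 - m) θ)
      (∑ m ∈ Finset.range (n + 2), (a m - b m)) θ := by
    refine HasDerivAt.fun_sum fun m hm => ?_
    have hm' : m ≤ n + 1 := Nat.lt_succ_iff.1 (Finset.mem_range.1 hm)
    rcases m with _ | m
    · refine ((hasDerivAt_padeMonomial_zero (n + 1) θ).const_mul
        (padeCoeff (n + 1) 0 : ℂ)).congr_deriv ?_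
      simp only [ha, hb, Nat.sub_zero]
      push_cast; ring
    · refine ((hasDerivAt_padeMonomial_succ m (n + 1 - (m + 1)) θ).const_mul
        (padeCoeff (n + 1) (m + 1) : ℂ)).congr_deriv ?_
      have h1 : n + 1 - (m + 1) + 1 = n + 1 - m := by omega
      have h2 : ((n + 1 - (m + 1) : ℕ) : ℂ) = n - m := by
        rw [Nat.cast_sub hm']; push_cast; ring
      simp only [ha, hb, h1, h2, Nat.add_sub_cancel]
      push_cast; ring
  refine hd.congr_deriv ?_
  rw [Finset.sum_sub_distrib, Finset.sum_range_succ' b, Finset.sum_range_succ' a]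
  have hb0 : b 0 = 0 := by simp [hb]
  have hlast : b (n + 1 + 1) = 0 := by
    simp [hb, padeCoeff_eq_zero (n := n + 1) (m := n + 1 + 1) (by omega) (by omega)]
  have hs : ∑ k ∈ Finset.range (n + 1), b (k + 1) =
      ∑ k ∈ Finset.range (n + 1), b (k + 1 + 1) + b 1 := by
    have := Finset.sum_range_succ' (fun k => b (k + 1)) (n + 1)
    rw [Finset.sum_range_succ, hlast, add_zero] at this
    simpa using this
  have h0 : a 0 = b 1 := by
    have := padeCoeff_contiguous_zero (n + 1) (by omega)
    have hc : (4 * ((n : ℂ) + 1) + 1) * padeCoeff (n + 1) 0 - 8 * padeCoeff (n + 1) 1 = 0 := by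
      exact_mod_cast congrArg (Complex.ofReal) this
    simp only [ha, hb, Nat.sub_self, Nat.sub_zero]
    push_cast
    linear_combination Complex.I * padeMonomial 0 (n + 1) θ * hc
  rw [hb0, hs, h0]
  have hmain : ∀ m ∈ Finset.range (n + 1), a (m + 1) - b (m + 1 + 1) =
      ((-((16 * ((n : ℝ) + 1) ^ 2 - 1) / (2 * (n + 1)))
      * Real.sin (4 * θ) : ℝ) : ℂ) * ((padeCoeff n m : ℂ) * padeMonomial m (n - m) θ) := by
    intro m hm
    have hm' : m ≤ n := Nat.lt_succ_iff.1 (Finset.mem_range.1 hm)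
    have := padeCoeff_contiguous_succ n m hm'
    have hc : (4 * ((n : ℂ) + 1) - 8 * (m + 1) + 1) * padeCoeff (n + 1) (m + 1)
        - 8 * (m + 2) * padeCoeff (n + 1) (m + 2)
        = -((16 * ((n : ℂ) + 1) ^ 2 - 1) / (4 * (n + 1))) * padeCoeff n m := by
      exact_mod_cast congrArg (Complex.ofReal) this
    have e1 : n + 1 - (m + 1) = n - m := by omega
    simp only [ha, hb, Nat.add_sub_cancel, e1]
    rw [padeMonomial_succ_left]
    have hn : (n : ℂ) + 1 ≠ 0 := by exact_mod_cast Nat.succ_ne_zero n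
    push_cast
    have hI := Complex.I_sq
    have hc2 : -((16 * ((n : ℂ) + 1) ^ 2 - 1) / (2 * (n + 1)))
        = 2 * -((16 * ((n : ℂ) + 1) ^ 2 - 1) / (4 * (n + 1))) := by field_simp; ring
    rw [hc2]
    linear_combination (-2 * Complex.sin (4 * θ) * padeMonomial m (n - m) θ * Complex.I ^ 2) * hc
      + (-2 * Complex.sin (4 * θ) * padeMonomial m (n - m) θ
        * (-((16 * ((n : ℂ) + 1) ^ 2 - 1) / (4 * (n + 1))) * padeCoeff n m)) * hI
  rw [padeForm_eq_sum, Finset.mul_sum, ← Finset.sum_congr rfl hmain, Finset.sum_sub_distrib]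
  ring

theorem padeForm_one (θ : ℝ) : padeForm 1 θ =
    (((2 * Real.cos (4 * θ) : ℝ) : ℂ) - ((Real.sin (4 * θ) / 2 : ℝ) : ℂ) * Complex.I)
      * padeForm 0 θ := by
  have e3 : Complex.exp (4 * θ * Complex.I) = Real.cos (4 * θ) + Complex.I * Real.sin (4 * θ) := by
    linear_combination (exp_four_sub_exp_neg_four θ) / 2 + (exp_four_add_exp_neg_four θ) / 2
  rw [padeForm_zero, padeForm, e3]
  simp [Finset.sum_range_succ, padeCoeff]
  ring

/-! ### Recurrence, nonvanishing and estimates of the Padé forms -/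

theorem eq_of_hasDerivAt_eq {f g f' : ℝ → ℂ} (hf : ∀ x, HasDerivAt f (f' x) x)
    (hg : ∀ x, HasDerivAt g (f' x) x) (h0 : f 0 = g 0) (x : ℝ) : f x = g x := by
  have h : ∀ x, HasDerivAt (fun x => f x - g x) 0 x := fun x => by
    simpa using (hf x).fun_sub (hg x)
  have := is_const_of_deriv_eq_zero (fun x => (h x).differentiableAt) (fun x => (h x).deriv) x 0
  simp only [h0, sub_self] at this
  exact sub_eq_zero.1 this

/-- The three-term recurrence of the Padé forms. Both sides have the same derivative and the same
value at `0`. -/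
theorem padeForm_add_two (n : ℕ) : ∀ θ : ℝ, padeForm (n + 2) θ =
    (((4 * (n : ℝ) + 6) / (n + 2) * Real.cos (4 * θ) : ℝ) : ℂ) * padeForm (n + 1) θ
      + (((16 * ((n : ℝ) + 1) ^ 2 - 1) / (4 * (n + 1) * (n + 2)) * Real.sin (4 * θ) ^ 2 : ℝ) : ℂ)
        * padeForm n θ := by
  have hsin : ∀ θ : ℝ, HasDerivAt (fun θ : ℝ => Real.sin (4 * θ)) (Real.cos (4 * θ) * (4 * 1)) θ :=
    fun θ => ((hasDerivAt_id θ).const_mul 4).sin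
  have hcos : ∀ θ : ℝ, HasDerivAt (fun θ : ℝ => Real.cos (4 * θ)) (-Real.sin (4 * θ) * (4 * 1)) θ :=
    fun θ => ((hasDerivAt_id θ).const_mul 4).cos
  have hn1 : ∀ n : ℕ, (n : ℂ) + 1 ≠ 0 := fun n => by exact_mod_cast Nat.succ_ne_zero n
  have hn2 : ∀ n : ℕ, (n : ℂ) + 2 ≠ 0 := fun n => by exact_mod_cast Nat.succ_ne_zero (n + 1)
  have hn3 : ∀ n : ℕ, (n : ℂ) + 3 ≠ 0 := fun n => by exact_mod_cast Nat.succ_ne_zero (n + 2)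
  have hzero : ∀ n : ℕ, padeForm (n + 2) 0 =
      (((4 * (n : ℝ) + 6) / (n + 2) * Real.cos (4 * 0) : ℝ) : ℂ) * padeForm (n + 1) 0
      + (((16 * ((n : ℝ) + 1) ^ 2 - 1) / (4 * (n + 1) * (n + 2)) * Real.sin (4 * 0) ^ 2 : ℝ) : ℂ)
        * padeForm n 0 := by
    intro n
    have h := Nat.succ_mul_centralBinom_succ (n + 1)
    have h' : ((n : ℂ) + 2) * (n + 2).centralBinom = 2 * (2 * (n + 1) + 1)
        * (n + 1).centralBinom := by exact_mod_cast h
    simp only [padeForm_at_zero, mul_zero, Real.cos_zero, Real.sin_zero]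
    push_cast
    have h2 : ((n + 2).centralBinom : ℂ) = (4 * n + 6) / (n + 2) * (n + 1).centralBinom := by
      rw [div_mul_eq_mul_div, eq_div_iff (hn2 n)]
      linear_combination h'
    rw [h2]
    ring
  induction n with
  | zero =>
    refine eq_of_hasDerivAt_eq (hasDerivAt_padeForm 1) (fun θ => ?_) (by simpa using hzero 0)
    have h0 : HasDerivAt (padeForm 0) (Complex.I * padeForm 0 θ) θ := by
      have h1 := ((hasDerivAt_id θ).ofReal_comp.mul_const Complex.I).cexp
      have e : padeForm 0 = fun θ : ℝ => Complex.exp (θ * Complex.I) := funext padeForm_zero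
      rw [e]
      refine HasDerivAt.congr_deriv (f := fun θ : ℝ => Complex.exp (θ * Complex.I)) h1 ?_
      simp [mul_comm]
    have hA := (((hcos θ).const_mul ((4 * ((0 : ℕ) : ℝ) + 6) / ((0 : ℕ) + 2))).ofReal_comp).mul
      (hasDerivAt_padeForm 0 θ)
    have hB := ((((hsin θ).pow 2).const_mul ((16 * (((0 : ℕ) : ℝ) + 1) ^ 2 - 1)
      / (4 * ((0 : ℕ) + 1) * ((0 : ℕ) + 2)))).ofReal_comp).mul h0
    refine HasDerivAt.congr_deriv (f := fun θ : ℝ =>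
      (((4 * ((0 : ℕ) : ℝ) + 6) / ((0 : ℕ) + 2) * Real.cos (4 * θ) : ℝ) : ℂ) * padeForm (0 + 1) θ
      + (((16 * (((0 : ℕ) : ℝ) + 1) ^ 2 - 1) / (4 * ((0 : ℕ) + 1) * ((0 : ℕ) + 2))
        * Real.sin (4 * θ) ^ 2 : ℝ) : ℂ) * padeForm 0 θ) (hA.add hB) ?_
    simp only [Pi.pow_apply, zero_add, padeForm_one]
    push_cast
    ring
  | succ n ih =>
    refine eq_of_hasDerivAt_eq (hasDerivAt_padeForm (n + 2)) (fun θ => ?_) (hzero (n + 1))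
    have hA := (((hcos θ).const_mul ((4 * ((n + 1 : ℕ) : ℝ) + 6) / ((n + 1 : ℕ) + 2))).ofReal_comp).mul
      (hasDerivAt_padeForm (n + 1) θ)
    have hB := ((((hsin θ).pow 2).const_mul ((16 * (((n + 1 : ℕ) : ℝ) + 1) ^ 2 - 1)
      / (4 * ((n + 1 : ℕ) + 1) * ((n + 1 : ℕ) + 2)))).ofReal_comp).mul (hasDerivAt_padeForm n θ)
    refine HasDerivAt.congr_deriv (f := fun θ : ℝ =>
      (((4 * ((n + 1 : ℕ) : ℝ) + 6) / ((n + 1 : ℕ) + 2) * Real.cos (4 * θ) : ℝ) : ℂ)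
        * padeForm (n + 1 + 1) θ
      + (((16 * (((n + 1 : ℕ) : ℝ) + 1) ^ 2 - 1) / (4 * ((n + 1 : ℕ) + 1) * ((n + 1 : ℕ) + 2))
        * Real.sin (4 * θ) ^ 2 : ℝ) : ℂ) * padeForm (n + 1) θ) (hA.add hB) ?_
    simp only [Pi.pow_apply, show n + 1 + 1 = n + 2 from rfl, ih θ]
    have := hn1 n
    have := hn2 n
    have := hn3 n
    have h3 : (n : ℂ) + 1 + 1 = n + 2 := by ring
    have h4 : (n : ℂ) + 1 + 2 = n + 3 := by ring
    have h5 : (n : ℂ) + 2 + 1 = n + 3 := by ring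
    push_cast
    rw [h3, h4, h5]
    field_simp
    ring

/-- Two consecutive Padé forms are not real multiples of each other: the analogue of the nonvanishing
determinant of consecutive Padé approximants. -/
theorem im_padeForm_mul_conj_ne_zero {θ : ℝ} (hθ : Real.sin (4 * θ) ≠ 0) (n : ℕ) :
    (padeForm n θ * (starRingEnd ℂ) (padeForm (n + 1) θ)).im ≠ 0 := by
  induction n with
  | zero =>
    rw [zero_add, padeForm_one, padeForm_zero, map_mul, ← mul_assoc, mul_comm, ← mul_assoc,
      ← Complex.normSq_eq_conj_mul_self, Complex.normSq_eq_norm_sq, Complex.norm_exp_ofReal_mul_I]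
    have hs : Real.sin (4 * θ) / 2 ≠ 0 := div_ne_zero hθ two_ne_zero
    generalize 2 * Real.cos (4 * θ) = c
    generalize Real.sin (4 * θ) / 2 = s at hs
    simpa [Complex.conj_ofReal] using hs
  | succ n ih =>
    have hq : (16 * ((n : ℝ) + 1) ^ 2 - 1) / (4 * (n + 1) * (n + 2)) * Real.sin (4 * θ) ^ 2 ≠ 0 := by
      have : 0 < 16 * ((n : ℝ) + 1) ^ 2 - 1 := by nlinarith [(Nat.cast_nonneg n : (0 : ℝ) ≤ n)]
      positivity
    rw [show n + 1 + 1 = n + 2 from rfl, padeForm_add_two]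
    set p := (4 * (n : ℝ) + 6) / (n + 2) * Real.cos (4 * θ)
    set q := (16 * ((n : ℝ) + 1) ^ 2 - 1) / (4 * (n + 1) * (n + 2)) * Real.sin (4 * θ) ^ 2
    have : (padeForm (n + 1) θ * (starRingEnd ℂ) ((p : ℂ) * padeForm (n + 1) θ
        + (q : ℂ) * padeForm n θ)).im
        = -q * (padeForm n θ * (starRingEnd ℂ) (padeForm (n + 1) θ)).im := by
      simp only [map_add, map_mul, Complex.conj_ofReal, Complex.mul_im, Complex.add_re,
        Complex.add_im, Complex.mul_re, Complex.conj_re, Complex.conj_im, Complex.ofReal_re,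
        Complex.ofReal_im]
      ring
    rw [this]
    exact mul_ne_zero (neg_ne_zero.2 hq) ih

theorem norm_le_of_norm_deriv_le {f f' : ℝ → ℂ} {B B' : ℝ → ℝ} (hf : ∀ x, HasDerivAt f (f' x) x)
    (hB : ∀ x, HasDerivAt B (B' x) x) (h0 : ‖f 0‖ ≤ B 0) (h : ∀ x, 0 ≤ x → ‖f' x‖ ≤ B' x)
    {x : ℝ} (hx : 0 ≤ x) : ‖f x‖ ≤ B x :=
  image_norm_le_of_norm_deriv_right_le_deriv_boundary (a := 0) (b := x)
    (fun y _ => (hf y).continuousAt.continuousWithinAt) (fun y _ => (hf y).hasDerivWithinAt) h0 hB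
    (fun y hy => h y hy.1) ⟨hx, le_rfl⟩

theorem abs_sin_four_mul_le {x : ℝ} (hx : 0 ≤ x) : |Real.sin (4 * x)| ≤ 4 * x := by
  have := Real.abs_sin_le_abs (x := 4 * x)
  rwa [abs_of_nonneg (by positivity : 0 ≤ 4 * x)] at this

/-- The size of the Padé form, obtained by integrating `hasDerivAt_padeForm`. -/
theorem norm_padeForm_le (n : ℕ) : ∀ θ : ℝ,
    ‖padeForm n θ‖ ≤ n.centralBinom * (1 + 8 * θ ^ 2) ^ n := by
  suffices h : ∀ θ : ℝ, 0 ≤ θ → ‖padeForm n θ‖ ≤ n.centralBinom * (1 + 8 * θ ^ 2) ^ n by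
    intro θ
    rcases le_total 0 θ with h0 | h0
    · exact h θ h0
    · have := h (-θ) (by linarith)
      rwa [padeForm_neg, RCLike.norm_conj, neg_sq] at this
  induction n with
  | zero => intro θ _; simp [padeForm_zero, Complex.norm_exp_ofReal_mul_I]
  | succ n ih =>
    intro θ hθ
    have hB : ∀ x : ℝ, HasDerivAt (fun x : ℝ => ((n + 1).centralBinom : ℝ) * (1 + 8 * x ^ 2) ^ (n + 1))
        (((n + 1).centralBinom : ℝ) * (((n + 1 : ℕ) : ℝ) * (1 + 8 * x ^ 2) ^ n * (8 * (2 * x)))) x := by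
      intro x
      have h1 : HasDerivAt (fun x : ℝ => 1 + 8 * x ^ 2) (8 * (2 * x)) x := by
        simpa using ((hasDerivAt_pow 2 x).const_mul 8).const_add 1
      exact (h1.fun_pow (n + 1)).const_mul _
    refine norm_le_of_norm_deriv_le (hasDerivAt_padeForm n) hB ?_ (fun x hx => ?_) hθ
    · simp [padeForm_at_zero]
    · have hK : 0 < 16 * ((n : ℝ) + 1) ^ 2 - 1 := by nlinarith [(Nat.cast_nonneg n : (0 : ℝ) ≤ n)]
      have hn : (0 : ℝ) < n + 1 := by positivity
      rw [norm_mul, Complex.norm_real, Real.norm_eq_abs, abs_mul, abs_neg,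
        abs_of_nonneg (by positivity : 0 ≤ (16 * ((n : ℝ) + 1) ^ 2 - 1) / (2 * (n + 1)))]
      have hc : 2 * (n.centralBinom : ℝ) ≤ (n + 1).centralBinom := by
        have h := Nat.succ_mul_centralBinom_succ n
        have h' : ((n : ℝ) + 1) * (n + 1).centralBinom = 2 * (2 * n + 1) * n.centralBinom := by
          exact_mod_cast h
        have h2 : (0 : ℝ) ≤ n.centralBinom := by positivity
        have h3 : ((n : ℝ) + 1) * (2 * n.centralBinom) ≤ (n + 1) * (n + 1).centralBinom := by
          rw [h']; nlinarith [(Nat.cast_nonneg n : (0 : ℝ) ≤ n)]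
        exact le_of_mul_le_mul_left h3 hn
      have hk : (16 * ((n : ℝ) + 1) ^ 2 - 1) / (2 * (n + 1)) ≤ 8 * (n + 1) := by
        rw [div_le_iff₀ (by positivity)]; nlinarith
      calc (16 * ((n : ℝ) + 1) ^ 2 - 1) / (2 * (n + 1)) * |Real.sin (4 * x)| * ‖padeForm n x‖
          ≤ 8 * (n + 1) * (4 * x) * (n.centralBinom * (1 + 8 * x ^ 2) ^ n) := by
            gcongr
            · exact abs_sin_four_mul_le hx
            · exact ih x hx
        _ = (2 * n.centralBinom) * (((n : ℝ) + 1) * (1 + 8 * x ^ 2) ^ n * (8 * (2 * x))) := by ring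
        _ ≤ _ := by
            push_cast
            gcongr

/-- The remainder of the approximation vanishes at `0` to order `2 n + 1`, again by integrating
`hasDerivAt_padeForm`. -/
theorem abs_im_padeForm_le (n : ℕ) : ∀ θ : ℝ,
    |(padeForm (n + 1) θ).im| ≤ 5 / 8 * 16 ^ (n + 1) * |θ| ^ (2 * (n + 1) + 1) := by
  suffices h : ∀ θ : ℝ, 0 ≤ θ →
      |(padeForm (n + 1) θ).im| ≤ 5 / 8 * 16 ^ (n + 1) * θ ^ (2 * (n + 1) + 1) by
    intro θ
    rcases le_total 0 θ with h0 | h0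
    · rw [abs_of_nonneg h0]; exact h θ h0
    · have := h (-θ) (by linarith)
      rwa [padeForm_neg, Complex.conj_im, abs_neg, ← abs_of_nonpos h0] at this
  have him : ∀ n θ, HasDerivAt (fun θ => (((padeForm (n + 1) θ).im : ℝ) : ℂ))
      (((-((16 * ((n : ℝ) + 1) ^ 2 - 1) / (2 * (n + 1))) * Real.sin (4 * θ)
        * (padeForm n θ).im : ℝ)) : ℂ) θ := by
    intro n θ
    have h1 : HasDerivAt (fun θ => (padeForm (n + 1) θ).im)
      (-((16 * ((n : ℝ) + 1) ^ 2 - 1) / (2 * (n + 1))) * Real.sin (4 * θ)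
        * (padeForm n θ).im) θ := by
      refine HasDerivAt.congr_deriv
        (Complex.imCLM.hasFDerivAt.comp_hasDerivAt θ (hasDerivAt_padeForm n θ)) ?_
      rw [Complex.imCLM_apply, Complex.im_ofReal_mul]
    exact h1.ofReal_comp
  induction n with
  | zero =>
    intro θ hθ
    have hB : ∀ x : ℝ, HasDerivAt (fun x : ℝ => 10 * x ^ 3) (10 * (3 * x ^ 2)) x := fun x => by
      simpa using (hasDerivAt_pow 3 x).const_mul 10
    have := norm_le_of_norm_deriv_le (him 0) hB (by simp [padeForm_at_zero]) (fun x hx => ?_) hθ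
    · rw [Complex.norm_real, Real.norm_eq_abs] at this
      refine this.trans (le_of_eq ?_); norm_num
    · rw [Complex.norm_real, Real.norm_eq_abs, abs_mul, abs_mul, padeForm_zero,
        Complex.exp_ofReal_mul_I_im]
      have h1 := abs_sin_four_mul_le hx
      have h2 := Real.abs_sin_le_abs (x := x)
      rw [abs_of_nonneg hx] at h2
      have h3 : |(-((16 * (((0 : ℕ) : ℝ) + 1) ^ 2 - 1) / (2 * (((0 : ℕ) : ℝ) + 1))))| = 15 / 2 := by
        norm_num [abs_of_pos]
      rw [h3]
      calc 15 / 2 * |Real.sin (4 * x)| * |Real.sin x| ≤ 15 / 2 * (4 * x) * x := by gcongr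
        _ = _ := by ring
  | succ n ih =>
    intro θ hθ
    have hB : ∀ x : ℝ, HasDerivAt (fun x : ℝ => 5 / 8 * 16 ^ (n + 2) * x ^ (2 * (n + 2) + 1))
        (5 / 8 * 16 ^ (n + 2) * (((2 * (n + 2) + 1 : ℕ) : ℝ) * x ^ (2 * (n + 2)))) x := fun x => by
      simpa using (hasDerivAt_pow (2 * (n + 2) + 1) x).const_mul (5 / 8 * 16 ^ (n + 2))
    have := norm_le_of_norm_deriv_le (him (n + 1)) hB (by simp [padeForm_at_zero])
      (fun x hx => ?_) hθ
    · rwa [Complex.norm_real, Real.norm_eq_abs] at this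
    · have hK : 0 < 16 * (((n + 1 : ℕ) : ℝ) + 1) ^ 2 - 1 := by
        nlinarith [(Nat.cast_nonneg (n + 1) : (0 : ℝ) ≤ (n + 1 : ℕ))]
      rw [Complex.norm_real, Real.norm_eq_abs, abs_mul, abs_mul, abs_neg,
        abs_of_nonneg (by positivity :
          0 ≤ (16 * (((n + 1 : ℕ) : ℝ) + 1) ^ 2 - 1) / (2 * (((n + 1 : ℕ) : ℝ) + 1)))]
      have hk : (16 * (((n + 1 : ℕ) : ℝ) + 1) ^ 2 - 1) / (2 * (((n + 1 : ℕ) : ℝ) + 1))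
          ≤ 8 * (n + 2) := by
        rw [div_le_iff₀ (by positivity)]; push_cast; nlinarith
      calc (16 * (((n + 1 : ℕ) : ℝ) + 1) ^ 2 - 1) / (2 * (((n + 1 : ℕ) : ℝ) + 1))
            * |Real.sin (4 * x)| * |(padeForm (n + 1) x).im|
          ≤ 8 * (n + 2) * (4 * x) * (5 / 8 * 16 ^ (n + 1) * x ^ (2 * (n + 1) + 1)) := by
            gcongr
            · exact abs_sin_four_mul_le hx
            · exact ih x hx
        _ = 5 / 8 * 16 ^ (n + 2) * ((2 * (n + 2)) * x ^ (2 * (n + 2))) := by ring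
        _ ≤ _ := by
            push_cast
            gcongr
            linarith

/-! ### Arithmetic of the values of the Padé forms -/

/-- The integers for even `n`, and the additive group `T` for odd `n`. -/
noncomputable def parityLattice (T : AddSubgroup ℝ) (n : ℕ) : AddSubgroup ℝ :=
  if Even n then AddSubgroup.zmultiples 1 else T

/-- Products of two elements of `T` are integers. -/
def HasIntegralProducts (T : AddSubgroup ℝ) : Prop :=
  ∀ a ∈ T, ∀ b ∈ T, ∃ n : ℤ, a * b = n

theorem mem_zmultiples_one_iff {x : ℝ} :
    x ∈ AddSubgroup.zmultiples (1 : ℝ) ↔ ∃ n : ℤ, x = n := by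
  simp [AddSubgroup.mem_zmultiples_iff, eq_comm]

theorem mul_mem_parityLattice {T : AddSubgroup ℝ} (hT : HasIntegralProducts T) {m n : ℕ} {a b : ℝ}
    (ha : a ∈ parityLattice T m) (hb : b ∈ parityLattice T n) : a * b ∈ parityLattice T (m + n) := by
  unfold parityLattice at *
  by_cases hm : Even m <;> by_cases hn : Even n
  · simp only [hm, hn, hm.add hn, if_true, mem_zmultiples_one_iff] at *
    obtain ⟨p, rfl⟩ := ha
    obtain ⟨q, rfl⟩ := hb
    exact ⟨p * q, by push_cast; ring⟩
  · have h : ¬Even (m + n) := by rw [Nat.even_add]; tauto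
    simp only [hm, hn, h, if_true, if_false, mem_zmultiples_one_iff] at *
    obtain ⟨p, rfl⟩ := ha
    simpa using T.zsmul_mem hb p
  · have h : ¬Even (m + n) := by rw [Nat.even_add]; tauto
    simp only [hm, hn, h, if_true, if_false, mem_zmultiples_one_iff] at *
    obtain ⟨p, rfl⟩ := hb
    simpa [mul_comm] using T.zsmul_mem ha p
  · have h : Even (m + n) := by rw [Nat.even_add]; tauto
    simp only [hm, hn, h, if_true, if_false, mem_zmultiples_one_iff] at *
    exact hT a ha b hb

theorem parityLattice_add_two (T : AddSubgroup ℝ) (n : ℕ) :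
    parityLattice T (n + 2) = parityLattice T n := by
  simp [parityLattice, Nat.even_add]

theorem intCast_mem_parityLattice_zero (T : AddSubgroup ℝ) (n : ℤ) :
    (n : ℝ) ∈ parityLattice T 0 := by
  simp [parityLattice]

theorem parityLattice_one (T : AddSubgroup ℝ) : parityLattice T 1 = T := by
  simp [parityLattice]

/-- Complex numbers whose real part and whose imaginary part divided by `s` lie in the lattices of
parity `n` and `n + 1`. For `s ^ 2` an integer this is the degree `n` part of a `ℤ/2`-graded ring,
which contains all the algebraic integers needed in the approximation argument. -/
def gradedPart (T : AddSubgroup ℝ) (s : ℝ) (n : ℕ) : AddSubgroup ℂ where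
  carrier := {z | z.re ∈ parityLattice T n ∧ ∃ t ∈ parityLattice T (n + 1), z.im = s * t}
  zero_mem' := ⟨zero_mem _, 0, zero_mem _, by simp⟩
  add_mem' := by
    rintro z w ⟨h1, t, ht, h2⟩ ⟨h3, t', ht', h4⟩
    exact ⟨add_mem h1 h3, t + t', add_mem ht ht', by rw [Complex.add_im, h2, h4]; ring⟩
  neg_mem' := by
    rintro z ⟨h1, t, ht, h2⟩
    exact ⟨neg_mem h1, -t, neg_mem ht, by rw [Complex.neg_im, h2]; ring⟩

theorem mul_mem_gradedPart {T : AddSubgroup ℝ} (hT : HasIntegralProducts T) {s : ℝ} {k : ℤ}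
    (hs : s ^ 2 = k) {m n : ℕ} {z w : ℂ} (hz : z ∈ gradedPart T s m) (hw : w ∈ gradedPart T s n) :
    z * w ∈ gradedPart T s (m + n) := by
  obtain ⟨h1, t, ht, h2⟩ := hz
  obtain ⟨h3, t', ht', h4⟩ := hw
  refine ⟨?_, t' * z.re + t * w.re, ?_, ?_⟩
  · have h5 : t * t' ∈ parityLattice T (m + n) := by
      have := mul_mem_parityLattice hT ht ht'
      rwa [show m + 1 + (n + 1) = m + n + 2 by ring, parityLattice_add_two] at this
    have h6 := sub_mem (mul_mem_parityLattice hT h1 h3) (zsmul_mem h5 k)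
    convert h6 using 1
    rw [Complex.mul_re, h2, h4, zsmul_eq_mul, ← hs]
    ring
  · refine add_mem ?_ ?_
    · have := mul_mem_parityLattice hT ht' h1
      rwa [show n + 1 + m = m + n + 1 by ring] at this
    · have := mul_mem_parityLattice hT ht h3
      rwa [show m + 1 + n = m + n + 1 by ring] at this
  · rw [Complex.mul_im, h2, h4]; ring

theorem pow_mem_gradedPart {T : AddSubgroup ℝ} (hT : HasIntegralProducts T) {s : ℝ} {k : ℤ}
    (hs : s ^ 2 = k) {z : ℂ} (hz : z ∈ gradedPart T s 1) (n : ℕ) : z ^ n ∈ gradedPart T s n := by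
  induction n with
  | zero =>
    refine ⟨?_, 0, zero_mem _, by simp⟩
    simpa using intCast_mem_parityLattice_zero T 1
  | succ n ih => rw [pow_succ]; exact mul_mem_gradedPart hT hs ih hz

theorem le_abs_im_of_mem_gradedPart {T : AddSubgroup ℝ} (hT : HasIntegralProducts T) {s : ℝ}
    (hs0 : 0 ≤ s) {n : ℕ} {z : ℂ} (hz : z ∈ gradedPart T s n) (h0 : z.im ≠ 0) : s ≤ |z.im| := by
  obtain ⟨-, t, ht, h⟩ := hz
  rw [h] at h0 ⊢
  have ht0 : t ≠ 0 := right_ne_zero_of_mul h0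
  have h2 := mul_mem_parityLattice hT ht ht
  have he : Even (n + 1 + (n + 1)) := ⟨n + 1, rfl⟩
  rw [parityLattice, if_pos he, mem_zmultiples_one_iff] at h2
  obtain ⟨p, hp⟩ := h2
  have hp0 : (0 : ℝ) < p := by rw [← hp]; exact mul_self_pos.2 ht0
  have hp1 : (1 : ℝ) ≤ p := by exact_mod_cast (by exact_mod_cast hp0 : (0 : ℤ) < p)
  have : 1 ≤ |t| := by
    rw [← abs_one, ← sq_le_sq, one_pow, sq, hp]; exact hp1
  rw [abs_mul, abs_of_nonneg hs0]
  exact le_mul_of_one_le_right hs0 this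

/-- The pair `(z, f)` consists of the value `z` of the resolvent linear form at a point and the value
`f` of the quartic form there: `z ^ 4 = τ + 4 s f i` with `τ ∈ T`. -/
def IsResolventValue (T : AddSubgroup ℝ) (s : ℝ) (z : ℂ) (f : ℤ) : Prop :=
  ∃ τ ∈ T, z ^ 4 = τ + 4 * s * f * Complex.I

/-- The values `z`, `w` of the resolvent linear form at two points with determinant `d` satisfy
`conj w * z = M + s d i` with `M ∈ T`. -/
def IsResolventPair (T : AddSubgroup ℝ) (s : ℝ) (z w : ℂ) (d : ℤ) : Prop :=
  ∃ M ∈ T, (starRingEnd ℂ) w * z = M + s * d * Complex.I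

theorem mem_gradedPart_one {T : AddSubgroup ℝ} {s M : ℝ} (hM : M ∈ T) (d : ℤ) :
    (M + s * d * Complex.I : ℂ) ∈ gradedPart T s 1 := by
  refine ⟨?_, d, ?_, ?_⟩
  · rw [parityLattice_one]; simpa using hM
  · have := intCast_mem_parityLattice_zero T d
    rwa [← parityLattice_add_two] at this
  · simp

theorem four_mul_eq_of_isResolventValue {T : AddSubgroup ℝ} {s θ X : ℝ} {f : ℤ}
    (h : IsResolventValue T s (X * Complex.exp (θ * Complex.I)) f) :
    4 * s * f = X ^ 4 * Real.sin (4 * θ) := by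
  obtain ⟨τ, -, h⟩ := h
  have h1 := congrArg Complex.im h
  have e : (X * Complex.exp (θ * Complex.I) : ℂ) ^ 4
      = ((X ^ 4 : ℝ) : ℂ) * Complex.exp (((4 * θ : ℝ) : ℂ) * Complex.I) := by
    rw [mul_pow, ← Complex.exp_nat_mul]; push_cast; congr 2; ring
  rw [e, Complex.im_ofReal_mul, Complex.exp_ofReal_mul_I_im] at h1
  rw [h1]
  simp

theorem exists_mem_eq_of_isResolventValue {T : AddSubgroup ℝ} {s θ X : ℝ} {f : ℤ}
    (h : IsResolventValue T s (X * Complex.exp (θ * Complex.I)) f) :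
    ∃ τ ∈ T, τ = X ^ 4 * Real.cos (4 * θ) := by
  obtain ⟨τ, hτ, h⟩ := h
  refine ⟨τ, hτ, ?_⟩
  have h1 := congrArg Complex.re h
  have e : (X * Complex.exp (θ * Complex.I) : ℂ) ^ 4
      = ((X ^ 4 : ℝ) : ℂ) * Complex.exp (((4 * θ : ℝ) : ℂ) * Complex.I) := by
    rw [mul_pow, ← Complex.exp_nat_mul]; push_cast; congr 2; ring
  rw [e, Complex.re_ofReal_mul, Complex.exp_ofReal_mul_I_re] at h1
  rw [h1]
  simp

/-- Up to the scaling by `Y * X ^ (4 n + 1)`, the approximation form of order `n` at the first point,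
evaluated at the second point, is an algebraic integer of a very restricted type. -/
theorem smul_padeForm_mem_gradedPart {T : AddSubgroup ℝ} (hT : HasIntegralProducts T) {s : ℝ} {k : ℤ}
    (hs : s ^ 2 = k) {X θ Y θ' : ℝ} {f d : ℤ}
    (hz : IsResolventValue T s (X * Complex.exp (θ * Complex.I)) f)
    (hzw : IsResolventPair T s (X * Complex.exp (θ * Complex.I)) (Y * Complex.exp (θ' * Complex.I)) d)
    (n : ℕ) : ((Y * X ^ (4 * n + 1) : ℝ) : ℂ) * (Complex.exp (-(θ' * Complex.I)) * padeForm n θ)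
      ∈ gradedPart T s (1 + n) := by
  obtain ⟨M, hM, hzw⟩ := hzw
  have hf := four_mul_eq_of_isResolventValue hz
  obtain ⟨τ, hτ, hz⟩ := hz
  choose N hN using exists_int_eq_eight_pow_mul_padeCoeff n
  have hw : ((τ : ℂ) + s * ((4 * f : ℤ) : ℂ) * Complex.I) ∈ gradedPart T s 1 :=
    mem_gradedPart_one hτ (4 * f)
  have hF : (((0 : ℝ) : ℂ) + s * ((-f : ℤ) : ℂ) * Complex.I) ∈ gradedPart T s 1 :=
    mem_gradedPart_one T.zero_mem (-f)
  have hsum : (∑ m ∈ Finset.range (n + 1), N m • ((((0 : ℝ) : ℂ) + s * ((-f : ℤ) : ℂ) * Complex.I) ^ m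
      * ((τ : ℂ) + s * ((4 * f : ℤ) : ℂ) * Complex.I) ^ (n - m))) ∈ gradedPart T s n := by
    refine sum_mem fun m hm => zsmul_mem ?_ _
    have hm' : m ≤ n := Nat.lt_succ_iff.1 (Finset.mem_range.1 hm)
    have := mul_mem_gradedPart hT hs (pow_mem_gradedPart hT hs hF m)
      (pow_mem_gradedPart hT hs hw (n - m))
    rwa [Nat.add_sub_cancel' hm'] at this
  have h := mul_mem_gradedPart hT hs (mem_gradedPart_one (s := s) hM d) hsum
  convert h using 1
  rw [← hzw, padeForm, Finset.mul_sum, Finset.mul_sum, Finset.mul_sum, Finset.mul_sum]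
  refine Finset.sum_congr rfl fun m hm => ?_
  have hm' : m ≤ n := Nat.lt_succ_iff.1 (Finset.mem_range.1 hm)
  have h1 : ((τ : ℂ) + s * ((4 * f : ℤ) : ℂ) * Complex.I)
      = (X : ℂ) ^ 4 * Complex.exp (4 * θ * Complex.I) := by
    have : ((τ : ℂ) + s * ((4 * f : ℤ) : ℂ) * Complex.I) = τ + 4 * s * f * Complex.I := by
      push_cast; ring
    rw [this, ← hz, mul_pow, ← Complex.exp_nat_mul]; push_cast; congr 2; ring
  -- the factor `8 ^ m` that clears the denominators is supplied by `-D X ^ 4 = 8 (-s f i)`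
  have h2 : (8 : ℂ) * (((0 : ℝ) : ℂ) + s * ((-f : ℤ) : ℂ) * Complex.I)
      = (X : ℂ) ^ 4 * (-(2 * Complex.I * Real.sin (4 * θ))) := by
    have : (4 * s * f : ℂ) = X ^ 4 * Real.sin (4 * θ) := by
      rw [← Complex.ofReal_intCast f]; exact_mod_cast congrArg Complex.ofReal hf
    push_cast at this ⊢
    linear_combination (-2 * Complex.I) * this
  have h3 : (N m : ℂ) = 8 ^ m * (padeCoeff n m : ℂ) := by
    have := congrArg Complex.ofReal (hN m)
    push_cast at this
    exact this
  have h4 : (N m : ℂ) * (((0 : ℝ) : ℂ) + s * ((-f : ℤ) : ℂ) * Complex.I) ^ m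
      = (padeCoeff n m : ℂ) * ((X : ℂ) ^ (4 * m) * (-(2 * Complex.I * Real.sin (4 * θ))) ^ m) := by
    rw [h3, mul_comm (8 ^ m : ℂ), mul_assoc, ← mul_pow, h2, mul_pow, ← pow_mul]
  have h5 : (starRingEnd ℂ) (Y * Complex.exp (θ' * Complex.I))
      = Y * Complex.exp (-(θ' * Complex.I)) := by
    rw [map_mul, Complex.conj_ofReal, ← Complex.exp_conj, map_mul, Complex.conj_I,
      Complex.conj_ofReal, mul_neg]
  have h6 : (X : ℂ) ^ (4 * n + 1) = X * (X ^ (4 * m) * X ^ (4 * (n - m))) := by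
    rw [← pow_add, ← pow_succ']; congr 1; omega
  rw [zsmul_eq_mul, ← mul_assoc (N m : ℂ), h4, h1, h5, mul_pow (X ^ 4 : ℂ), ← pow_mul (X : ℂ) 4]
  push_cast
  rw [h6]
  ring

/-- A nonvanishing value of the approximation form is bounded below. -/
theorem le_of_im_padeForm_ne_zero {T : AddSubgroup ℝ} (hT : HasIntegralProducts T) {s : ℝ} {k : ℤ}
    (hs : s ^ 2 = k) (hs0 : 0 ≤ s) {X θ Y θ' : ℝ} (hX : 0 < X) (hY : 0 < Y) {f d : ℤ}
    (hz : IsResolventValue T s (X * Complex.exp (θ * Complex.I)) f)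
    (hzw : IsResolventPair T s (X * Complex.exp (θ * Complex.I)) (Y * Complex.exp (θ' * Complex.I)) d)
    (n : ℕ) (h0 : (Complex.exp (-(θ' * Complex.I)) * padeForm n θ).im ≠ 0) :
    s ≤ Y * X ^ (4 * n + 1) * |(Complex.exp (-(θ' * Complex.I)) * padeForm n θ).im| := by
  have hpos : 0 < Y * X ^ (4 * n + 1) := by positivity
  have h := le_abs_im_of_mem_gradedPart hT hs0 (smul_padeForm_mem_gradedPart hT hs hz hzw n) (by
    rw [Complex.im_ofReal_mul]; exact mul_ne_zero hpos.ne' h0)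
  rwa [Complex.im_ofReal_mul, abs_mul, abs_of_pos hpos] at h

/-! ### Nonvanishing of the form of order one -/

/-- If the approximation form of order one vanishes at two points, then a covariant identity bounds
the first point: with `R = |z|^8` one gets `R (f f' + 5 d^4 k) = 81 d^4 k^2 f^2`. -/
theorem im_padeForm_one_ne_zero {T : AddSubgroup ℝ} (hT : HasIntegralProducts T) {s : ℝ} {k : ℤ}
    (hs : s ^ 2 = k) (hs0 : 0 < s) {X θ Y θ' : ℝ} (hX : 0 < X) {f f' d : ℤ} {h : ℕ}
    (hh : 0 < h) (hd : d ≠ 0)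
    (hz : IsResolventValue T s (X * Complex.exp (θ * Complex.I)) f)
    (hw : IsResolventValue T s (Y * Complex.exp (θ' * Complex.I)) f')
    (hzw : IsResolventPair T s (X * Complex.exp (θ * Complex.I)) (Y * Complex.exp (θ' * Complex.I)) d)
    (hf : |f| ≤ h) (hf' : |f'| ≤ h) (hXk : 81 * (k : ℝ) * h ^ 4 < X ^ 8) :
    (Complex.exp (-(θ' * Complex.I)) * padeForm 1 θ).im ≠ 0 := by
  intro h0
  have hsin := four_mul_eq_of_isResolventValue hz
  obtain ⟨τ, hτ, hcos⟩ := exists_mem_eq_of_isResolventValue hz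
  obtain ⟨τ', -, hw'⟩ := hw
  obtain ⟨M, -, hM⟩ := hzw
  have hR : X ^ 8 = τ ^ 2 + 16 * k * f ^ 2 := by
    have h2 : (16 : ℝ) * k * f ^ 2 = (4 * s * f) ^ 2 := by rw [← hs]; ring
    rw [h2, hsin, hcos]
    linear_combination (-X ^ 8) * Real.sin_sq_add_cos_sq (4 * θ)
  have hz4 : (X * Complex.exp (θ * Complex.I) : ℂ) ^ 4 = τ + 4 * s * f * Complex.I := by
    have e : (X * Complex.exp (θ * Complex.I) : ℂ) ^ 4
        = ((X ^ 4 : ℝ) : ℂ) * Complex.exp (((4 * θ : ℝ) : ℂ) * Complex.I) := by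
      rw [mul_pow, ← Complex.exp_nat_mul]; push_cast; congr 2; ring
    have h2 : (4 * s * f : ℂ) = ((X ^ 4 * Real.sin (4 * θ) : ℝ) : ℂ) := by rw [← hsin]; push_cast; ring
    rw [e, Complex.exp_mul_I, h2, hcos]; push_cast; ring
  -- the vanishing says `d τ = M f`
  have hdM : d * τ = M * f := by
    have h1 : ((Y * X ^ 5 : ℝ) : ℂ) * (Complex.exp (-(θ' * Complex.I)) * padeForm 1 θ)
        = (M + s * d * Complex.I) * (2 * τ - 2 * s * f * Complex.I) := by
      have h5 : (starRingEnd ℂ) (Y * Complex.exp (θ' * Complex.I))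
          = Y * Complex.exp (-(θ' * Complex.I)) := by
        rw [map_mul, Complex.conj_ofReal, ← Complex.exp_conj, map_mul, Complex.conj_I,
          Complex.conj_ofReal, mul_neg]
      have h6 : (2 * τ - 2 * s * f * Complex.I : ℂ) = (X : ℂ) ^ 4 *
          (((2 * Real.cos (4 * θ) : ℝ) : ℂ) - ((Real.sin (4 * θ) / 2 : ℝ) : ℂ) * Complex.I) := by
        have h2 : (4 * s * f : ℂ) = ((X ^ 4 * Real.sin (4 * θ) : ℝ) : ℂ) := by
          rw [← hsin]; push_cast; ring
        have h3 : (2 * s * f : ℂ) = ((X ^ 4 * Real.sin (4 * θ) / 2 : ℝ) : ℂ) := by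
          push_cast at h2 ⊢; linear_combination h2 / 2
        rw [h3, hcos]; push_cast; ring
      rw [← hM, h5, h6, padeForm_one, padeForm_zero]
      push_cast
      ring
    have h2 := congrArg Complex.im h1
    rw [Complex.im_ofReal_mul, h0, mul_zero] at h2
    simp at h2
    have : 2 * s * (d * τ - M * f) = 0 := by linarith
    have := (mul_eq_zero.1 this).resolve_left (by positivity)
    linarith
  have hf0 : (f : ℝ) ≠ 0 := by
    intro hf0
    rw [hf0, mul_zero] at hdM
    have : τ = 0 := (mul_eq_zero.1 hdM).resolve_left (by exact_mod_cast hd)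
    rw [this, hf0] at hR
    have : 0 < X ^ 8 := by positivity
    norm_num at hR
    exact this.ne' (by rw [hR]; norm_num)
  -- the values of `f'` from the fourth power of `conj w * z`
  have hE : (M + s * d * Complex.I : ℂ) ^ 4
      = (starRingEnd ℂ) (τ' + 4 * s * f' * Complex.I) * (τ + 4 * s * f * Complex.I) := by
    rw [← hM, mul_pow, ← map_pow, hw', hz4]
  have e4 : (((M ^ 4 - 6 * M ^ 2 * s ^ 2 * d ^ 2 + s ^ 4 * d ^ 4 : ℝ) : ℂ)
        + ((4 * M ^ 3 * (s * d) - 4 * M * (s * d) ^ 3 : ℝ) : ℂ) * Complex.I)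
      = (((τ' : ℝ) : ℂ) - ((4 * s * f' : ℝ) : ℂ) * Complex.I)
        * (((τ : ℝ) : ℂ) + ((4 * s * f : ℝ) : ℂ) * Complex.I) := by
    have e5 : (starRingEnd ℂ) (τ' + 4 * s * f' * Complex.I)
        = ((τ' : ℝ) : ℂ) - ((4 * s * f' : ℝ) : ℂ) * Complex.I := by
      simp only [map_add, map_mul, Complex.conj_ofReal, Complex.conj_I, map_ofNat, map_intCast]
      push_cast; ring
    rw [e5] at hE
    push_cast at hE ⊢
    rw [← hE]
    linear_combination (-6 * M ^ 2 * s ^ 2 * d ^ 2 - 4 * M * s ^ 3 * d ^ 3 * Complex.I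
      - s ^ 4 * d ^ 4 * (Complex.I ^ 2 - 1)) * Complex.I_sq
  have hre := congrArg Complex.re e4
  have him := congrArg Complex.im e4
  simp only [Complex.add_re, Complex.add_im, Complex.sub_re, Complex.sub_im, Complex.mul_re,
    Complex.mul_im, Complex.ofReal_re, Complex.ofReal_im, Complex.I_re, Complex.I_im] at hre him
  have hmain : X ^ 8 * f * f' = d ^ 4 * k * (81 * k * f ^ 2 - 5 * X ^ 8) := by
    have h1 : X ^ 8 * f' * f ^ 4 = d ^ 4 * k * f ^ 3 * (k * f ^ 2 - 5 * τ ^ 2) := by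
      have h2 : 4 * s * (X ^ 8 * f' * f ^ 4 - d ^ 4 * k * f ^ 3 * (k * f ^ 2 - 5 * τ ^ 2)) = 0 := by
        have e1 : f ^ 4 * M ^ 4 = (d * τ) ^ 4 := by rw [hdM]; ring
        have e2 : f ^ 2 * M ^ 2 = (d * τ) ^ 2 := by rw [hdM]; ring
        have e3 : f ^ 3 * M ^ 3 = (d * τ) ^ 3 := by rw [hdM]; ring
        have e5 : f * M = d * τ := by rw [hdM]; ring
        have e6 : s ^ 4 = k ^ 2 := by rw [← hs]; ring
        rw [hR]
        linear_combination (f ^ 4 * τ) * him - (4 * s * f ^ 5) * hre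
          + (-4 * s * d * τ * f) * e3 + (4 * s ^ 3 * d ^ 3 * τ * f ^ 3) * e5 + (4 * s * f) * e1
          - (24 * s ^ 3 * d ^ 2 * f ^ 3) * e2 + (-20 * s * d ^ 4 * τ ^ 2 * f ^ 3
            - 64 * s * f ^ 6 * f') * hs + (4 * s * d ^ 4 * f ^ 5) * e6
      have := (mul_eq_zero.1 h2).resolve_left (by positivity)
      linarith
    have h3 : f ^ 3 * (X ^ 8 * f * f' - d ^ 4 * k * (81 * k * f ^ 2 - 5 * X ^ 8)) = 0 := by
      rw [hR] at h1 ⊢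
      linear_combination h1
    have := (mul_eq_zero.1 h3).resolve_left (by positivity)
    linarith
  obtain ⟨t, ht⟩ := hT τ hτ τ hτ
  -- the same identity between integers
  set r : ℤ := t + 16 * k * f ^ 2 with hr
  have hRr : X ^ 8 = r := by rw [hR, hr]; push_cast; linear_combination ht
  have hint : r * (f * f' + 5 * d ^ 4 * k) = 81 * d ^ 4 * k ^ 2 * f ^ 2 := by
    have : (r : ℝ) * (f * f' + 5 * d ^ 4 * k) = 81 * d ^ 4 * k ^ 2 * f ^ 2 := by
      rw [hRr] at hmain; linear_combination hmain
    exact_mod_cast this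
  have hk : 0 < k := by
    have : (0 : ℝ) < k := by rw [← hs]; positivity
    exact_mod_cast this
  have hrk : 81 * k * h ^ 4 < r := by rw [hRr] at hXk; exact_mod_cast hXk
  have hf2 : f ^ 2 ≤ h ^ 2 := sq_le_sq.2 (by simpa using hf)
  have hff : -(h : ℤ) ^ 2 ≤ f * f' := by
    have h1 : |f * f'| ≤ (h : ℤ) ^ 2 := by
      rw [abs_mul, sq]; exact mul_le_mul hf hf' (abs_nonneg _) (by positivity)
    exact (abs_le.1 h1).1
  have hh1 : (1 : ℤ) ≤ h := by exact_mod_cast hh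
  have hh24 : (h : ℤ) ^ 2 ≤ h ^ 4 := pow_le_pow_right₀ hh1 (by norm_num)
  have hd4 : 0 < d ^ 4 := by positivity
  have hr81 : 81 * k * f ^ 2 < r := by nlinarith
  have hr0 : 0 < r := lt_of_le_of_lt (by positivity) hr81
  set e := f * f' + 5 * d ^ 4 * k with he
  have he0 : 0 < e := by
    have hf00 : f ≠ 0 := by exact_mod_cast hf0
    have : 0 < r * e := by rw [hint]; positivity
    exact (pos_iff_pos_of_mul_pos this).1 hr0
  have hek : e ≤ d ^ 4 * k := by
    by_contra hlt
    push Not at hlt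
    have h1 : r * (d ^ 4 * k) < r * e := mul_lt_mul_of_pos_left hlt hr0
    have h2 : (81 * k * f ^ 2) * (d ^ 4 * k) ≤ r * (d ^ 4 * k) :=
      mul_le_mul_of_nonneg_right hr81.le (by positivity)
    nlinarith
  have hdk : 4 * (d ^ 4 * k) ≤ h ^ 2 := by nlinarith
  have h1 : r ≤ 81 * d ^ 4 * k ^ 2 * f ^ 2 := by rw [← hint]; nlinarith
  have h2 : 81 * k * f ^ 2 * (4 * (d ^ 4 * k)) ≤ 81 * k * h ^ 2 * h ^ 2 := by
    gcongr
  nlinarith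

/-! ### The Thue–Siegel principle for one class -/

theorem abs_le_of_abs_sin_le {x ε : ℝ} (hx : |x| ≤ Real.pi / 2) (hε : ε ≤ 1 / 20)
    (h : |Real.sin x| ≤ ε) : |x| ≤ 101 / 100 * ε := by
  have h1 := Real.mul_abs_le_abs_sin hx
  have hpi := Real.pi_lt_d2
  have hpi0 := Real.pi_pos
  have h2 : |x| ≤ 1.6 * ε := by
    have h3 : 2 / Real.pi * |x| ≤ ε := h1.trans h
    have h4 : |x| = Real.pi / 2 * (2 / Real.pi * |x|) := by field_simp
    rw [h4]
    have h5 : 0 ≤ 2 / Real.pi * |x| := by positivity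
    nlinarith
  have h6 : |x| ≤ 0.08 := by linarith
  rcases eq_or_lt_of_le (abs_nonneg x) with h0 | h0
  · rw [← h0]; linarith [(abs_nonneg _).trans h]
  · have h7 := Real.sin_gt_sub_cube h0
    have h8 : |Real.sin x| = Real.sin |x| := by
      rw [Real.abs_sin_eq_sin_abs_of_abs_le_pi (by linarith)]
    rw [h8] at h
    have h9 : |x| ^ 3 ≤ 0.0064 * |x| := by
      have : |x| ^ 3 = |x| ^ 2 * |x| := by ring
      rw [this]
      have : |x| ^ 2 ≤ 0.0064 := by nlinarith
      gcongr
    linarith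

theorem abs_le_of_isResolventValue {T : AddSubgroup ℝ} {s X θ : ℝ} {f : ℤ} {h : ℕ} (hs0 : 0 < s)
    (hX : 0 < X) (hθ : |θ| ≤ Real.pi / 8)
    (hz : IsResolventValue T s (X * Complex.exp (θ * Complex.I)) f) (hf : |f| ≤ h)
    (hsmall : 80 * (s * h) ≤ X ^ 4) : |θ| ≤ 101 / 100 * (s * h / X ^ 4) := by
  have h1 := four_mul_eq_of_isResolventValue hz
  have hX4 : 0 < X ^ 4 := by positivity
  have hfr : |(f : ℝ)| ≤ h := by exact_mod_cast hf
  have h2 : |Real.sin (4 * θ)| ≤ 4 * (s * h / X ^ 4) := by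
    have h3 : Real.sin (4 * θ) = 4 * s * f / X ^ 4 := by rw [h1]; field_simp
    rw [h3, abs_div, abs_mul, abs_of_pos hX4, abs_of_pos (by positivity : 0 < 4 * s), mul_div_assoc',
      ← mul_assoc]
    gcongr
  have h4 := abs_le_of_abs_sin_le (x := 4 * θ) (by
    rw [abs_mul, abs_of_pos (by norm_num : (0 : ℝ) < 4)]; linarith) (by
    rw [mul_div_assoc', div_le_div_iff₀ hX4 (by norm_num)]; linarith) h2
  rw [abs_mul, abs_of_pos (by norm_num : (0 : ℝ) < 4)] at h4
  linarith

theorem abs_im_exp_mul_le (θ : ℝ) (z : ℂ) :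
    |(Complex.exp (-(θ * Complex.I)) * z).im| ≤ |z.im| + |θ| * ‖z‖ := by
  have e : Complex.exp (-(θ * Complex.I)) = Real.cos θ - Real.sin θ * Complex.I := by
    have : -(θ * Complex.I) = ((-θ : ℝ) : ℂ) * Complex.I := by push_cast; ring
    rw [this, Complex.exp_mul_I, ← Complex.ofReal_cos, ← Complex.ofReal_sin, Real.cos_neg,
      Real.sin_neg]
    push_cast; ring
  have h1 : (Complex.exp (-(θ * Complex.I)) * z).im = Real.cos θ * z.im - Real.sin θ * z.re := by
    rw [e, Complex.mul_im, Complex.sub_re, Complex.sub_im, Complex.ofReal_re, Complex.ofReal_im,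
      Complex.re_ofReal_mul, Complex.im_ofReal_mul, Complex.I_re, Complex.I_im]
    ring
  rw [h1]
  refine (abs_sub _ _).trans ?_
  rw [abs_mul, abs_mul]
  exact add_le_add (mul_le_of_le_one_left (abs_nonneg _) (Real.abs_cos_le_one θ))
    (mul_le_mul Real.abs_sin_le_abs (Complex.abs_re_le_norm z) (abs_nonneg _) (abs_nonneg _))

theorem centralBinom_le_of_two_le {j : ℕ} (hj : 2 ≤ j) : (j.centralBinom : ℝ) ≤ 3 / 8 * 4 ^ j := by
  induction j, hj using Nat.le_induction with
  | base => norm_num [Nat.centralBinom, Nat.choose]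
  | succ n hn ih =>
    have h := Nat.succ_mul_centralBinom_succ n
    have h' : ((n : ℝ) + 1) * (n + 1).centralBinom = 2 * (2 * n + 1) * n.centralBinom := by
      exact_mod_cast h
    have h3 : ((n : ℝ) + 1) * (n + 1).centralBinom ≤ (n + 1) * (4 * n.centralBinom) := by
      rw [h']; nlinarith [(Nat.cast_nonneg n.centralBinom : (0 : ℝ) ≤ n.centralBinom)]
    have := le_of_mul_le_mul_left h3 (by positivity)
    calc ((n + 1).centralBinom : ℝ) ≤ 4 * n.centralBinom := this
      _ ≤ 4 * (3 / 8 * 4 ^ n) := by gcongr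
      _ = _ := by ring

/-- One application of the approximation of order `j + 1` at the first point: if its value at the
second point does not vanish and the second point is far enough for the main term of the
approximation to be negligible, then the second point is very far. -/
theorem far_of_im_padeForm_ne_zero {T : AddSubgroup ℝ} (hT : HasIntegralProducts T) {s : ℝ} {k : ℤ}
    (hs : s ^ 2 = k) (hs0 : 0 < s) {X θ Y θ' : ℝ} (hX : 0 < X) (hY : 0 < Y) {f d : ℤ} {h : ℕ}
    (hz : IsResolventValue T s (X * Complex.exp (θ * Complex.I)) f)
    (hzw : IsResolventPair T s (X * Complex.exp (θ * Complex.I)) (Y * Complex.exp (θ' * Complex.I)) d)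
    (hθ : |θ| ≤ 101 / 100 * (s * h / X ^ 4)) (hθ' : |θ'| ≤ 101 / 100 * (s * h / Y ^ 4))
    (hμ : 1 + 8 * θ ^ 2 ≤ 101 / 100) (j : ℕ)
    (h0 : (Complex.exp (-(θ' * Complex.I)) * padeForm (j + 1) θ).im ≠ 0)
    (hmain : 404 / 100 * h * (j + 1).centralBinom * (101 / 100) ^ (j + 1) * X ^ (4 * j + 5) ≤ Y ^ 3) :
    X ^ (4 * j + 7) ≤ 842 / 1000 * h * (16.33 * k * h ^ 2) ^ (j + 1) * Y := by
  have h1 := le_of_im_padeForm_ne_zero hT hs hs0.le hX hY hz hzw (j + 1) h0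
  have h2 := abs_im_exp_mul_le θ' (padeForm (j + 1) θ)
  have h3 := abs_im_padeForm_le j θ
  have h4 := norm_padeForm_le (j + 1) θ
  have hk0 : (0 : ℝ) < k := by rw [← hs]; positivity
  -- the main term of the approximation contributes at most `s / 4`
  have hsecond : Y * X ^ (4 * (j + 1) + 1) * (|θ'| * ‖padeForm (j + 1) θ‖) ≤ s / 4 := by
    calc Y * X ^ (4 * (j + 1) + 1) * (|θ'| * ‖padeForm (j + 1) θ‖)
        ≤ Y * X ^ (4 * (j + 1) + 1) * ((101 / 100 * (s * h / Y ^ 4))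
          * ((j + 1).centralBinom * (101 / 100) ^ (j + 1))) := by
          gcongr
          refine h4.trans ?_
          gcongr
      _ = s / 4 * ((404 / 100 * h * (j + 1).centralBinom * (101 / 100) ^ (j + 1)
          * X ^ (4 * j + 5)) / Y ^ 3) := by
          field_simp
          ring
      _ ≤ s / 4 * 1 := by
          gcongr
          rw [div_le_one (by positivity)]
          exact hmain
      _ = s / 4 := mul_one _
  have hfirst : Y * X ^ (4 * (j + 1) + 1) * |(padeForm (j + 1) θ).im| ≤
      s * (63125 / 100000 * h * (16.33 * k * h ^ 2) ^ (j + 1) * Y) / X ^ (4 * j + 7) := by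
    calc Y * X ^ (4 * (j + 1) + 1) * |(padeForm (j + 1) θ).im|
        ≤ Y * X ^ (4 * (j + 1) + 1) * (5 / 8 * 16 ^ (j + 1)
          * (101 / 100 * (s * h / X ^ 4)) ^ (2 * (j + 1) + 1)) := by
          gcongr
          exact h3.trans (by gcongr)
      -- `0.63125 = (5 / 8) * 1.01`, and `16 * 1.01 ^ 2 ≤ 16.33` below
      _ = s * (63125 / 100000 * h * (16 * (101 / 100) ^ 2 * k * h ^ 2) ^ (j + 1) * Y)
          / X ^ (4 * j + 7) := by
          rw [← hs]
          rw [pow_succ _ (2 * (j + 1)), pow_mul (101 / 100 * (s * h / X ^ 4)) 2 (j + 1),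
            eq_div_iff (by positivity)]
          have e : X ^ (4 * (j + 1) + 1) * X ^ (4 * j + 7) = (X ^ 8) ^ (j + 1) * X ^ 4 := by
            rw [← pow_add, ← pow_mul, ← pow_add]; congr 1; ring
          have e2 : (5 / 8 * 16 ^ (j + 1) * (((101 / 100 * (s * h / X ^ 4)) ^ 2) ^ (j + 1)
              * (101 / 100 * (s * h / X ^ 4)))) * ((X ^ 8) ^ (j + 1) * X ^ 4)
              = 63125 / 100000 * (s * h) * (16 * (101 / 100) ^ 2 * s ^ 2 * h ^ 2) ^ (j + 1) := by
            have e3 : (16 : ℝ) ^ (j + 1) * ((101 / 100 * (s * h / X ^ 4)) ^ 2) ^ (j + 1)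
                * (X ^ 8) ^ (j + 1) = (16 * (101 / 100) ^ 2 * s ^ 2 * h ^ 2) ^ (j + 1) := by
              rw [← mul_pow, ← mul_pow]; congr 1; field_simp
            rw [← e3]
            field_simp
            ring
          linear_combination (5 / 8 * 16 ^ (j + 1) * (((101 / 100 * (s * h / X ^ 4)) ^ 2) ^ (j + 1)
              * (101 / 100 * (s * h / X ^ 4)))) * Y * e + Y * e2
      _ ≤ _ := by
          gcongr
          norm_num
  have h5 : s ≤ s * (63125 / 100000 * h * (16.33 * k * h ^ 2) ^ (j + 1) * Y) / X ^ (4 * j + 7)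
      + s / 4 := by
    calc s ≤ _ := h1
      _ ≤ Y * X ^ (4 * (j + 1) + 1) * (|(padeForm (j + 1) θ).im| + |θ'| * ‖padeForm (j + 1) θ‖) := by
          gcongr
      _ ≤ _ := by rw [mul_add]; exact add_le_add hfirst hsecond
  have h6 : s * (3 / 4 * X ^ (4 * j + 7))
      ≤ s * (63125 / 100000 * h * (16.33 * k * h ^ 2) ^ (j + 1) * Y) := by
    have h7 : s * (3 / 4) ≤ s * (63125 / 100000 * h * (16.33 * k * h ^ 2) ^ (j + 1) * Y)
      / X ^ (4 * j + 7) := by linarith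
    rw [le_div_iff₀ (by positivity)] at h7
    linarith
  have h8 := le_of_mul_le_mul_left h6 hs0
  -- `0.842 ≥ (4 / 3) * 0.63125`
  have h9 : 0 ≤ (h : ℝ) * (16.33 * k * h ^ 2) ^ (j + 1) * Y := by positivity
  linarith

/-- A line through the origin does not contain two consecutive Padé forms. -/
theorem im_padeForm_ne_zero_or {θ θ' : ℝ} (hsin : Real.sin (4 * θ) ≠ 0) (n : ℕ) :
    (Complex.exp (-(θ' * Complex.I)) * padeForm n θ).im ≠ 0 ∨
      (Complex.exp (-(θ' * Complex.I)) * padeForm (n + 1) θ).im ≠ 0 := by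
  by_contra hcon
  push Not at hcon
  obtain ⟨h1, h2⟩ := hcon
  apply im_padeForm_mul_conj_ne_zero hsin n
  set e := Complex.exp (-(θ' * Complex.I)) with he
  have hn : (starRingEnd ℂ) e * e = 1 := by
    have : e = Complex.exp (((-θ' : ℝ) : ℂ) * Complex.I) := by rw [he]; push_cast; congr 1; ring
    rw [← Complex.normSq_eq_conj_mul_self, Complex.normSq_eq_norm_sq, this,
      Complex.norm_exp_ofReal_mul_I]
    simp
  have h3 : padeForm n θ * (starRingEnd ℂ) (padeForm (n + 1) θ)
      = (e * padeForm n θ) * (starRingEnd ℂ) (e * padeForm (n + 1) θ) := by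
    rw [map_mul]
    linear_combination (-(padeForm n θ * (starRingEnd ℂ) (padeForm (n + 1) θ))) * hn
  rw [h3, Complex.mul_im, Complex.conj_im, Complex.conj_re, h1, h2]
  ring

theorem im_exp_mul_eq_of_isResolventPair {T : AddSubgroup ℝ} {s X θ Y θ' : ℝ} {d : ℤ}
    (hzw : IsResolventPair T s (X * Complex.exp (θ * Complex.I))
      (Y * Complex.exp (θ' * Complex.I)) d) :
    s * d = X * Y * (Complex.exp (-(θ' * Complex.I)) * Complex.exp (θ * Complex.I)).im := by
  obtain ⟨M, -, hM⟩ := hzw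
  have h5 : (starRingEnd ℂ) (Y * Complex.exp (θ' * Complex.I))
      = Y * Complex.exp (-(θ' * Complex.I)) := by
    rw [map_mul, Complex.conj_ofReal, ← Complex.exp_conj, map_mul, Complex.conj_I,
      Complex.conj_ofReal, mul_neg]
  have h1 : ((X * Y : ℝ) : ℂ) * (Complex.exp (-(θ' * Complex.I)) * Complex.exp (θ * Complex.I))
      = M + s * d * Complex.I := by
    rw [← hM, h5]; push_cast; ring
  have h2 := congrArg Complex.im h1
  rw [Complex.im_ofReal_mul] at h2
  rw [h2]; simp

/-- The gap principle: `s |d| = X Y |sin (θ - θ')|`. -/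
theorem le_mul_add_of_isResolventPair {T : AddSubgroup ℝ} {s X θ Y θ' : ℝ} (hs0 : 0 < s)
    (hX : 0 < X) (hY : 0 < Y) {d : ℤ} (hd : d ≠ 0)
    (hzw : IsResolventPair T s (X * Complex.exp (θ * Complex.I))
      (Y * Complex.exp (θ' * Complex.I)) d) : s ≤ X * Y * (|Real.sin θ| + |Real.sin θ'|) := by
  have h1 := im_exp_mul_eq_of_isResolventPair hzw
  have hd1 : (1 : ℝ) ≤ |(d : ℝ)| := by exact_mod_cast Int.one_le_abs hd
  have h2 : (Complex.exp (-(θ' * Complex.I)) * Complex.exp (θ * Complex.I)).im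
      = Real.sin (θ - θ') := by
    rw [← Complex.exp_add, ← Complex.exp_ofReal_mul_I_im]; congr 2; push_cast; ring
  have h3 : |Real.sin (θ - θ')| ≤ |Real.sin θ| + |Real.sin θ'| := by
    rw [Real.sin_sub]
    refine (abs_sub _ _).trans (add_le_add ?_ ?_)
    · rw [abs_mul]; exact mul_le_of_le_one_right (abs_nonneg _) (Real.abs_cos_le_one _)
    · rw [abs_mul]; exact mul_le_of_le_one_left (abs_nonneg _) (Real.abs_cos_le_one _)
  rw [h2] at h1
  calc s ≤ s * |(d : ℝ)| := le_mul_of_one_le_right hs0.le hd1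
    _ = |s * d| := by rw [abs_mul, abs_of_pos hs0]
    _ = X * Y * |Real.sin (θ - θ')| := by rw [h1, abs_mul, abs_of_pos (by positivity : 0 < X * Y)]
    _ ≤ _ := by gcongr

/-- The growth obtained from one order of approximation makes the main term negligible for the next two
orders. -/
theorem main_term_le {k h X Y : ℝ} (hk0 : 0 < k) (hh1 : 1 ≤ h) (hX : 0 < X)
    (hX41 : 1 ≤ 4.04 * X ^ 4) (hbig : 270000 * k ^ 3 * h ^ 10 ≤ X ^ 8) (j : ℕ)
    (hj : X ^ (4 * j + 7) ≤ 842 / 1000 * h * (16.33 * k * h ^ 2) ^ (j + 1) * Y) {i : ℕ}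
    (hi1 : j + 1 ≤ i) (hi2 : i ≤ j + 2) :
    404 / 100 * h * (i + 1).centralBinom * (101 / 100) ^ (i + 1) * X ^ (4 * i + 5) ≤ Y ^ 3 := by
  have hh0 : 0 < h := by linarith
  have hbig' : 14.8 * h ^ 4 * (4.04 * (16.33 * k * h ^ 2) ^ 3) ≤ X ^ 8 := by
    have e : 14.8 * h ^ 4 * (4.04 * (16.33 * k * h ^ 2) ^ 3)
        = (14.8 * 4.04 * 16.33 ^ 3) * (k ^ 3 * h ^ 10) := by ring
    have e' : (14.8 * 4.04 * 16.33 ^ 3 : ℝ) ≤ 270000 := by norm_num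
    calc _ = _ := e
      _ ≤ 270000 * (k ^ 3 * h ^ 10) := mul_le_mul_of_nonneg_right e' (by positivity)
      _ = 270000 * k ^ 3 * h ^ 10 := by ring
      _ ≤ X ^ 8 := hbig
  set p : ℝ := 16.33 * k * h ^ 2 with hp
  have hp0 : 0 < p := by positivity
  have hbig2 : 14.8 * (h ^ 4 * (4.04 * p ^ 3) ^ (j + 1)) ≤ (X ^ 8) ^ (j + 1) := by
    have h1 : 14.8 * h ^ 4 ≤ (14.8 * h ^ 4) ^ (j + 1) := by
      refine le_self_pow₀ ?_ (by omega)
      have : (1 : ℝ) ≤ h ^ 4 := one_le_pow₀ hh1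
      linarith
    have h2 : (14.8 * h ^ 4) ^ (j + 1) * (4.04 * p ^ 3) ^ (j + 1) ≤ (X ^ 8) ^ (j + 1) := by
      rw [← mul_pow]; exact pow_le_pow_left₀ (by positivity) hbig' _
    refine le_trans (le_of_eq (by ring)) ((mul_le_mul_of_nonneg_right h1
      (by positivity : 0 ≤ (4.04 * p ^ 3) ^ (j + 1))).trans h2)
  have hkey : 1.515 * h * 4.04 ^ (j + 3) * X ^ (4 * j + 13) ≤ Y ^ 3 := by
    have hc : (X ^ (4 * j + 7)) ^ 3 ≤ (842 / 1000 * h * p ^ (j + 1) * Y) ^ 3 :=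
      pow_le_pow_left₀ (by positivity) hj 3
    have e1 : (842 / 1000 * h * p ^ (j + 1)) ^ 3 * (1.515 * h * 4.04 ^ (j + 3) * X ^ (4 * j + 13))
        = ((842 / 1000) ^ 3 * 1.515 * 4.04 ^ 2) * (h ^ 4 * (4.04 * p ^ 3) ^ (j + 1)
          * X ^ (4 * j + 13)) := by rw [mul_pow (4.04 : ℝ), ← pow_mul]; ring
    have e2 : (X ^ (4 * j + 7)) ^ 3 = (X ^ 8) ^ (j + 1) * X ^ (4 * j + 13) := by
      rw [← pow_mul, ← pow_mul, ← pow_add]; congr 1; ring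
    have h1 : (842 / 1000 * h * p ^ (j + 1)) ^ 3 * (1.515 * h * 4.04 ^ (j + 3) * X ^ (4 * j + 13))
        ≤ (842 / 1000 * h * p ^ (j + 1)) ^ 3 * Y ^ 3 := by
      calc _ = _ := e1
        _ ≤ 14.8 * (h ^ 4 * (4.04 * p ^ 3) ^ (j + 1) * X ^ (4 * j + 13)) :=
            mul_le_mul_of_nonneg_right (by norm_num) (by positivity)
        _ = 14.8 * (h ^ 4 * (4.04 * p ^ 3) ^ (j + 1)) * X ^ (4 * j + 13) := by ring
        _ ≤ (X ^ 8) ^ (j + 1) * X ^ (4 * j + 13) :=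
            mul_le_mul_of_nonneg_right hbig2 (by positivity)
        _ = _ := e2.symm
        _ ≤ _ := hc
        _ = _ := by ring
    exact le_of_mul_le_mul_left h1 (by positivity)
  refine le_trans ?_ hkey
  calc 404 / 100 * h * (i + 1).centralBinom * (101 / 100) ^ (i + 1) * X ^ (4 * i + 5)
      ≤ 404 / 100 * h * (3 / 8 * 4 ^ (i + 1)) * (101 / 100) ^ (i + 1) * X ^ (4 * i + 5) := by
        gcongr
        exact centralBinom_le_of_two_le (by omega)
    _ = 1.515 * h * (4.04 ^ (i + 1) * X ^ (4 * i + 5)) := by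
        rw [show (4.04 : ℝ) = 4 * (101 / 100) by norm_num, mul_pow]; ring
    _ = 1.515 * h * ((4.04 * X ^ 4) ^ (i + 1) * X) := by
        rw [mul_pow, ← pow_mul]; ring
    _ ≤ 1.515 * h * ((4.04 * X ^ 4) ^ (j + 3) * X) :=
        mul_le_mul_of_nonneg_left (mul_le_mul_of_nonneg_right
          (pow_le_pow_right₀ hX41 (by omega)) hX.le) (by positivity)
    _ = _ := by rw [mul_pow, ← pow_mul]; ring

/-- Two consecutive values of the approximation form do not both vanish. -/
theorem im_padeForm_ne_zero_or_of_isResolventPair {T : AddSubgroup ℝ} {s : ℝ} (hs0 : 0 < s)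
    {X θ Y θ' : ℝ} (hX : 0 < X) {f d : ℤ} (hd : d ≠ 0)
    (hz : IsResolventValue T s (X * Complex.exp (θ * Complex.I)) f)
    (hzw : IsResolventPair T s (X * Complex.exp (θ * Complex.I)) (Y * Complex.exp (θ' * Complex.I)) d)
    (hθ : |θ| ≤ Real.pi / 8) (n : ℕ) :
    (Complex.exp (-(θ' * Complex.I)) * padeForm n θ).im ≠ 0 ∨
      (Complex.exp (-(θ' * Complex.I)) * padeForm (n + 1) θ).im ≠ 0 := by
  -- if `sin 4θ = 0`, then `θ = 0` and the Padé forms are nonzero real numbers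
  by_cases hsin : Real.sin (4 * θ) = 0
  · left
    have h1 := four_mul_eq_of_isResolventValue hz
    rw [hsin, mul_zero] at h1
    have hf0 : f = 0 := by
      have : (f : ℝ) = 0 := (mul_eq_zero.1 h1).resolve_left (by positivity)
      exact_mod_cast this
    have hθ0 : θ = 0 := by
      have := abs_le_of_isResolventValue (h := 0) hs0 hX hθ hz (by simp [hf0])
        (by simp; positivity)
      simpa using this
    have h2 := im_exp_mul_eq_of_isResolventPair hzw
    rw [hθ0] at h2 ⊢
    rw [padeForm_at_zero, mul_comm, ← Complex.ofReal_natCast, Complex.im_ofReal_mul]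
    refine mul_ne_zero (by exact_mod_cast n.centralBinom_ne_zero) fun h3 => ?_
    simp only [Complex.ofReal_zero, zero_mul, Complex.exp_zero, mul_one, h3, mul_zero] at h2
    exact (mul_ne_zero hs0.ne' (by exact_mod_cast hd)) h2
  · exact im_padeForm_ne_zero_or hsin n

/-- A number `Y` cannot satisfy the lower bounds coming from arbitrarily large orders of
approximation. -/
theorem false_of_unbounded_growth {X Y c p : ℝ} (hX : 0 < X) (hp0 : 0 < p)
    (hXp : 2 * p ≤ X ^ 4) (hinf : ∀ N, ∃ j, N ≤ j ∧ X ^ (4 * j + 7) ≤ c * p ^ (j + 1) * Y) :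
    False := by
  obtain ⟨N, hN⟩ := pow_unbounded_of_one_lt (c * Y / X ^ 3) (one_lt_two (α := ℝ))
  obtain ⟨j, hj, hPj⟩ := hinf N
  have h1 : X ^ 3 * 2 ^ N * p ^ (j + 1) ≤ c * Y * p ^ (j + 1) := by
    calc X ^ 3 * 2 ^ N * p ^ (j + 1) ≤ X ^ 3 * 2 ^ (j + 1) * p ^ (j + 1) := by
          gcongr
          · norm_num
          · omega
      _ = X ^ 3 * (2 * p) ^ (j + 1) := by rw [mul_pow]; ring
      _ ≤ X ^ 3 * (X ^ 4) ^ (j + 1) := by gcongr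
      _ = X ^ (4 * j + 7) := by rw [← pow_mul]; ring
      _ ≤ _ := hPj
      _ = _ := by ring
  have h2 := le_of_mul_le_mul_right h1 (by positivity)
  rw [div_lt_iff₀ (by positivity)] at hN
  linarith

/-- The Thue–Siegel principle: in one class there is no second point beyond a large point. The gap
principle starts an induction in which the approximations of growing order at the first point push the
second point farther and farther away. -/
theorem false_of_large_of_isResolventPair {T : AddSubgroup ℝ} (hT : HasIntegralProducts T) {s : ℝ}
    {k : ℤ} (hs : s ^ 2 = k) (hs0 : 0 < s) {X θ Y θ' : ℝ} (hX : 0 < X) (hXY : X ≤ Y)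
    {f f' d : ℤ} {h : ℕ} (hh : 0 < h) (hd : d ≠ 0)
    (hz : IsResolventValue T s (X * Complex.exp (θ * Complex.I)) f)
    (hw : IsResolventValue T s (Y * Complex.exp (θ' * Complex.I)) f')
    (hzw : IsResolventPair T s (X * Complex.exp (θ * Complex.I)) (Y * Complex.exp (θ' * Complex.I)) d)
    (hf : |f| ≤ h) (hf' : |f'| ≤ h) (hθ : |θ| ≤ Real.pi / 8) (hθ' : |θ'| ≤ Real.pi / 8)
    (hbig : 270000 * (k : ℝ) ^ 3 * h ^ 10 ≤ X ^ 8) : False := by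
  have hY : 0 < Y := hX.trans_le hXY
  have hk0 : (0 : ℝ) < k := by rw [← hs]; positivity
  have hk1 : (1 : ℝ) ≤ k := by exact_mod_cast (by exact_mod_cast hk0 : 0 < k)
  have hs1 : 1 ≤ s := by nlinarith
  have hh1 : (1 : ℝ) ≤ h := by exact_mod_cast hh
  -- `519 ^ 2 ≤ 270000`
  have hX4 : 519 * (s ^ 3 * h ^ 5) ≤ X ^ 4 := by
    refine le_of_sq_le_sq ?_ (by positivity)
    calc (519 * (s ^ 3 * (h : ℝ) ^ 5)) ^ 2 = 269361 * (s ^ 2) ^ 3 * h ^ 10 := by ring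
      _ ≤ 270000 * (s ^ 2) ^ 3 * h ^ 10 := by gcongr; norm_num
      _ ≤ (X ^ 4) ^ 2 := by rw [hs, ← pow_mul]; exact hbig
  have hp1 : s * h ≤ s ^ 3 * h ^ 5 := by
    gcongr
    · exact le_self_pow₀ hs1 (by norm_num)
    · exact le_self_pow₀ hh1 (by norm_num)
  have hp2 : (k : ℝ) * h ^ 2 ≤ s ^ 3 * h ^ 5 := by
    rw [← hs]
    gcongr <;> first | assumption | norm_num
  have hp3 : (h : ℝ) ^ 4 ≤ s ^ 3 * h ^ 5 := by
    calc (h : ℝ) ^ 4 ≤ 1 * h ^ 5 := by rw [one_mul]; exact pow_le_pow_right₀ hh1 (by norm_num)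
      _ ≤ _ := by gcongr; exact one_le_pow₀ hs1
  have hsh : 0 < s * h := by positivity
  have hX4Y4 : X ^ 4 ≤ Y ^ 4 := by gcongr
  have hθ1 := abs_le_of_isResolventValue hs0 hX hθ hz hf (by nlinarith)
  have hθ'1 := abs_le_of_isResolventValue hs0 hY hθ' hw hf' (by nlinarith)
  have hμ : 1 + 8 * θ ^ 2 ≤ 101 / 100 := by
    have h1 : |θ| ≤ 1 / 50 := by
      refine hθ1.trans ?_
      rw [mul_div_assoc', div_le_div_iff₀ (by positivity) (by norm_num)]
      nlinarith
    have h2 : θ ^ 2 ≤ (1 / 50) ^ 2 := by rw [← sq_abs]; gcongr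
    linarith
  have hgap : X ^ 3 ≤ 202 / 100 * h * Y := by
    have h1 := le_mul_add_of_isResolventPair hs0 hX hY hd hzw
    have h2 : |Real.sin θ| + |Real.sin θ'| ≤ 202 / 100 * (s * h / X ^ 4) := by
      have h3 : s * h / Y ^ 4 ≤ s * h / X ^ 4 := by gcongr
      have h4 := Real.abs_sin_le_abs (x := θ)
      have h5 := Real.abs_sin_le_abs (x := θ')
      linarith
    have h6 : s ≤ s * ((202 / 100 * h * Y) / X ^ 3) := by
      calc s ≤ _ := h1
        _ ≤ X * Y * (202 / 100 * (s * h / X ^ 4)) := by gcongr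
        _ = _ := by field_simp
    have h7 : 1 ≤ (202 / 100 * h * Y) / X ^ 3 := by
      by_contra hlt
      push Not at hlt
      nlinarith
    rwa [one_le_div (by positivity)] at h7
  have hne := im_padeForm_ne_zero_or_of_isResolventPair hs0 hX hd hz hzw hθ
  have hp0 : 0 < 16.33 * (k : ℝ) * h ^ 2 := by positivity
  have hXp : 2 * (16.33 * (k : ℝ) * h ^ 2) ≤ X ^ 4 := by nlinarith
  let P : ℕ → Prop := fun j => X ^ (4 * j + 7) ≤ 842 / 1000 * h * (16.33 * k * h ^ 2) ^ (j + 1) * Y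
  -- the start: the gap principle makes the approximation of order one applicable
  have hP0 : P 0 := by
    refine far_of_im_padeForm_ne_zero hT hs hs0 hX hY hz hzw hθ1 hθ'1 hμ 0 ?_ ?_
    · refine im_padeForm_one_ne_zero hT hs hs0 hX hh hd hz hw hzw hf hf' (lt_of_lt_of_le ?_ hbig)
      have h1 : (k : ℝ) * h ^ 4 ≤ k ^ 3 * h ^ 10 :=
        mul_le_mul (le_self_pow₀ hk1 (by norm_num)) (pow_le_pow_right₀ hh1 (by norm_num))
          (by positivity) (by positivity)
      have h2 : 0 < (k : ℝ) * h ^ 4 := by positivity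
      nlinarith
    · have h1 : (X ^ 3) ^ 3 ≤ (202 / 100 * h * Y) ^ 3 := by gcongr
      have h2 : 68 * (h : ℝ) ^ 4 * X ^ 5 ≤ (X ^ 3) ^ 3 := by
        have : (X ^ 3) ^ 3 = X ^ 4 * X ^ 5 := by ring
        rw [this]; gcongr; nlinarith
      have h3 : 68 * (h : ℝ) ^ 4 * X ^ 5 = h ^ 3 * (68 * h * X ^ 5) := by ring
      have h4 : (202 / 100 * h * Y) ^ 3 = h ^ 3 * ((202 / 100) ^ 3 * Y ^ 3) := by ring
      have h5 := h2.trans h1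
      rw [h3, h4] at h5
      have h6 := le_of_mul_le_mul_left h5 (by positivity)
      have h7 : 0 ≤ h * X ^ 5 := by positivity
      norm_num [Nat.centralBinom, Nat.choose] at h6 ⊢
      nlinarith
  have hstep : ∀ j, P j → P (j + 1) ∨ P (j + 2) := by
    intro j hj
    have hmain := fun i h1 h2 => main_term_le hk0 hh1 hX (by nlinarith) hbig j hj (i := i) h1 h2
    rcases hne (j + 2) with h1 | h1
    · left
      exact far_of_im_padeForm_ne_zero hT hs hs0 hX hY hz hzw hθ1 hθ'1 hμ (j + 1) h1
        (hmain (j + 1) le_rfl (by omega))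
    · right
      exact far_of_im_padeForm_ne_zero hT hs hs0 hX hY hz hzw hθ1 hθ'1 hμ (j + 2) h1
        (hmain (j + 2) (by omega) le_rfl)
  have hinf : ∀ N, ∃ j, N ≤ j ∧ P j := by
    intro N
    induction N with
    | zero => exact ⟨0, le_rfl, hP0⟩
    | succ N ih =>
      obtain ⟨j, hj, hPj⟩ := ih
      rcases hstep j hPj with h1 | h1
      · exact ⟨j + 1, by omega, h1⟩
      · exact ⟨j + 2, by omega, h1⟩
  exact false_of_unbounded_growth hX hp0 hXp hinf

/-! ### Chains of gaps -/

/-- Two lower bounds for `sin 4θ = 4 sin θ (cos θ cos 2θ)` near the axis. -/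
theorem abs_sin_mul_le_abs_sin_four_mul {θ : ℝ} (hθ : |θ| ≤ Real.pi / 8) :
    4 * |Real.sin θ| * ((1 - Real.sin θ ^ 2) * (1 - 2 * Real.sin θ ^ 2)) ≤ |Real.sin (4 * θ)| ∧
      |Real.sin θ| ≤ 384 / 1000 * |Real.sin (4 * θ)| := by
  have hpi := Real.pi_pos
  have e : Real.sin (4 * θ) = 4 * Real.sin θ * (Real.cos θ * Real.cos (2 * θ)) := by
    rw [show 4 * θ = 2 * (2 * θ) by ring, Real.sin_two_mul, Real.sin_two_mul]; ring
  have hc1 : Real.cos (Real.pi / 8) ≤ Real.cos θ := by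
    rw [← Real.cos_abs θ]
    exact Real.cos_le_cos_of_nonneg_of_le_pi (abs_nonneg _) (by linarith) hθ
  have hc2 : Real.cos (Real.pi / 4) ≤ Real.cos (2 * θ) := by
    rw [← Real.cos_abs (2 * θ), abs_mul, abs_two]
    exact Real.cos_le_cos_of_nonneg_of_le_pi (by positivity) (by linarith) (by linarith)
  rw [Real.cos_pi_div_eight] at hc1
  rw [Real.cos_pi_div_four] at hc2
  have h2 : 1.4142 ≤ √2 := Real.le_sqrt_of_sq_le (by norm_num)
  have h3 : 1.8477 ≤ √(2 + √2) := Real.le_sqrt_of_sq_le (by linarith)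
  have hc1' : 0.92 ≤ Real.cos θ := by linarith
  have hc2' : 0.7071 ≤ Real.cos (2 * θ) := by linarith
  have hcc : 0 < Real.cos θ * Real.cos (2 * θ) := by positivity
  rw [e, abs_mul, abs_mul, abs_of_pos hcc, abs_of_pos (by norm_num : (0 : ℝ) < 4)]
  have hs := abs_nonneg (Real.sin θ)
  constructor
  · refine mul_le_mul_of_nonneg_left ?_ (by positivity)
    rw [← Real.cos_sq', ← Real.cos_two_mul_eq_one_sub]
    refine mul_le_mul_of_nonneg_right ?_ (by linarith)
    have := Real.cos_le_one θ
    nlinarith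
  · have : 0.6512 ≤ Real.cos θ * Real.cos (2 * θ) := by nlinarith
    nlinarith

theorem twentyOne_tenths_le_of_cube_le {r : ℝ} (hr : 1 ≤ r) (h : r ^ 3 ≤ 4435 / 10000 * (r ^ 4 + 1)) :
    21 / 10 ≤ r := by
  by_contra! hlt
  have h0 := mul_nonneg (sub_nonneg.2 hr) (sub_nonneg.2 hlt.le)
  nlinarith [mul_nonneg h0 (sq_nonneg r), mul_nonneg h0 (by linarith : 0 ≤ r)]

theorem twelve_fifths_le_of_cube_le {r : ℝ} (hr : 1 ≤ r) (h : r ^ 3 ≤ 396 / 1000 * (r ^ 4 + 1)) :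
    24 / 10 ≤ r := by
  by_contra! hlt
  have h0 := mul_nonneg (sub_nonneg.2 hr) (sub_nonneg.2 hlt.le)
  nlinarith [mul_nonneg h0 (sq_nonneg r), mul_nonneg h0 (by linarith : 0 ≤ r)]

/-- The bounds on `σ = |sin θ|` for a point at normalized distance `a` from the origin whose argument
`θ ∈ [-π/8, π/8]` satisfies `|sin 4θ| ≤ κ / a⁴`. -/
structure IsNearAxis (a κ σ : ℝ) : Prop where
  le : σ ≤ 384 / 1000
  mul_le : σ * a ^ 4 ≤ 384 / 1000 * κ
  mul_le_of_le : κ ≤ 44 / 100 * a ^ 4 → σ * a ^ 4 ≤ 3 / 10 * κ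
  mul_le_of_small : κ ≤ 54 / 1000 * a ^ 4 → σ * a ^ 4 ≤ 2504 / 10000 * κ

theorem isNearAxis_abs_sin {a κ θ : ℝ} (hθ : |θ| ≤ Real.pi / 8) (ha : 0 < a)
    (h : |Real.sin (4 * θ)| * a ^ 4 ≤ κ) : IsNearAxis a κ |Real.sin θ| := by
  obtain ⟨h1, h2⟩ := abs_sin_mul_le_abs_sin_four_mul hθ
  have h3 := Real.abs_sin_le_one (4 * θ)
  have ha4 : 0 < a ^ 4 := by positivity
  have hs := abs_nonneg (Real.sin θ)
  have hs4 := abs_nonneg (Real.sin (4 * θ))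
  rw [← sq_abs] at h1
  generalize |Real.sin θ| = σ at *
  generalize |Real.sin (4 * θ)| = ε at *
  have key : ∀ e c : ℝ, 0 < c → σ ≤ e → e ≤ 1 / 2 → 1 ≤ 4 * c * ((1 - e ^ 2) * (1 - 2 * e ^ 2)) →
      σ * a ^ 4 ≤ c * κ := by
    intro e c hc he he2 hce
    have h4 : (1 - e ^ 2) * (1 - 2 * e ^ 2) ≤ (1 - σ ^ 2) * (1 - 2 * σ ^ 2) := by
      apply mul_le_mul <;> nlinarith
    have h5 : σ ≤ c * ε := by
      calc σ = σ * 1 := (mul_one _).symm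
        _ ≤ σ * (4 * c * ((1 - e ^ 2) * (1 - 2 * e ^ 2))) := by gcongr
        _ ≤ σ * (4 * c * ((1 - σ ^ 2) * (1 - 2 * σ ^ 2))) := by gcongr
        _ = c * (4 * σ * ((1 - σ ^ 2) * (1 - 2 * σ ^ 2))) := by ring
        _ ≤ c * ε := by gcongr
    calc σ * a ^ 4 ≤ c * ε * a ^ 4 := by gcongr
      _ = c * (ε * a ^ 4) := by ring
      _ ≤ c * κ := by gcongr
  refine ⟨by linarith, ?_, fun h4 => ?_, fun h4 => ?_⟩
  · calc σ * a ^ 4 ≤ 384 / 1000 * ε * a ^ 4 := by gcongr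
      _ = 384 / 1000 * (ε * a ^ 4) := by ring
      _ ≤ _ := by gcongr
  · have h5 : ε ≤ 44 / 100 := le_of_mul_le_mul_right (h.trans h4) ha4
    exact key (169 / 1000) _ (by norm_num) (by linarith) (by norm_num) (by norm_num)
  · have h5 : ε ≤ 54 / 1000 := le_of_mul_le_mul_right (h.trans h4) ha4
    exact key (21 / 1000) _ (by norm_num) (by linarith) (by norm_num) (by norm_num)

/-- The gap inequality in terms of the ratio of the distances. -/
theorem sq_mul_cube_le {a r σ σ' c κ : ℝ} (ha : 0 < a) (hr : 0 < r) (h1 : σ * a ^ 4 ≤ c * κ)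
    (h2 : σ' * (r * a) ^ 4 ≤ c * κ) (hgap : 1 ≤ a * (r * a) * (σ + σ')) :
    a ^ 2 * r ^ 3 ≤ c * κ * (r ^ 4 + 1) := by
  calc a ^ 2 * r ^ 3 = a ^ 2 * r ^ 3 * 1 := (mul_one _).symm
    _ ≤ a ^ 2 * r ^ 3 * (a * (r * a) * (σ + σ')) := by gcongr
    _ = r ^ 4 * (σ * a ^ 4) + σ' * (r * a) ^ 4 := by ring
    _ ≤ r ^ 4 * (c * κ) + c * κ := by gcongr
    _ = _ := by ring

/-- The gap principle for the first two points of a class if `κ` is bounded absolutely. -/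
theorem le_of_gap_of_kappa_le {a b σ σ' κ : ℝ} (ha : 0 < a) (hab : a ≤ b) (hσ0 : 0 ≤ σ)
    (hσ'0 : 0 ≤ σ') (hσ : IsNearAxis a κ σ) (hσ' : IsNearAxis b κ σ')
    (hgap : 1 ≤ a * b * (σ + σ')) (hκ : κ ≤ 4 / 3) : 509 / 100 ≤ b ^ 2 := by
  have hb := ha.trans_le hab
  -- `1.0746` is slightly larger than the fourth root of `4 / 3`, so it is a distance at which the
  -- trivial bound `0.384` and the bound `0.384 κ / a⁴` for `|sin θ|` meet
  suffices 21 / 10 * 1.0746 ≤ b by nlinarith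
  have h1 := hσ.le
  have h2 := hσ'.le
  rcases lt_or_ge b 1.0746 with h3 | h3
  · exfalso
    have h4 : a * b * (σ + σ') ≤ 1.0746 * 1.0746 * (384 / 1000 + 384 / 1000) := by
      gcongr
      linarith
    linarith
  rcases le_or_gt a 1.0746 with h4 | h4
  · obtain ⟨r, rfl⟩ : ∃ r, b = r * 1.0746 := ⟨b / 1.0746, by field_simp⟩
    have hr : 1 ≤ r := by linarith
    have h5 : 1 ≤ 1.0746 * (r * 1.0746) * (384 / 1000 + σ') := hgap.trans (by gcongr)
    have h6 := sq_mul_cube_le (c := 384 / 1000) (κ := 1.0746 ^ 4) (by norm_num) (by linarith) le_rfl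
      (hσ'.mul_le.trans (by linarith)) h5
    have h7 := twentyOne_tenths_le_of_cube_le hr (by nlinarith [pow_pos (zero_lt_one.trans_le hr) 4])
    linarith
  · obtain ⟨r, rfl⟩ : ∃ r, b = r * a := ⟨b / a, by field_simp⟩
    have hr : 1 ≤ r := by
      by_contra! h5
      nlinarith
    have h6 := sq_mul_cube_le ha (by linarith) hσ.mul_le hσ'.mul_le hgap
    have h8 : κ ≤ 1.0746 ^ 2 * a ^ 2 := by nlinarith
    have h9 : a ^ 2 * r ^ 3 ≤ a ^ 2 * (4435 / 10000 * (r ^ 4 + 1)) := by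
      calc _ ≤ _ := h6
        _ ≤ 384 / 1000 * (1.0746 ^ 2 * a ^ 2) * (r ^ 4 + 1) := by gcongr
        _ = (384 / 1000 * 1.0746 ^ 2) * (a ^ 2 * (r ^ 4 + 1)) := by ring
        _ ≤ 4435 / 10000 * (a ^ 2 * (r ^ 4 + 1)) := by gcongr; norm_num
        _ = _ := by ring
    have h7 := twentyOne_tenths_le_of_cube_le hr (le_of_mul_le_mul_left h9 (by positivity))
    nlinarith

/-- The gap principle for the first two points of a class if the first one is not too small. -/
theorem le_of_gap_of_kappa_le_mul {a b σ σ' κ : ℝ} (ha : 0 < a) (hab : a ≤ b)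
    (hσ : IsNearAxis a κ σ) (hσ' : IsNearAxis b κ σ') (hgap : 1 ≤ a * b * (σ + σ'))
    (hκ : κ ≤ 132 / 100 * a ^ 2) (ha3 : 3 ≤ a ^ 2) : 576 / 100 * a ^ 2 ≤ b ^ 2 := by
  have hb := ha.trans_le hab
  have hab4 : a ^ 4 ≤ b ^ 4 := by gcongr
  have h44 : κ ≤ 44 / 100 * a ^ 4 := by nlinarith
  obtain ⟨r, rfl⟩ : ∃ r, b = r * a := ⟨b / a, by field_simp⟩
  have hr : 1 ≤ r := by
    by_contra! h5
    nlinarith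
  have h6 := sq_mul_cube_le ha (by linarith) (hσ.mul_le_of_le h44)
    (hσ'.mul_le_of_le (by linarith)) hgap
  have h9 : a ^ 2 * r ^ 3 ≤ a ^ 2 * (396 / 1000 * (r ^ 4 + 1)) := by
    calc _ ≤ _ := h6
      _ ≤ 3 / 10 * (132 / 100 * a ^ 2) * (r ^ 4 + 1) := by gcongr
      _ = _ := by ring
  have h7 := twelve_fifths_le_of_cube_le hr (le_of_mul_le_mul_left h9 (by positivity))
  rw [mul_pow]
  gcongr
  nlinarith

/-- The gap principle for the second and the third point of a class. -/
theorem cube_le_mul_of_gap {a b σ σ' κ : ℝ} (ha : 0 < a) (hab : a ≤ b)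
    (hσ : IsNearAxis a κ σ) (hσ' : IsNearAxis b κ σ') (hgap : 1 ≤ a * b * (σ + σ')) (hκ0 : 0 < κ)
    (hκ : κ ≤ 4 / 15 * a ^ 2) (ha5 : 5 ≤ a ^ 2) : 399 / 100 * a ^ 3 ≤ κ * b := by
  have hb := ha.trans_le hab
  have hab4 : a ^ 4 ≤ b ^ 4 := by gcongr
  have h54 : κ ≤ 54 / 1000 * a ^ 4 := by nlinarith
  obtain ⟨r, rfl⟩ : ∃ r, b = r * a := ⟨b / a, by field_simp⟩
  have hr : 1 ≤ r := by
    by_contra! h5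
    nlinarith
  have h6 := sq_mul_cube_le ha (by linarith) (hσ.mul_le_of_small h54)
    (hσ'.mul_le_of_small (by linarith)) hgap
  have h9 : a ^ 2 * r ^ 3 ≤ a ^ 2 * (668 / 10000 * (r ^ 4 + 1)) := by
    calc _ ≤ _ := h6
      _ ≤ 2504 / 10000 * (4 / 15 * a ^ 2) * (r ^ 4 + 1) := by gcongr
      _ = (2504 / 10000 * (4 / 15)) * (a ^ 2 * (r ^ 4 + 1)) := by ring
      _ ≤ 668 / 10000 * (a ^ 2 * (r ^ 4 + 1)) := by gcongr; norm_num
      _ = _ := by ring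
  have h10 := le_of_mul_le_mul_left h9 (by positivity)
  have hr3 : 1 ≤ r ^ 3 := one_le_pow₀ hr
  have hr10 : 10 ≤ r := by
    by_contra! h5
    have : r ^ 4 ≤ 10 * r ^ 3 := by
      rw [pow_succ']; gcongr
    linarith
  have h11 : 1 ≤ 1 / 10000 * r ^ 4 := by
    have : (10 : ℝ) ^ 4 ≤ r ^ 4 := by gcongr
    linarith
  have h12 : r ^ 3 * a ^ 2 ≤ r ^ 3 * (2505 / 10000 * κ * r) := by
    calc r ^ 3 * a ^ 2 = a ^ 2 * r ^ 3 := mul_comm _ _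
      _ ≤ _ := h6
      _ ≤ 2504 / 10000 * κ * (r ^ 4 + 1 / 10000 * r ^ 4) := by gcongr
      _ = (2504 / 10000 * (10001 / 10000)) * (r ^ 3 * (κ * r)) := by ring
      _ ≤ 2505 / 10000 * (r ^ 3 * (κ * r)) := by gcongr; norm_num
      _ = _ := by ring
  have h13 := le_of_mul_le_mul_left h12 (by positivity)
  nlinarith

/-- The size of the smallest point of a class, in the normalization `a = |z| / √s`, `κ = 4h / s`: either
`κ` and `h³ / s` are bounded absolutely or both are bounded in terms of `a`. -/
def IsAdmissibleStart (s h a : ℝ) : Prop :=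
  4 * h / s ≤ 4 / 3 ∧ h ^ 3 ≤ 3 * s ∨
    4 * h / s ≤ 132 / 100 * a ^ 2 ∧ 3 ≤ a ^ 2 ∧ h ^ 3 ≤ 4 * a ^ 4 * s

/-- The third point of a class is large: beyond the threshold of the Thue–Siegel principle, which reads
`270000 s² h¹⁰ ≤ c⁸` in the normalization `c = |z| / √s`. -/
theorem le_third_of_gaps {s h a b c σa σb σc : ℝ} (hs : 0 < s) (hh : 0 < h) (ha : 0 < a)
    (hab : a ≤ b) (hbc : b ≤ c) (ha0 : 0 ≤ σa) (hb0 : 0 ≤ σb)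
    (hσa : IsNearAxis a (4 * h / s) σa) (hσb : IsNearAxis b (4 * h / s) σb)
    (hσc : IsNearAxis c (4 * h / s) σc) (hgab : 1 ≤ a * b * (σa + σb))
    (hgbc : 1 ≤ b * c * (σb + σc)) (hstart : IsAdmissibleStart s h a) :
    270000 * s ^ 2 * h ^ 10 ≤ c ^ 8 := by
  have hb := ha.trans_le hab
  have hc := hb.trans_le hbc
  have hκ0 : 0 < 4 * h / s := by positivity
  -- what is needed of the second point: `2.88 h^(3/2) / √s ≤ b²`, where `2.88 ^ 2 = 8.2944`
  obtain ⟨h5, hκ, hL⟩ : 5 ≤ b ^ 2 ∧ 4 * h / s ≤ 4 / 15 * b ^ 2 ∧ 8.2944 * h ^ 3 ≤ b ^ 4 * s := by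
    rcases hstart with ⟨h1, h2⟩ | ⟨h1, h2, h3⟩
    · have h4 := le_of_gap_of_kappa_le ha hab ha0 hb0 hσa hσb hgab h1
      refine ⟨by linarith, by linarith, ?_⟩
      have : 24.8832 ≤ b ^ 4 := by nlinarith
      nlinarith
    · have h4 := le_of_gap_of_kappa_le_mul ha hab hσa hσb hgab h1 h2
      refine ⟨by linarith, by linarith, ?_⟩
      have : 33.1776 * a ^ 4 ≤ b ^ 4 := by nlinarith
      nlinarith
  have h6 := cube_le_mul_of_gap hb hbc hσb hσc hgbc hκ0 hκ h5
  have h7 : 399 / 100 * (b ^ 3 * s) ≤ 4 * h * c := by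
    have e : 4 * h / s * c * s = 4 * h * c := by field_simp
    rw [← e]
    nlinarith
  have h8 : (399 / 100 * (b ^ 3 * s)) ^ 8 ≤ (4 * h * c) ^ 8 := by gcongr
  have h9 : (8.2944 * h ^ 3) ^ 6 ≤ (b ^ 4 * s) ^ 6 := by gcongr
  have h10 : (4 : ℝ) ^ 8 * h ^ 8 * (270000 * s ^ 2 * h ^ 10) ≤ 4 ^ 8 * h ^ 8 * c ^ 8 := by
    calc (4 : ℝ) ^ 8 * h ^ 8 * (270000 * s ^ 2 * h ^ 10)
        = (4 ^ 8 * 270000) * (s ^ 2 * h ^ 18) := by ring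
      _ ≤ ((399 / 100) ^ 8 * 8.2944 ^ 6) * (s ^ 2 * h ^ 18) :=
          mul_le_mul_of_nonneg_right (by norm_num) (by positivity)
      _ = (399 / 100) ^ 8 * s ^ 2 * (8.2944 * h ^ 3) ^ 6 := by ring
      _ ≤ (399 / 100) ^ 8 * s ^ 2 * (b ^ 4 * s) ^ 6 := by gcongr
      _ = (399 / 100 * (b ^ 3 * s)) ^ 8 := by ring
      _ ≤ _ := h8
      _ = _ := by ring
  exact le_of_mul_le_mul_left h10 (by positivity)

/-- A class contains at most three points: by the gap principle the third one is large, and then the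
Thue–Siegel principle excludes a fourth one. -/
theorem false_of_four_in_class {T : AddSubgroup ℝ} (hT : HasIntegralProducts T) {s : ℝ}
    {k : ℤ} (hs : s ^ 2 = k) (hs0 : 0 < s) {X θ : Fin 4 → ℝ} {f : Fin 4 → ℤ}
    {d : Fin 4 → Fin 4 → ℤ} {h : ℕ} (hh : 0 < h) (hX : ∀ i, 0 < X i) (hXm : Monotone X)
    (hd : ∀ i j, i < j → d i j ≠ 0)
    (hz : ∀ i, IsResolventValue T s (X i * Complex.exp (θ i * Complex.I)) (f i))
    (hzw : ∀ i j, i < j → IsResolventPair T s (X i * Complex.exp (θ i * Complex.I))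
      (X j * Complex.exp (θ j * Complex.I)) (d i j))
    (hf : ∀ i, |f i| ≤ h) (hθ : ∀ i, |θ i| ≤ Real.pi / 8)
    (hstart : IsAdmissibleStart s h (X 0 / √s)) : False := by
  have hu0 : 0 < √s := Real.sqrt_pos.2 hs0
  have hu2 : √s ^ 2 = s := Real.sq_sqrt hs0.le
  have hu4 : √s ^ 4 = s ^ 2 := by rw [show √s ^ 4 = (√s ^ 2) ^ 2 by ring, hu2]
  have hh0 : (0 : ℝ) < h := by exact_mod_cast hh
  have hnear : ∀ i, IsNearAxis (X i / √s) (4 * h / s) |Real.sin (θ i)| := by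
    intro i
    refine isNearAxis_abs_sin (hθ i) (by have := hX i; positivity) ?_
    have h1 := four_mul_eq_of_isResolventValue (hz i)
    have h2 : |(f i : ℝ)| ≤ h := by exact_mod_cast hf i
    have h3 : |Real.sin (4 * θ i)| * X i ^ 4 ≤ 4 * s * h := by
      have hX4 : 0 < X i ^ 4 := pow_pos (hX i) 4
      have h4 : |X i ^ 4 * Real.sin (4 * θ i)| = |4 * s * f i| := by rw [h1]
      rw [abs_mul, abs_mul, abs_of_pos hX4, abs_of_pos (by positivity : 0 < 4 * s)] at h4
      rw [mul_comm, h4]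
      gcongr
    rw [div_pow, hu4, ← mul_div_assoc, div_le_div_iff₀ (by positivity) hs0]
    nlinarith
  have hgap : ∀ i j, i < j →
      1 ≤ X i / √s * (X j / √s) * (|Real.sin (θ i)| + |Real.sin (θ j)|) := by
    intro i j hij
    have h1 := le_mul_add_of_isResolventPair hs0 (hX i) (hX j) (hd i j hij) (hzw i j hij)
    rw [div_mul_div_comm, ← sq, hu2, div_mul_eq_mul_div, le_div_iff₀ hs0, one_mul]
    exact h1
  have hmono : ∀ i j, i ≤ j → X i / √s ≤ X j / √s := fun i j hij =>
    div_le_div_of_nonneg_right (hXm hij) hu0.le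
  have h1 := le_third_of_gaps hs0 hh0 (by have := hX 0; positivity) (hmono 0 1 (by decide))
    (hmono 1 2 (by decide)) (abs_nonneg _) (abs_nonneg _) (hnear 0) (hnear 1) (hnear 2)
    (hgap 0 1 (by decide)) (hgap 1 2 (by decide)) hstart
  refine false_of_large_of_isResolventPair hT hs hs0 (hX 2) (hXm (by decide : (2 : Fin 4) ≤ 3)) hh
    (hd 2 3 (by decide)) (hz 2) (hz 3) (hzw 2 3 (by decide)) (hf 2) (hf 3) (hθ 2) (hθ 3) ?_
  have h8 : √s ^ 8 = s ^ 4 := by rw [show √s ^ 8 = (√s ^ 2) ^ 4 by ring, hu2]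
  rw [div_pow, h8, le_div_iff₀ (by positivity)] at h1
  rw [← hs]
  calc _ = _ := by ring
    _ ≤ _ := h1

/-! ### The reduced covariant and the resolvent linear form -/

/-- The relations between a quartic form with vanishing invariant `J`, the coefficients of its reduced
quadratic covariant `A x² + 2 B x y + C y²`, the integer `b = a₂ / 3`, and `k = I / 3`. -/
structure HasReducedCovariant (F : BinaryQuartic) (b k : ℤ) (A B C : ℝ) : Prop where
  a₂_eq : F.a₂ = 3 * b
  k_eq : k = 3 * b ^ 2 - F.a₁ * F.a₃ + 4 * F.a₀ * F.a₄
  j_eq : 2 * b ^ 3 - F.a₁ * b * F.a₃ + F.a₁ ^ 2 * F.a₄ - 8 * F.a₀ * b * F.a₄ + F.a₀ * F.a₃ ^ 2 = 0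
  A_pos : 0 < A
  k_pos : 0 < k
  AA : A ^ 2 = F.a₁ ^ 2 - 8 * F.a₀ * b
  AB : A * B = F.a₁ * b - 2 * F.a₀ * F.a₃
  AC : A * C = 4 * b ^ 2 - F.a₁ * F.a₃
  BB : B ^ 2 = b ^ 2 - 4 * F.a₀ * F.a₄
  BC : B * C = F.a₃ * b - 2 * F.a₁ * F.a₄
  CC : C ^ 2 = F.a₃ ^ 2 - 8 * F.a₄ * b
  two_mul_abs_B_le : 2 * |B| ≤ A
  A_le : A ≤ C

theorem eval_hessian (F : BinaryQuartic) (x y : ℝ) :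
    MvPolynomial.eval ![x, y] F.hessian =
      (12 * F.a₀ * x ^ 2 + 6 * F.a₁ * x * y + 2 * F.a₂ * y ^ 2)
        * (2 * F.a₂ * x ^ 2 + 6 * F.a₃ * x * y + 12 * F.a₄ * y ^ 2)
      - (3 * F.a₁ * x ^ 2 + 4 * F.a₂ * x * y + 3 * F.a₃ * y ^ 2) ^ 2 := by
  have h : ∀ (i : Fin 2) (n : ℕ) [n.AtLeastTwo],
      MvPolynomial.pderiv i (OfNat.ofNat n : MvPolynomial (Fin 2) ℝ) = 0 := by
    intro i n _
    rw [← Nat.cast_ofNat (R := MvPolynomial (Fin 2) ℝ)]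
    exact Derivation.map_natCast _ _
  simp [BinaryQuartic.hessian, BinaryQuartic.form, Derivation.leibniz, Derivation.leibniz_pow, h]
  ring

/-- The middle root of `t³ - 3 I t` is `0`. -/
theorem middle_root_eq_zero {t₁ t t₃ i : ℝ} (h1 : t₁ < t) (h3 : t < t₃) (e1 : t₁ ^ 3 - i * t₁ = 0)
    (e : t ^ 3 - i * t = 0) (e3 : t₃ ^ 3 - i * t₃ = 0) : t = 0 := by
  by_contra h
  have hi : i = t ^ 2 := mul_left_cancel₀ h (by linarith)
  have key : ∀ u, u ≠ t → u ^ 3 - i * u = 0 → u = 0 ∨ u = -t := by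
    intro u hu hu2
    rcases eq_or_ne u 0 with h0 | h0
    · exact Or.inl h0
    · right
      have h4 : (u - t) * (u + t) = 0 := by
        rw [hi] at hu2
        exact (mul_eq_zero.1 (show u * ((u - t) * (u + t)) = 0 by linarith)).resolve_left h0
      linarith [(mul_eq_zero.1 h4).resolve_left (sub_ne_zero.2 hu)]
  rcases key t₁ h1.ne e1 with h5 | h5 <;> rcases key t₃ h3.ne' e3 with h6 | h6 <;> linarith

theorem exists_hasReducedCovariant {F : BinaryQuartic} (hred : F.IsReduced) (hJ : F.invJ = 0) :
    ∃ b k A B C, HasReducedCovariant F b k A B C := by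
  obtain ⟨φ₁, φ, φ₃, h1, h3, hroot, A, B, C, hA, hdisc, hm, hBA, hAC⟩ := hred
  have hφ : φ = 0 := by
    refine middle_root_eq_zero h1 h3 (i := 3 * F.invI) ?_ ?_ ?_
    · have := hroot φ₁ (by simp); rw [hJ] at this; push_cast at this; linarith
    · have := hroot φ (by simp); rw [hJ] at this; push_cast at this; linarith
    · have := hroot φ₃ (by simp); rw [hJ] at this; push_cast at this; linarith
  obtain ⟨b, hb⟩ : (3 : ℤ) ∣ F.a₂ := by
    have h4 : (3 : ℤ) ∣ F.a₂ ^ 3 := by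
      unfold BinaryQuartic.invJ at hJ
      have : (3 : ℤ) ∣ 2 * F.a₂ ^ 3 := ⟨3 * F.a₁ * F.a₂ * F.a₃ - 9 * F.a₁ ^ 2 * F.a₄
        + 24 * F.a₀ * F.a₂ * F.a₄ - 9 * F.a₀ * F.a₃ ^ 2, by linarith⟩
      omega
    exact Int.prime_three.dvd_of_dvd_pow h4
  have hjeq : 2 * b ^ 3 - F.a₁ * b * F.a₃ + F.a₁ ^ 2 * F.a₄ - 8 * F.a₀ * b * F.a₄
      + F.a₀ * F.a₃ ^ 2 = 0 := by
    unfold BinaryQuartic.invJ at hJ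
    rw [hb] at hJ
    linarith
  have hjR : 2 * (b : ℝ) ^ 3 - F.a₁ * b * F.a₃ + F.a₁ ^ 2 * F.a₄ - 8 * F.a₀ * b * F.a₄
      + F.a₀ * F.a₃ ^ 2 = 0 := by exact_mod_cast hjeq
  have hbR : (F.a₂ : ℝ) = 3 * b := by exact_mod_cast hb
  have hev : ∀ x y : ℝ, -1 / 9 * ((12 * F.a₀ * x ^ 2 + 6 * F.a₁ * x * y + 2 * F.a₂ * y ^ 2)
        * (2 * F.a₂ * x ^ 2 + 6 * F.a₃ * x * y + 12 * F.a₄ * y ^ 2)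
      - (3 * F.a₁ * x ^ 2 + 4 * F.a₂ * x * y + 3 * F.a₃ * y ^ 2) ^ 2)
        = (A * x ^ 2 + B * x * y + C * y ^ 2) ^ 2 := by
    intro x y
    have := congrArg (MvPolynomial.eval ![x, y]) hm
    rw [hφ, map_add, map_mul, map_mul, eval_hessian] at this
    simpa using this
  have e1 := hev 1 0
  have e2 := hev 0 1
  have e3 := hev 1 1
  have e4 := hev 1 (-1)
  have e5 := hev 2 1
  rw [hbR] at e1 e2 e3 e4 e5
  have AA : A ^ 2 = F.a₁ ^ 2 - 8 * F.a₀ * b := by linarith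
  have CC : C ^ 2 = F.a₃ ^ 2 - 8 * F.a₄ * b := by linarith
  have AB : A * (B / 2) = F.a₁ * b - 2 * F.a₀ * F.a₃ := by linarith
  have BC : B / 2 * C = F.a₃ * b - 2 * F.a₁ * F.a₄ := by linarith
  have hE : 4 * (B / 2) ^ 2 + 2 * (A * C) = 12 * b ^ 2 - 2 * F.a₁ * F.a₃ - 16 * F.a₀ * F.a₄ := by
    linarith
  -- the coefficients of `m²` determine only a combination of `A C` and `B²`; they are separated by `J = 0`
  have BB : (B / 2) ^ 2 = b ^ 2 - 4 * F.a₀ * F.a₄ := by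
    refine mul_left_cancel₀ (pow_ne_zero 2 hA.ne') ?_
    rw [← mul_pow, AB, AA]
    linear_combination 4 * F.a₀ * hjR
  have AC : A * C = 4 * b ^ 2 - F.a₁ * F.a₃ := by linarith
  have hk : 0 < 3 * b ^ 2 - F.a₁ * F.a₃ + 4 * F.a₀ * F.a₄ := by
    have : (0 : ℝ) < 3 * b ^ 2 - F.a₁ * F.a₃ + 4 * F.a₀ * F.a₄ := by linarith
    exact_mod_cast this
  refine ⟨b, _, A, B / 2, C, hb, rfl, hjeq, hA, hk, AA, AB, AC, BB, BC, CC, ?_, hAC⟩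
  rw [abs_div, abs_two]
  linarith

namespace HasReducedCovariant

variable {F : BinaryQuartic} {b k : ℤ} {A B C : ℝ}

theorem disc_eq (H : HasReducedCovariant F b k A B C) : A * C - B ^ 2 = k := by
  rw [H.AC, H.BB, H.k_eq]; push_cast; ring

theorem rel_one (H : HasReducedCovariant F b k A B C) : b * A - F.a₁ * B + 2 * F.a₀ * C = 0 := by
  refine mul_left_cancel₀ H.A_pos.ne' ?_
  linear_combination b * H.AA - F.a₁ * H.AB + 2 * F.a₀ * H.AC

theorem rel_two (H : HasReducedCovariant F b k A B C) : F.a₃ * A - 4 * b * B + F.a₁ * C = 0 := by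
  refine mul_left_cancel₀ H.A_pos.ne' ?_
  linear_combination F.a₃ * H.AA - 4 * b * H.AB + F.a₁ * H.AC

theorem rel_three (H : HasReducedCovariant F b k A B C) :
    2 * F.a₄ * A - F.a₃ * B + b * C = 0 := by
  have hjR : 2 * (b : ℝ) ^ 3 - F.a₁ * b * F.a₃ + F.a₁ ^ 2 * F.a₄ - 8 * F.a₀ * b * F.a₄
      + F.a₀ * F.a₃ ^ 2 = 0 := by exact_mod_cast H.j_eq
  refine mul_left_cancel₀ H.A_pos.ne' ?_
  linear_combination 2 * F.a₄ * H.AA - F.a₃ * H.AB + b * H.AC + 2 * hjR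

end HasReducedCovariant

/-- The additive group generated by the coefficients `A`, `B`, `C` of the covariant. -/
def covariantLattice (A B C : ℝ) : AddSubgroup ℝ where
  carrier := {t | ∃ x y z : ℤ, t = x * A + y * B + z * C}
  zero_mem' := ⟨0, 0, 0, by simp⟩
  add_mem' := by
    rintro _ _ ⟨x, y, z, rfl⟩ ⟨x', y', z', rfl⟩
    exact ⟨x + x', y + y', z + z', by push_cast; ring⟩
  neg_mem' := by
    rintro _ ⟨x, y, z, rfl⟩
    exact ⟨-x, -y, -z, by push_cast; ring⟩

theorem hasIntegralProducts_covariantLattice {F : BinaryQuartic} {b k : ℤ} {A B C : ℝ}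
    (H : HasReducedCovariant F b k A B C) : HasIntegralProducts (covariantLattice A B C) := by
  rintro _ ⟨x, y, z, rfl⟩ _ ⟨x', y', z', rfl⟩
  refine ⟨x * x' * (F.a₁ ^ 2 - 8 * F.a₀ * b) + (x * y' + y * x') * (F.a₁ * b - 2 * F.a₀ * F.a₃)
    + (x * z' + z * x') * (4 * b ^ 2 - F.a₁ * F.a₃) + y * y' * (b ^ 2 - 4 * F.a₀ * F.a₄)
    + (y * z' + z * y') * (F.a₃ * b - 2 * F.a₁ * F.a₄)
    + z * z' * (F.a₃ ^ 2 - 8 * F.a₄ * b), ?_⟩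
  push_cast
  rw [← H.AA, ← H.AB, ← H.AC, ← H.BB, ← H.BC, ← H.CC]
  ring

/-- The quartic form is the imaginary part of the fourth power of a complex linear form: with
`τ = F_y (A x + B y) - F_x (B x + C y)` the quartic form `τ + 4 s F i` is a multiple of
`(A x + (B + s i) y) ^ 4`. -/
theorem value_mul_eq {F : BinaryQuartic} {b k : ℤ} {A B C s : ℝ}
    (H : HasReducedCovariant F b k A B C) (hs : s ^ 2 = k) (x y : ℤ) :
    (A : ℂ) ^ 4 * ((((F.a₁ * x ^ 3 + 6 * b * x ^ 2 * y + 3 * F.a₃ * x * y ^ 2 + 4 * F.a₄ * y ^ 3)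
        * (A * x + B * y) - (4 * F.a₀ * x ^ 3 + 3 * F.a₁ * x ^ 2 * y + 6 * b * x * y ^ 2
        + F.a₃ * y ^ 3) * (B * x + C * y) : ℝ) : ℂ) + 4 * s * (F.value x y : ℤ) * Complex.I)
      = (((F.a₁ * A - 4 * F.a₀ * B : ℝ) : ℂ) + 4 * s * F.a₀ * Complex.I)
        * (A * x + (B + s * Complex.I) * y) ^ 4 := by
  have r1 : (b * A - F.a₁ * B + 2 * F.a₀ * C : ℂ) = 0 := by exact_mod_cast H.rel_one
  have r2 : (F.a₃ * A - 4 * b * B + F.a₁ * C : ℂ) = 0 := by exact_mod_cast H.rel_two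
  have r3 : (2 * F.a₄ * A - F.a₃ * B + b * C : ℂ) = 0 := by exact_mod_cast H.rel_three
  have hk : (s ^ 2 : ℂ) = A * C - B ^ 2 := by
    have := H.disc_eq
    rw [← hs] at this
    exact_mod_cast this.symm
  have hI := Complex.I_sq
  have ha2 : (F.a₂ : ℂ) = 3 * b := by exact_mod_cast congrArg (Int.cast (R := ℂ)) H.a₂_eq
  -- the coefficients of the resolvent and their recursion
  set g : ℂ := B + s * Complex.I with hg
  obtain ⟨P0, hP0⟩ : ∃ P : ℂ, P = F.a₁ * A - 4 * F.a₀ * B + 4 * s * F.a₀ * Complex.I := ⟨_, rfl⟩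
  obtain ⟨P1, hP1⟩ : ∃ P : ℂ, P = 6 * b * A - 2 * F.a₁ * B - 4 * F.a₀ * C
    + 4 * s * F.a₁ * Complex.I := ⟨_, rfl⟩
  obtain ⟨P2, hP2⟩ : ∃ P : ℂ, P = 3 * F.a₃ * A - 3 * F.a₁ * C + 4 * s * (3 * b) * Complex.I :=
    ⟨_, rfl⟩
  obtain ⟨P3, hP3⟩ : ∃ P : ℂ, P = 4 * F.a₄ * A + 2 * F.a₃ * B - 6 * b * C
    + 4 * s * F.a₃ * Complex.I := ⟨_, rfl⟩
  obtain ⟨P4, hP4⟩ : ∃ P : ℂ, P = 4 * F.a₄ * B - F.a₃ * C + 4 * s * F.a₄ * Complex.I := ⟨_, rfl⟩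
  have e1 : P1 * A = 4 * P0 * g := by
    rw [hP1, hP0, hg]
    linear_combination (6 * A) * r1 - 16 * F.a₀ * s ^ 2 * hI + 16 * F.a₀ * hk
  have e2 : 2 * P2 * A = 3 * P1 * g := by
    rw [hP2, hP1, hg]
    linear_combination (6 * s * Complex.I + 6 * B) * r1 + 6 * A * r2 - 12 * F.a₁ * s ^ 2 * hI
      + 12 * F.a₁ * hk
  have e3 : 3 * P3 * A = 2 * P2 * g := by
    rw [hP3, hP2, hg]
    linear_combination (6 * s * Complex.I + 6 * B) * r2 + 6 * A * r3 - 24 * b * s ^ 2 * hI + 24 * b * hk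
  have e4 : 4 * P4 * A = P3 * g := by
    rw [hP4, hP3, hg]
    linear_combination (6 * s * Complex.I + 6 * B) * r3 - 4 * F.a₃ * s ^ 2 * hI + 4 * F.a₃ * hk
  have hval : ((F.value x y : ℤ) : ℂ) = F.a₀ * x ^ 4 + F.a₁ * x ^ 3 * y + 3 * b * x ^ 2 * y ^ 2
      + F.a₃ * x * y ^ 3 + F.a₄ * y ^ 4 := by
    rw [← ha2]; simp [BinaryQuartic.value]
  have hlhs : ((((F.a₁ * x ^ 3 + 6 * b * x ^ 2 * y + 3 * F.a₃ * x * y ^ 2 + 4 * F.a₄ * y ^ 3)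
        * (A * x + B * y) - (4 * F.a₀ * x ^ 3 + 3 * F.a₁ * x ^ 2 * y + 6 * b * x * y ^ 2
        + F.a₃ * y ^ 3) * (B * x + C * y) : ℝ) : ℂ) + 4 * s * (F.value x y : ℤ) * Complex.I)
      = P0 * x ^ 4 + P1 * x ^ 3 * y + P2 * x ^ 2 * y ^ 2 + P3 * x * y ^ 3 + P4 * y ^ 4 := by
    rw [hval, hP0, hP1, hP2, hP3, hP4]; push_cast; ring
  have hP0' : (((F.a₁ * A - 4 * F.a₀ * B : ℝ) : ℂ) + 4 * s * F.a₀ * Complex.I) = P0 := by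
    rw [hP0]; push_cast; ring
  rw [hlhs, hP0']
  have e2' : P2 * A ^ 2 = 6 * P0 * g ^ 2 := by linear_combination A / 2 * e2 + 3 / 2 * g * e1
  have e3' : P3 * A ^ 3 = 4 * P0 * g ^ 3 := by linear_combination A ^ 2 / 3 * e3 + 2 / 3 * g * e2'
  have e4' : P4 * A ^ 4 = P0 * g ^ 4 := by linear_combination A ^ 3 / 4 * e4 + 1 / 4 * g * e3'
  linear_combination A ^ 3 * x ^ 3 * y * e1 + A ^ 2 * x ^ 2 * y ^ 2 * e2' + A * x * y ^ 3 * e3'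
    + y ^ 4 * e4'

/-- The leading coefficient of `τ + 4 s F i` has absolute value `A ^ 2`. -/
theorem norm_leading_eq {F : BinaryQuartic} {b k : ℤ} {A B C s : ℝ}
    (H : HasReducedCovariant F b k A B C) (hs : s ^ 2 = k) :
    ‖(((F.a₁ * A - 4 * F.a₀ * B : ℝ) : ℂ) + 4 * s * F.a₀ * Complex.I)‖ = A ^ 2 := by
  have h1 : ((((F.a₁ * A - 4 * F.a₀ * B : ℝ) : ℂ) + 4 * s * F.a₀ * Complex.I))
      = ((F.a₁ * A - 4 * F.a₀ * B : ℝ) : ℂ) + ((4 * s * F.a₀ : ℝ) : ℂ) * Complex.I := by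
    push_cast; ring
  rw [h1, Complex.norm_add_mul_I, Real.sqrt_eq_iff_eq_sq (by positivity) (by positivity)]
  linear_combination 16 * (F.a₀ : ℝ) ^ 2 * hs - 16 * (F.a₀ : ℝ) ^ 2 * H.disc_eq
    + 8 * F.a₀ * A * H.rel_one - A ^ 2 * H.AA

/-- The resolvent linear form `z` of a quartic form with vanishing invariant `J`: the covariant is `|z|²`,
and the quartic form is the imaginary part of `z ^ 4 / (4 s)`. -/
theorem exists_resolvent {F : BinaryQuartic} {b k : ℤ} {A B C s : ℝ}
    (H : HasReducedCovariant F b k A B C) (hs : s ^ 2 = k) : ∃ z : ℤ → ℤ → ℂ,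
      (∀ x y, ‖z x y‖ ^ 2 = A * x ^ 2 + 2 * B * x * y + C * y ^ 2) ∧
      (∀ x y, IsResolventValue (covariantLattice A B C) s (z x y) (F.value x y)) ∧
      ∀ x y x' y', IsResolventPair (covariantLattice A B C) s (z x y) (z x' y')
        (x' * y - x * y') := by
  have hA := H.A_pos
  have hAC : (A : ℂ) ≠ 0 := by exact_mod_cast hA.ne'
  have hsA : (((√A : ℝ) : ℂ)) ^ 2 = A := by exact_mod_cast Real.sq_sqrt hA.le
  have hsA0 : ((√A : ℝ) : ℂ) ≠ 0 := by exact_mod_cast (Real.sqrt_pos.2 hA).ne'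
  obtain ⟨P0, hP0⟩ : ∃ P : ℂ,
    P = ((F.a₁ * A - 4 * F.a₀ * B : ℝ) : ℂ) + 4 * s * F.a₀ * Complex.I := ⟨_, rfl⟩
  obtain ⟨w, hw⟩ := IsAlgClosed.exists_pow_nat_eq (P0 / A ^ 2) (n := 4) (by norm_num)
  have hw1 : ‖w‖ = 1 := by
    have h1 : ‖w‖ ^ 4 = 1 := by
      rw [← norm_pow, hw, norm_div, hP0, norm_leading_eq H hs, norm_pow, Complex.norm_real,
        Real.norm_of_nonneg hA.le, div_self (by positivity)]
    exact (pow_eq_one_iff_of_nonneg (norm_nonneg _) (by norm_num)).1 h1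
  -- the resolvent form is `w (A x + (B + s i) y) / √A`
  have hww : (starRingEnd ℂ) w * w = 1 := by
    rw [mul_comm, Complex.mul_conj, Complex.normSq_eq_norm_sq, hw1]; simp
  have hpair : ∀ x y x' y' : ℤ, (starRingEnd ℂ) (w * ((A * x' + (B + s * Complex.I) * y') / √A))
      * (w * ((A * x + (B + s * Complex.I) * y) / √A))
      = ((A * (x * x') + B * (x * y' + x' * y) + C * (y * y') : ℝ) : ℂ)
        + s * ((x' * y - x * y' : ℤ) : ℂ) * Complex.I := by
    intro x y x' y'
    have hk : (s ^ 2 : ℂ) = A * C - B ^ 2 := by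
      have := H.disc_eq
      rw [← hs] at this
      exact_mod_cast this.symm
    simp only [map_mul, map_div₀, map_add, Complex.conj_ofReal, Complex.conj_I, map_intCast]
    have e : (starRingEnd ℂ) w * ((A * x' + (B + s * -Complex.I) * y') / √A)
        * (w * ((A * x + (B + s * Complex.I) * y) / √A))
        = ((starRingEnd ℂ) w * w) * ((A * x' + (B + s * -Complex.I) * y')
          * (A * x + (B + s * Complex.I) * y)) / √A ^ 2 := by
      field_simp
    rw [e, hww, hsA, div_eq_iff hAC]
    push_cast
    linear_combination (y * y' : ℂ) * hk - (s ^ 2 * y * y' : ℂ) * Complex.I_sq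
  refine ⟨fun x y => w * ((A * x + (B + s * Complex.I) * y) / √A), fun x y => ?_, fun x y => ?_,
    fun x y x' y' => ?_⟩
  · have h1 := hpair x y x y
    rw [mul_comm, Complex.mul_conj, Complex.normSq_eq_norm_sq] at h1
    have h2 : ‖w * ((A * x + (B + s * Complex.I) * y) / √A)‖ ^ 2
        = A * (x * x) + B * (x * y + x * y) + C * (y * y) := by
      have h3 := congrArg Complex.re h1
      rw [Complex.ofReal_re] at h3
      rw [h3]
      simp
    rw [h2]; ring
  · refine ⟨(F.a₁ * x ^ 3 + 6 * b * x ^ 2 * y + 3 * F.a₃ * x * y ^ 2 + 4 * F.a₄ * y ^ 3)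
        * (A * x + B * y) - (4 * F.a₀ * x ^ 3 + 3 * F.a₁ * x ^ 2 * y + 6 * b * x * y ^ 2
        + F.a₃ * y ^ 3) * (B * x + C * y),
      ⟨(F.a₁ * x ^ 3 + 6 * b * x ^ 2 * y + 3 * F.a₃ * x * y ^ 2 + 4 * F.a₄ * y ^ 3) * x,
      (F.a₁ * x ^ 3 + 6 * b * x ^ 2 * y + 3 * F.a₃ * x * y ^ 2 + 4 * F.a₄ * y ^ 3) * y -
      (4 * F.a₀ * x ^ 3 + 3 * F.a₁ * x ^ 2 * y + 6 * b * x * y ^ 2 + F.a₃ * y ^ 3) * x,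
      -((4 * F.a₀ * x ^ 3 + 3 * F.a₁ * x ^ 2 * y + 6 * b * x * y ^ 2 + F.a₃ * y ^ 3) * y),
      by push_cast; ring⟩, ?_⟩
    refine mul_left_cancel₀ (pow_ne_zero 4 hAC) ?_
    rw [value_mul_eq H hs, ← hP0, mul_pow, div_pow, hw,
      show ((√A : ℝ) : ℂ) ^ 4 = (((√A : ℝ) : ℂ) ^ 2) ^ 2 by ring, hsA]
    field_simp
  · exact ⟨_, ⟨x * x', x * y' + x' * y, y * y', by push_cast; ring⟩, hpair x y x' y'⟩

/-! ### Irreducibility and forms with small invariants -/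

theorem not_isUnit_of_eval_zero_eq_zero {p : MvPolynomial (Fin 2) ℚ}
    (h : MvPolynomial.eval ![0, 0] p = 0) : ¬IsUnit p := fun hp =>
  not_isUnit_zero (h ▸ hp.map (MvPolynomial.eval ![(0 : ℚ), 0]))

theorem a₀_ne_zero_of_isIrreducible {F : BinaryQuartic} (hirr : F.IsIrreducible) : F.a₀ ≠ 0 := by
  intro h0
  have hfac : F.form ℚ = MvPolynomial.X 1 * (MvPolynomial.C (F.a₁ : ℚ) * MvPolynomial.X 0 ^ 3
      + MvPolynomial.C (F.a₂ : ℚ) * MvPolynomial.X 0 ^ 2 * MvPolynomial.X 1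
      + MvPolynomial.C (F.a₃ : ℚ) * MvPolynomial.X 0 * MvPolynomial.X 1 ^ 2
      + MvPolynomial.C (F.a₄ : ℚ) * MvPolynomial.X 1 ^ 3) := by
    simp only [BinaryQuartic.form, h0, Int.cast_zero, map_zero]
    ring
  rcases hirr.isUnit_or_isUnit hfac with h | h
  · exact not_isUnit_of_eval_zero_eq_zero (by simp) h
  · exact not_isUnit_of_eval_zero_eq_zero (by simp) h

/-- The number `A ^ 2` is not a square: if `A` is rational, then the quartic form is a product of two
rational quadratic forms. -/
theorem sq_ne_of_isIrreducible {F : BinaryQuartic} (hirr : F.IsIrreducible) {b k : ℤ} {A B C : ℝ}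
    (H : HasReducedCovariant F b k A B C) (q : ℤ) : q ^ 2 ≠ F.a₁ ^ 2 - 8 * F.a₀ * b := by
  intro hq
  have ha0 : (F.a₀ : ℚ) ≠ 0 := by exact_mod_cast a₀_ne_zero_of_isIrreducible hirr
  have hn : (0 : ℝ) < F.a₁ ^ 2 - 8 * F.a₀ * b := by rw [← H.AA]; have := H.A_pos; positivity
  have hqQ : (q : ℚ) ^ 2 = F.a₁ ^ 2 - 8 * F.a₀ * b := by exact_mod_cast hq
  have hq0 : (q : ℚ) ≠ 0 := by
    rintro h0
    rw [h0] at hqQ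
    have : (0 : ℚ) < F.a₁ ^ 2 - 8 * F.a₀ * b := by exact_mod_cast hn
    linarith
  obtain ⟨r, hr⟩ : ∃ r : ℚ, q * r = F.a₁ * b - 2 * F.a₀ * F.a₃ :=
    ⟨(F.a₁ * b - 2 * F.a₀ * F.a₃) / q, by field_simp⟩
  have hj : 2 * (b : ℚ) ^ 3 - F.a₁ * b * F.a₃ + F.a₁ ^ 2 * F.a₄ - 8 * F.a₀ * b * F.a₄
      + F.a₀ * F.a₃ ^ 2 = 0 := by exact_mod_cast H.j_eq
  have hrr : r ^ 2 = b ^ 2 - 4 * F.a₀ * F.a₄ := by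
    refine mul_left_cancel₀ (pow_ne_zero 2 hq0) ?_
    rw [← mul_pow, hr, hqQ]
    linear_combination 4 * F.a₀ * hj
  have ha2 : (F.a₂ : ℚ) = 3 * b := by exact_mod_cast H.a₂_eq
  obtain ⟨u₁, hu₁⟩ : ∃ u : ℚ, u = (F.a₁ + q) / (2 * F.a₀) := ⟨_, rfl⟩
  obtain ⟨u₂, hu₂⟩ : ∃ u : ℚ, u = (b + r) / (2 * F.a₀) := ⟨_, rfl⟩
  obtain ⟨v₁, hv₁⟩ : ∃ v : ℚ, v = (F.a₁ - q) / 2 := ⟨_, rfl⟩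
  obtain ⟨v₂, hv₂⟩ : ∃ v : ℚ, v = (b - r) / 2 := ⟨_, rfl⟩
  have hfac : F.form ℚ = ((MvPolynomial.X 0 ^ 2
      + MvPolynomial.C u₁ * MvPolynomial.X 0 * MvPolynomial.X 1
      + MvPolynomial.C u₂ * MvPolynomial.X 1 ^ 2) : MvPolynomial (Fin 2) ℚ)
      * (MvPolynomial.C (F.a₀ : ℚ) * MvPolynomial.X 0 ^ 2
      + MvPolynomial.C v₁ * MvPolynomial.X 0 * MvPolynomial.X 1
      + MvPolynomial.C v₂ * MvPolynomial.X 1 ^ 2) := by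
    have c1 : (F.a₁ : ℚ) = v₁ + u₁ * F.a₀ := by
      rw [hu₁, hv₁]; field_simp; ring
    have c2 : (F.a₂ : ℚ) = v₂ + u₁ * v₁ + u₂ * F.a₀ := by
      rw [hu₁, hv₁, hu₂, hv₂]; field_simp
      linear_combination 4 * F.a₀ * ha2 + hqQ
    have c3 : (F.a₃ : ℚ) = u₁ * v₂ + u₂ * v₁ := by
      rw [hu₁, hv₁, hu₂, hv₂]; field_simp
      linear_combination 2 * hr
    have c4 : (F.a₄ : ℚ) = u₂ * v₂ := by
      rw [hu₂, hv₂]; field_simp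
      linear_combination hrr
    rw [BinaryQuartic.form, c1, c2, c3, c4]
    simp only [map_add, map_mul]
    ring
  rcases hirr.isUnit_or_isUnit hfac with h | h
  · exact not_isUnit_of_eval_zero_eq_zero (by simp) h
  · exact not_isUnit_of_eval_zero_eq_zero (by simp) h

namespace HasReducedCovariant

variable {F : BinaryQuartic} {b k : ℤ} {A B C : ℝ}

theorem sq_B_le (H : HasReducedCovariant F b k A B C) : 4 * B ^ 2 ≤ A ^ 2 := by
  have h1 := H.two_mul_abs_B_le
  have h2 : (2 * |B|) ^ 2 ≤ A ^ 2 := pow_le_pow_left₀ (by positivity) h1 2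
  rwa [mul_pow, sq_abs, show (2 : ℝ) ^ 2 = 4 by norm_num] at h2

theorem sq_A_le (H : HasReducedCovariant F b k A B C) : A ^ 2 ≤ A * C := by
  rw [sq]; exact mul_le_mul_of_nonneg_left H.A_le H.A_pos.le

theorem three_mul_AC_le (H : HasReducedCovariant F b k A B C) : 3 * (A * C) ≤ 4 * k := by
  linarith [H.sq_B_le, H.sq_A_le, H.disc_eq]

theorem nine_mul_sq_a₀_le (H : HasReducedCovariant F b k A B C) : 9 * F.a₀ ^ 2 ≤ k := by
  have hk : (0 : ℝ) < k := by exact_mod_cast H.k_pos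
  have h1 : 16 * k * (F.a₀ : ℝ) ^ 2 = (A ^ 2) ^ 2 - (F.a₁ * A - 4 * F.a₀ * B) ^ 2 := by
    linear_combination - 16 * (F.a₀ : ℝ) ^ 2 * H.disc_eq + 8 * F.a₀ * A * H.rel_one
      - A ^ 2 * H.AA
  have h2 : (A ^ 2) ^ 2 ≤ (4 * k / 3 : ℝ) ^ 2 := by
    have := H.three_mul_AC_le
    have := H.sq_A_le
    gcongr
    linarith
  have h3 : (16 * k : ℝ) * (9 * F.a₀ ^ 2) ≤ 16 * k * k := by
    nlinarith [sq_nonneg (F.a₁ * A - 4 * F.a₀ * B)]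
  exact_mod_cast le_of_mul_le_mul_left h3 (by positivity)

theorem nine_mul_sq_b_le (H : HasReducedCovariant F b k A B C) : 9 * b ^ 2 ≤ 4 * k := by
  have hk : (0 : ℝ) < k := by exact_mod_cast H.k_pos
  have h1 : 16 * k * (b : ℝ) ^ 2 = 4 * (A * C) ^ 2 - (F.a₃ * A - F.a₁ * C) ^ 2 := by
    linear_combination - 16 * (b : ℝ) ^ 2 * H.disc_eq + (F.a₃ * A + 4 * b * B + F.a₁ * C) * H.rel_two
      - 4 * A * C * H.AC
  have h2 : (A * C) ^ 2 ≤ (4 * k / 3 : ℝ) ^ 2 := by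
    have := H.three_mul_AC_le
    have := H.A_pos
    have := H.A_le
    have : 0 ≤ A * C := by nlinarith
    gcongr
    linarith
  have h3 : (4 * k : ℝ) * (9 * b ^ 2) ≤ 4 * k * (4 * k) := by
    nlinarith [sq_nonneg (F.a₃ * A - F.a₁ * C)]
  exact_mod_cast le_of_mul_le_mul_left h3 (by positivity)

end HasReducedCovariant

/-- A finite search over `|a₁| ≤ 8`, `|b| ≤ 3`, `|a₃| ≤ 23`, with `a₀ = 1` and with `a₄` determined by
`J = 0`. The indices are shifted so as to be natural numbers; `n = A²`, `e = A C` and `p = A B`. -/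
theorem coeff_search : ∀ (i : Fin 17) (j : Fin 7),
    let a₁ : ℤ := (i : ℕ) - 8
    let b : ℤ := (j : ℕ) - 3
    let n := a₁ ^ 2 - 8 * b
    n ∈ [1, 4, 9, 16, 25, 36] ∨ n ≤ 0 ∨ ∀ l : Fin 47,
      let a₃ : ℤ := (l : ℕ) - 23
      let e := 4 * b ^ 2 - a₁ * a₃
      let p := a₁ * b - 2 * a₃
      e < n ∨ n < 2 * p ∨ n < -(2 * p) ∨ ¬n ∣ -(2 * b ^ 3 - a₁ * b * a₃ + a₃ ^ 2) ∨
        let a₄ := -(2 * b ^ 3 - a₁ * b * a₃ + a₃ ^ 2) / n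
        let k := 3 * b ^ 2 - a₁ * a₃ + 4 * a₄
        k ≤ 0 ∨ 36 ≤ k ∨ a₄ = 1 ∧ a₃ = -a₁ ∧ b = -2 := by
  decide +kernel

/-- The monic forms of small discriminant. -/
theorem coeff_eq_of_small {a₁ b a₃ a₄ : ℤ}
    (hj : 2 * b ^ 3 - a₁ * b * a₃ + a₁ ^ 2 * a₄ - 8 * b * a₄ + a₃ ^ 2 = 0)
    (hk0 : 0 < 3 * b ^ 2 - a₁ * a₃ + 4 * a₄) (hk : 3 * b ^ 2 - a₁ * a₃ + 4 * a₄ < 36)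
    (hb : 9 * b ^ 2 ≤ 4 * (3 * b ^ 2 - a₁ * a₃ + 4 * a₄))
    (he : 3 * (4 * b ^ 2 - a₁ * a₃) ≤ 4 * (3 * b ^ 2 - a₁ * a₃ + 4 * a₄))
    (hn0 : 0 < a₁ ^ 2 - 8 * b) (hne : a₁ ^ 2 - 8 * b ≤ 4 * b ^ 2 - a₁ * a₃)
    (hp : 2 * |a₁ * b - 2 * a₃| ≤ a₁ ^ 2 - 8 * b) (hsq : ∀ q : ℤ, q ^ 2 ≠ a₁ ^ 2 - 8 * b) :
    a₄ = 1 ∧ a₃ = -a₁ ∧ b = -2 := by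
  have hb2 : b ^ 2 ≤ 15 := by omega
  have hb3 : |b| ≤ 3 := abs_le.2 ⟨by nlinarith, by nlinarith⟩
  have hb3' := abs_le.1 hb3
  have ha2 : a₁ ^ 2 ≤ 70 := by omega
  have ha1 : |a₁| ≤ 8 := abs_le.2 ⟨by nlinarith, by nlinarith⟩
  have ha1' := abs_le.1 ha1
  have hp' := abs_le.1 (show |a₁ * b - 2 * a₃| ≤ 23 by omega)
  have hab : |a₁ * b| ≤ 24 := by
    rw [abs_mul]
    calc |a₁| * |b| ≤ 8 * 3 := by gcongr
      _ = 24 := by norm_num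
  have hab' := abs_le.1 hab
  have ha3 : -23 ≤ a₃ ∧ a₃ ≤ 23 := by constructor <;> omega
  have h2p := abs_le.1 (show |2 * (a₁ * b - 2 * a₃)| ≤ a₁ ^ 2 - 8 * b by
    rw [abs_mul]; simpa using hp)
  have h := coeff_search ⟨(a₁ + 8).toNat, by omega⟩ ⟨(b + 3).toNat, by omega⟩
  have e1 : (((a₁ + 8).toNat : ℕ) : ℤ) - 8 = a₁ := by omega
  have e2 : (((b + 3).toNat : ℕ) : ℤ) - 3 = b := by omega
  have e3 : (((a₃ + 23).toNat : ℕ) : ℤ) - 23 = a₃ := by omega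
  simp only [e1, e2] at h
  rcases h with h | h | h
  · exfalso
    simp only [List.mem_cons, List.not_mem_nil, or_false] at h
    rcases h with h | h | h | h | h | h
    · exact hsq 1 (by rw [h]; norm_num)
    · exact hsq 2 (by rw [h]; norm_num)
    · exact hsq 3 (by rw [h]; norm_num)
    · exact hsq 4 (by rw [h]; norm_num)
    · exact hsq 5 (by rw [h]; norm_num)
    · exact hsq 6 (by rw [h]; norm_num)
  · omega
  · have h3 := h ⟨(a₃ + 23).toNat, by omega⟩
    simp only [e3] at h3
    have hdiv : -(2 * b ^ 3 - a₁ * b * a₃ + a₃ ^ 2) = (a₁ ^ 2 - 8 * b) * a₄ := by linarith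
    rw [hdiv, Int.mul_ediv_cancel_left _ hn0.ne'] at h3
    rcases h3 with h3 | h3 | h3 | h3 | h3 | h3 | h3
    · omega
    · omega
    · omega
    · exact absurd (Dvd.intro _ rfl) h3
    · omega
    · omega
    · exact h3

/-- If `k = I / 3` is small, then up to sign the form is `x⁴ + t x³ y - 6 x² y² - t x y³ + y⁴`. -/
theorem coeff_eq_of_k_lt {F : BinaryQuartic} (hirr : F.IsIrreducible) {b k : ℤ} {A B C : ℝ}
    (H : HasReducedCovariant F b k A B C) (hk : k < 36) :
    (F.a₀ = 1 ∨ F.a₀ = -1) ∧ F.a₄ = F.a₀ ∧ F.a₃ = -F.a₁ ∧ b = -2 * F.a₀ ∧ 17 ≤ k := by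
  have h0 := a₀_ne_zero_of_isIrreducible hirr
  have h1 := H.nine_mul_sq_a₀_le
  have hsq := sq_ne_of_isIrreducible hirr H
  have hkk := H.k_eq
  have hk0 := H.k_pos
  have hj := H.j_eq
  have hb := H.nine_mul_sq_b_le
  have he : 3 * (4 * b ^ 2 - F.a₁ * F.a₃) ≤ 4 * k := by
    have := H.three_mul_AC_le
    rw [H.AC] at this
    exact_mod_cast this
  have hn0 : 0 < F.a₁ ^ 2 - 8 * F.a₀ * b := by
    have : (0 : ℝ) < F.a₁ ^ 2 - 8 * F.a₀ * b := by rw [← H.AA]; have := H.A_pos; positivity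
    exact_mod_cast this
  have hne : F.a₁ ^ 2 - 8 * F.a₀ * b ≤ 4 * b ^ 2 - F.a₁ * F.a₃ := by
    have := H.sq_A_le
    rw [H.AC, H.AA] at this
    exact_mod_cast this
  have hp : 2 * |F.a₁ * b - 2 * F.a₀ * F.a₃| ≤ F.a₁ ^ 2 - 8 * F.a₀ * b := by
    have h2 : 2 * |A * B| ≤ A ^ 2 := by
      rw [abs_mul, abs_of_pos H.A_pos, sq]
      nlinarith [H.two_mul_abs_B_le, H.A_pos]
    rw [H.AB, H.AA] at h2
    exact_mod_cast h2
  have ha0 : F.a₀ = 1 ∨ F.a₀ = -1 := by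
    have : F.a₀ ^ 2 ≤ 3 := by omega
    have h3 : F.a₀ ≤ 1 := by nlinarith
    have h4 : -1 ≤ F.a₀ := by nlinarith
    omega
  have hmain : F.a₄ = F.a₀ ∧ F.a₃ = -F.a₁ ∧ b = -2 * F.a₀ := by
    rcases ha0 with h2 | h2
    · simp only [h2, mul_one] at hj hsq hn0 hne hp hkk ⊢
      rw [hkk] at hk0 hk hb he
      exact coeff_eq_of_small (by linarith) hk0 hk hb he hn0 hne hp hsq
    · simp only [h2, mul_neg, mul_one, neg_mul, sub_neg_eq_add] at hj hsq hn0 hne hp hkk ⊢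
      have hk' : k = 3 * (-b) ^ 2 - -F.a₁ * -F.a₃ + 4 * -F.a₄ := by linarith
      rw [hk'] at hk0 hk hb he
      have := coeff_eq_of_small (a₁ := -F.a₁) (b := -b) (a₃ := -F.a₃) (a₄ := -F.a₄) (by linarith)
        hk0 hk (by linarith) (by linarith) (by linarith) (by linarith)
        (by convert hp using 2 <;> ring_nf) (fun q => by have := hsq q; intro h; apply this; linarith)
      omega
  refine ⟨ha0, hmain.1, hmain.2.1, hmain.2.2, ?_⟩
  obtain ⟨h4, h3, h2⟩ := hmain
  have ha2 : F.a₀ ^ 2 = 1 := by rcases ha0 with h | h <;> rw [h] <;> norm_num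
  have hk' : k = 16 + F.a₁ ^ 2 := by
    rw [hkk, h2, h3, h4]; linear_combination 16 * ha2
  have h5 : F.a₁ ≠ 0 := by
    intro h5
    exact hsq 4 (by rw [h5, h2]; linear_combination -16 * ha2)
  have : 0 < F.a₁ ^ 2 := by positivity
  omega

/-! ### The first point of a class, and the count of the solutions -/

/-- The lower bound for `|y|`, freed of the fractional exponents. -/
theorem pow_le_of_mem_largeSolutions {F : BinaryQuartic} {b k : ℤ} {A B C : ℝ}
    (H : HasReducedCovariant F b k A B C) {h : ℕ} {v : ℤ × ℤ} (hv : v ∈ F.largeSolutions h) :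
    (h : ℝ) ^ 6 ≤ 9 * k * (v.2 : ℝ) ^ 8 := by
  have hk : (0 : ℝ) < k := by exact_mod_cast H.k_pos
  have hI : (3 * (F.invI : ℝ)) = 9 * k := by
    have h1 : F.invI = 3 * k := by rw [BinaryQuartic.invI, H.a₂_eq, H.k_eq]; ring
    rw [h1]; push_cast; ring
  have h2 := hv.2.2
  rw [hI, div_le_iff₀ (by positivity)] at h2
  have h3 : (((h : ℝ) ^ (3 / 4 : ℝ))) ^ 8 ≤ (|(v.2 : ℝ)| * (9 * k : ℝ) ^ (1 / 8 : ℝ)) ^ 8 :=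
    pow_le_pow_left₀ (by positivity) h2 8
  have e1 : (((h : ℝ) ^ (3 / 4 : ℝ))) ^ 8 = (h : ℝ) ^ 6 := by
    rw [← Real.rpow_natCast, ← Real.rpow_mul (by positivity), ← Real.rpow_natCast]; norm_num
  have e2 : ((9 * k : ℝ) ^ (1 / 8 : ℝ)) ^ 8 = 9 * k := by
    rw [← Real.rpow_natCast, ← Real.rpow_mul (by positivity)]; norm_num
  have e3 : |(v.2 : ℝ)| ^ 8 = (v.2 : ℝ) ^ 8 := (by decide : Even 8).pow_abs _
  rw [mul_pow, e1, e2, e3] at h3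
  linarith

theorem isAdmissibleStart_of_three_le {s h a Y : ℝ} (hs0 : 0 < s) (ha : 3 ≤ a ^ 2)
    (hY : h ^ 3 ≤ 3 * s * Y) (hYa : 3 * Y ≤ 4 * (a ^ 2) ^ 2)
    (hk : 192 * Y ≤ 2299 / 1000 * s ^ 2 * (a ^ 2) ^ 3) : IsAdmissibleStart s h a := by
  refine Or.inr ⟨?_, ha, ?_⟩
  · refine le_of_pow_le_pow_left₀ (n := 3) (by norm_num) (by positivity) ?_
    rw [div_pow, div_le_iff₀ (by positivity)]
    calc (4 * h) ^ 3 = 64 * h ^ 3 := by ring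
      _ ≤ 64 * (3 * s * Y) := by gcongr
      _ = s * (192 * Y) := by ring
      _ ≤ s * (2299 / 1000 * s ^ 2 * (a ^ 2) ^ 3) := by gcongr
      _ = 2299 / 1000 * (s ^ 3 * (a ^ 2) ^ 3) := by ring
      _ ≤ (132 / 100) ^ 3 * (s ^ 3 * (a ^ 2) ^ 3) := by gcongr; norm_num
      _ = _ := by ring
  · nlinarith

/-- If `k` is small, then the covariant is `s (x² + y²)`. -/
theorem covariant_eq_of_k_lt {F : BinaryQuartic} (hirr : F.IsIrreducible) {b k : ℤ} {A B C s : ℝ}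
    (H : HasReducedCovariant F b k A B C) (hs : s ^ 2 = k) (hs0 : 0 < s) (hk : k < 36) :
    A = s ∧ B = 0 ∧ C = s := by
  obtain ⟨ha0, h4, h3, hb, -⟩ := coeff_eq_of_k_lt hirr H hk
  have ha2 : (F.a₀ : ℝ) ^ 2 = 1 := by rcases ha0 with h | h <;> rw [h] <;> norm_num
  have h4R : (F.a₄ : ℝ) = F.a₀ := by exact_mod_cast h4
  have h3R : (F.a₃ : ℝ) = -F.a₁ := by exact_mod_cast h3
  have hbR : (b : ℝ) = -2 * F.a₀ := by exact_mod_cast hb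
  have hA := H.A_pos
  have hC : 0 < C := hA.trans_le H.A_le
  have hB : B = 0 := by
    refine (mul_eq_zero.1 (?_ : A * B = 0)).resolve_left hA.ne'
    rw [H.AB, h3R, hbR]; ring
  have hAC : A = C := by
    rw [← sq_eq_sq₀ hA.le hC.le, H.AA, H.CC, h4R, h3R, hbR]; ring
  have hAs : A = s := by
    rw [← sq_eq_sq₀ hA.le hs0.le, hs, ← H.disc_eq, hB, ← hAC]; ring
  exact ⟨hAs, hB, hAC ▸ hAs⟩

/-- Every large solution is an admissible first point of its class. Solutions with `|y| = 1` fall under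
the first alternative of `IsAdmissibleStart`, the others under the second one. The case `h = 2`, `|y| = 1`
needs a larger `k`. -/
theorem isAdmissibleStart_of_mem {F : BinaryQuartic} (hirr : F.IsIrreducible) {b k : ℤ}
    {A B C s : ℝ} (H : HasReducedCovariant F b k A B C) (hs : s ^ 2 = k) (hs0 : 0 < s) {h : ℕ}
    (hh : 0 < h) (hh2 : h = 2 → 36 ≤ k) {v : ℤ × ℤ} (hv : v ∈ F.largeSolutions h) {a : ℝ}
    (ha : a ^ 2 = (A * v.1 ^ 2 + 2 * B * v.1 * v.2 + C * v.2 ^ 2) / s) :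
    IsAdmissibleStart s h a := by
  have hpow := pow_le_of_mem_largeSolutions H hv
  have hcop := hv.1
  obtain ⟨x, y⟩ := v
  simp only at hpow hcop ha
  have hk0 : (0 : ℝ) < k := by exact_mod_cast H.k_pos
  have hk17 : 17 ≤ k := by
    by_contra! hlt
    have := (coeff_eq_of_k_lt hirr H (by omega)).2.2.2.2
    omega
  have hk17' : (17 : ℝ) ≤ k := by exact_mod_cast hk17
  have hh1 : (1 : ℝ) ≤ h := by exact_mod_cast hh
  have hh0 : (0 : ℝ) < h := by linarith
  have hY : (h : ℝ) ^ 3 ≤ 3 * s * (y : ℝ) ^ 4 := by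
    refine le_of_pow_le_pow_left₀ (n := 2) (by norm_num) (by positivity) ?_
    calc ((h : ℝ) ^ 3) ^ 2 = h ^ 6 := by ring
      _ ≤ _ := hpow
      _ = _ := by rw [← hs]; ring
  have hy0 : y ≠ 0 := by
    rintro rfl
    have : (0 : ℝ) < (h : ℝ) ^ 6 := by positivity
    simp at hpow
    linarith
  by_cases hy1 : |y| ≤ 1
  · have hy1' : |y| = 1 := le_antisymm hy1 (Int.one_le_abs hy0)
    have hyR : (y : ℝ) ^ 2 = 1 := by
      rw [← sq_abs, ← Int.cast_abs, hy1']; norm_num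
    have hy4 : (y : ℝ) ^ 4 = 1 := by
      rw [show (y : ℝ) ^ 4 = (y ^ 2) ^ 2 by ring, hyR]; norm_num
    have hy8 : (y : ℝ) ^ 8 = 1 := by
      rw [show (y : ℝ) ^ 8 = (y ^ 2) ^ 4 by ring, hyR]; norm_num
    rw [hy8] at hpow
    rw [hy4] at hY
    refine Or.inl ⟨?_, by linarith⟩
    have h9 : 9 * (h : ℝ) ^ 2 ≤ k := by
      rcases (show h = 1 ∨ h = 2 ∨ 3 ≤ h by omega) with h1 | h1 | h1
      · rw [h1]; norm_num; linarith
      · have : (36 : ℝ) ≤ k := by exact_mod_cast hh2 h1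
        rw [h1]; norm_num; linarith
      · have h3 : (3 : ℝ) ≤ h := by exact_mod_cast h1
        have h4 : (3 : ℝ) ^ 4 * h ^ 2 ≤ h ^ 4 * h ^ 2 := by gcongr
        nlinarith
    have h3 : 3 * (h : ℝ) ≤ s := by
      refine le_of_pow_le_pow_left₀ (n := 2) (by norm_num) hs0.le ?_
      rw [hs]; linarith
    rw [div_le_iff₀ hs0]
    linarith
  · have hy2 : 2 ≤ |y| := by omega
    have hy4 : (4 : ℝ) ≤ (y : ℝ) ^ 2 := by
      have h1 : (2 : ℝ) ≤ |(y : ℝ)| := by exact_mod_cast hy2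
      rw [← sq_abs]; nlinarith
    set m : ℝ := A * x ^ 2 + 2 * B * x * y + C * y ^ 2 with hm
    -- the minimum of the covariant over `x` is `k y² / A`, and `A² ≤ 4 k / 3` for a reduced form
    have hsq : 3 * (y : ℝ) ^ 4 ≤ 4 * (a ^ 2) ^ 2 := by
      have h1 : k * (y : ℝ) ^ 2 ≤ A * m := by
        have : A * m = (A * x + B * y) ^ 2 + k * y ^ 2 := by rw [hm, ← H.disc_eq]; ring
        nlinarith [sq_nonneg (A * x + B * y)]
      have h2 : (k * (y : ℝ) ^ 2) ^ 2 ≤ (A * m) ^ 2 := pow_le_pow_left₀ (by positivity) h1 2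
      have h3 : 3 * A ^ 2 ≤ 4 * k := by linarith [H.three_mul_AC_le, H.sq_A_le]
      have h4 : k * (k * (3 * (y : ℝ) ^ 4)) ≤ k * (4 * m ^ 2) := by
        nlinarith [mul_le_mul_of_nonneg_right h3 (sq_nonneg m)]
      have h5 := le_of_mul_le_mul_left h4 hk0
      rw [ha, div_pow, hs, ← mul_div_assoc, le_div_iff₀ hk0]
      linarith
    have ha0 : 0 ≤ a ^ 2 := sq_nonneg a
    have ha34 : 34 / 10 ≤ a ^ 2 := by nlinarith
    refine isAdmissibleStart_of_three_le hs0 (by linarith) hY hsq ?_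
    rw [hs]
    rcases lt_or_ge k 36 with hk | hk
    · obtain ⟨hA, hB, hC⟩ := covariant_eq_of_k_lt hirr H hs hs0 hk
      have hx0 : x ≠ 0 := by
        rintro rfl
        rw [isCoprime_zero_left, Int.isUnit_iff_abs_eq] at hcop
        omega
      have hx1 : (1 : ℝ) ≤ (x : ℝ) ^ 2 := by
        have : 0 < x ^ 2 := by positivity
        exact_mod_cast this
      have ha2 : (y : ℝ) ^ 2 + 1 ≤ a ^ 2 := by
        have : a ^ 2 = x ^ 2 + y ^ 2 := by
          rw [ha, hm, hA, hB, hC]; field_simp; ring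
        linarith
      have ha6 : ((y : ℝ) ^ 2 + 1) ^ 3 ≤ (a ^ 2) ^ 3 := by gcongr
      calc 192 * (y : ℝ) ^ 4 ≤ 2299 / 1000 * 17 * (7 * (y : ℝ) ^ 4) := by
            nlinarith [sq_nonneg ((y : ℝ) ^ 2)]
        _ ≤ 2299 / 1000 * 17 * ((y : ℝ) ^ 2 + 1) ^ 3 := by
            gcongr
            nlinarith [mul_le_mul_of_nonneg_right hy4 (sq_nonneg ((y : ℝ) ^ 2))]
        _ ≤ 2299 / 1000 * k * (a ^ 2) ^ 3 := by gcongr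
    · have hk36 : (36 : ℝ) ≤ k := by exact_mod_cast hk
      calc 192 * (y : ℝ) ^ 4 ≤ 256 * (a ^ 2) ^ 2 := by linarith
        _ ≤ 2299 / 1000 * 36 * (34 / 10 * (a ^ 2) ^ 2) := by nlinarith [sq_nonneg (a ^ 2)]
        _ ≤ 2299 / 1000 * k * (a ^ 2 * (a ^ 2) ^ 2) := by gcongr
        _ = _ := by ring

/-- If `x` and `y` are both odd, the value is divisible by `4`; if one of them is odd, it is odd. -/
theorem zmod_four_value_ne_two : ∀ t x y : ZMod 4, (∀ u v : ZMod 4, u * x + v * y ≠ 1) ∨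
    x ^ 4 + t * x ^ 3 * y - 6 * x ^ 2 * y ^ 2 - t * x * y ^ 3 + y ^ 4 ≠ 2 := by
  decide

/-- The forms with small `k` take no values congruent to `2` modulo `4` at coprime arguments, so for
them the bound `2` may be replaced by `1`. -/
theorem largeSolutions_two_subset {F : BinaryQuartic} (hirr : F.IsIrreducible) {b k : ℤ} {A B C : ℝ}
    (H : HasReducedCovariant F b k A B C) (hk : k < 36) :
    F.largeSolutions 2 ⊆ F.largeSolutions 1 := by
  obtain ⟨ha0, h4, h3, hb, -⟩ := coeff_eq_of_k_lt hirr H hk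
  rintro ⟨x, y⟩ ⟨hcop, hval, hy⟩
  refine ⟨hcop, ?_, ?_⟩
  · have hne : ∀ n : ℤ, n = 2 ∨ n = -2 → F.value x y ≠ n := by
      intro n hn hval2
      have e : F.a₀ * F.value x y = x ^ 4 + (F.a₀ * F.a₁) * x ^ 3 * y - 6 * x ^ 2 * y ^ 2
          - (F.a₀ * F.a₁) * x * y ^ 3 + y ^ 4 := by
        have ha2 : F.a₀ ^ 2 = 1 := by rcases ha0 with h | h <;> rw [h] <;> norm_num
        rw [BinaryQuartic.value, h4, h3, H.a₂_eq, hb]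
        linear_combination (x ^ 4 - 6 * x ^ 2 * y ^ 2 + y ^ 4) * ha2
      have e2 : ((F.a₀ * F.value x y : ℤ) : ZMod 4) = 2 := by
        rcases ha0 with h | h <;> rcases hn with h' | h' <;> rw [hval2, h, h'] <;> decide
      rw [e] at e2
      push_cast at e2
      obtain ⟨u, w, huw⟩ := hcop
      rcases zmod_four_value_ne_two ((F.a₀ : ZMod 4) * F.a₁) x y with h5 | h5
      · exact h5 u w (by exact_mod_cast congrArg (Int.cast (R := ZMod 4)) huw)
      · exact h5 e2
    have h5 := hne 2 (by simp)
    have h6 := hne (-2) (by simp)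
    simp only at hval ⊢
    rw [abs_le] at hval ⊢
    push_cast at *
    omega
  · refine le_trans ?_ hy
    have hk : (0 : ℝ) < k := by exact_mod_cast H.k_pos
    have hI : 0 < F.invI := by
      have h1 : F.invI = 3 * k := by rw [BinaryQuartic.invI, H.a₂_eq, H.k_eq]; ring
      have := H.k_pos
      omega
    have hI' : (0 : ℝ) < F.invI := by exact_mod_cast hI
    gcongr
    norm_num

/-- Every complex number is, up to a power of `exp (π i / 4)`, within `π / 8` of the positive real
axis. -/
theorem exists_octant (z : ℂ) : ∃ (j : Fin 4) (ε : ℤ) (θ : ℝ), ε ^ 2 = 1 ∧ |θ| ≤ Real.pi / 8 ∧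
    z = ε * Complex.exp ((j : ℕ) * (Real.pi / 4) * Complex.I)
      * (‖z‖ * Complex.exp (θ * Complex.I)) := by
  have hpi := Real.pi_pos
  set n : ℤ := round (4 * z.arg / Real.pi) with hn
  have hθ : |z.arg - n * (Real.pi / 4)| ≤ Real.pi / 8 := by
    have h1 := abs_sub_round (4 * z.arg / Real.pi)
    have e : z.arg - n * (Real.pi / 4) = Real.pi / 4 * (4 * z.arg / Real.pi - n) := by
      field_simp
    rw [e, abs_mul, abs_of_pos (by positivity)]
    nlinarith
  have hj : (((n % 4).toNat : ℕ) : ℤ) = n % 4 := Int.toNat_of_nonneg (Int.emod_nonneg _ (by norm_num))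
  have hq : n = 4 * (n / 4) + (n % 4).toNat := by rw [hj]; omega
  obtain ⟨ε, hε, hε'⟩ : ∃ ε : ℤ, ε ^ 2 = 1 ∧ (-1 : ℂ) ^ (n / 4) = ε := by
    rcases Int.even_or_odd (n / 4) with h | h
    · exact ⟨1, by norm_num, by rw [h.neg_one_zpow]; simp⟩
    · exact ⟨-1, by norm_num, by rw [h.neg_one_zpow]; simp⟩
  refine ⟨⟨(n % 4).toNat, by omega⟩, ε, z.arg - n * (Real.pi / 4), hε, hθ, ?_⟩
  rw [← hε', ← Complex.exp_pi_mul_I, ← Complex.exp_int_mul]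
  have e : (Complex.exp ((n / 4 : ℤ) * (Real.pi * Complex.I))
      * Complex.exp (((n % 4).toNat : ℕ) * (Real.pi / 4) * Complex.I))
      * (‖z‖ * Complex.exp (((z.arg - n * (Real.pi / 4) : ℝ) : ℂ) * Complex.I))
      = ‖z‖ * Complex.exp (z.arg * Complex.I) := by
    rw [mul_left_comm, ← Complex.exp_add, ← Complex.exp_add]
    congr 2
    have hqC : (n : ℂ) = 4 * (n / 4 : ℤ) + ((n % 4).toNat : ℕ) := by exact_mod_cast hq
    push_cast
    rw [hqC]
    ring
  rw [e, Complex.norm_mul_exp_arg_mul_I]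

/-- Rotating a point by a multiple of `π / 4` changes at most the sign of the value of the form. -/
theorem IsResolventValue.rotate {T : AddSubgroup ℝ} {s : ℝ} {z z₀ : ℂ} {f : ℤ}
    (hz : IsResolventValue T s z f) {ε : ℤ} (hε : ε ^ 2 = 1) {j : ℕ}
    (h : z = ε * Complex.exp (j * (Real.pi / 4) * Complex.I) * z₀) :
    IsResolventValue T s z₀ ((-1) ^ j * f) := by
  obtain ⟨τ, hτ, hz⟩ := hz
  have hω : Complex.exp (j * (Real.pi / 4) * Complex.I) ^ 4 = (-1) ^ j := by
    rw [← Complex.exp_nat_mul, ← Complex.exp_pi_mul_I, ← Complex.exp_nat_mul]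
    congr 1
    push_cast
    ring
  have hε' : (ε : ℂ) ^ 4 = 1 := by
    rw [show (4 : ℕ) = 2 * 2 by norm_num, pow_mul, show (ε : ℂ) ^ 2 = 1 by exact_mod_cast hε]
    norm_num
  rw [h, mul_pow, mul_pow, hω, hε', one_mul] at hz
  have h1 : z₀ ^ 4 = (-1) ^ j * (τ + 4 * s * f * Complex.I) := by
    rw [← hz, ← mul_assoc, ← mul_pow]; norm_num
  rcases neg_one_pow_eq_or ℤ j with h2 | h2
  · have h3 : (-1 : ℂ) ^ j = 1 := by exact_mod_cast congrArg (Int.cast (R := ℂ)) h2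
    exact ⟨τ, hτ, by rw [h1, h2, h3]; push_cast; ring⟩
  · have h3 : (-1 : ℂ) ^ j = -1 := by exact_mod_cast congrArg (Int.cast (R := ℂ)) h2
    exact ⟨-τ, T.neg_mem hτ, by rw [h1, h2, h3]; push_cast; ring⟩

/-- Rotating two points by the same multiple of `π / 4` changes at most the sign of the determinant. -/
theorem IsResolventPair.rotate {T : AddSubgroup ℝ} {s : ℝ} {z z₀ w w₀ : ℂ} {d : ℤ}
    (hzw : IsResolventPair T s z w d) {ε ε' : ℤ} (hε : ε ^ 2 = 1) (hε' : ε' ^ 2 = 1) {j : ℕ}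
    (hz : z = ε * Complex.exp (j * (Real.pi / 4) * Complex.I) * z₀)
    (hw : w = ε' * Complex.exp (j * (Real.pi / 4) * Complex.I) * w₀) :
    IsResolventPair T s z₀ w₀ (ε * ε' * d) := by
  obtain ⟨M, hM, h⟩ := hzw
  have hω : (starRingEnd ℂ) (Complex.exp (j * (Real.pi / 4) * Complex.I))
      * Complex.exp (j * (Real.pi / 4) * Complex.I) = 1 := by
    rw [mul_comm, Complex.mul_conj, Complex.normSq_eq_norm_sq,
      show (j * (Real.pi / 4) * Complex.I : ℂ) = ((j * (Real.pi / 4) : ℝ) : ℂ) * Complex.I by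
        push_cast; ring, Complex.norm_exp_ofReal_mul_I]
    norm_num
  have h1 : (ε : ℂ) ^ 2 = 1 := by exact_mod_cast hε
  have h2 : (ε' : ℂ) ^ 2 = 1 := by exact_mod_cast hε'
  rw [hz, hw, map_mul, map_mul, map_intCast] at h
  refine ⟨ε * ε' * M, ?_, ?_⟩
  · have := T.zsmul_mem hM (ε * ε')
    simpa using this
  · push_cast
    calc (starRingEnd ℂ) w₀ * z₀ = ε ^ 2 * ε' ^ 2 * 1 * ((starRingEnd ℂ) w₀ * z₀) := by
          rw [h1, h2]; ring
      _ = ε * ε' * (ε' * (starRingEnd ℂ) (Complex.exp (j * (Real.pi / 4) * Complex.I))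
          * (starRingEnd ℂ) w₀ * (ε * Complex.exp (j * (Real.pi / 4) * Complex.I) * z₀)) := by
          rw [← hω]; ring
      _ = _ := by rw [h]; ring

theorem det_ne_zero_of_isCoprime {v w : ℤ × ℤ} (hv : IsCoprime v.1 v.2) (hw : IsCoprime w.1 w.2)
    (h1 : v ≠ w) (h2 : v ≠ -w) : w.1 * v.2 - v.1 * w.2 ≠ 0 := by
  obtain ⟨x, y⟩ := v
  obtain ⟨x', y'⟩ := w
  intro h
  simp only at h hv hw
  have h3 : x' * y = x * y' := by linarith
  have d1 : x ∣ x' := hv.dvd_of_dvd_mul_right (Dvd.intro _ h3.symm)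
  have d2 : x' ∣ x := hw.dvd_of_dvd_mul_right (Dvd.intro _ h3)
  have d3 : y ∣ y' := hv.symm.dvd_of_dvd_mul_left (Dvd.intro_left _ h3)
  have d4 : y' ∣ y := hw.symm.dvd_of_dvd_mul_left (Dvd.intro_left _ h3.symm)
  have a1 := Int.associated_iff.1 (associated_of_dvd_dvd d1 d2)
  have a2 := Int.associated_iff.1 (associated_of_dvd_dvd d3 d4)
  simp only [ne_eq, Prod.mk.injEq, Prod.neg_mk, not_and] at h1 h2
  rcases a1 with rfl | rfl <;> rcases a2 with rfl | rfl
  · exact h1 rfl rfl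
  · have : x * y' = 0 := by linarith
    rcases mul_eq_zero.1 this with h | h
    · exact h2 (by omega) rfl
    · exact h1 rfl (by omega)
  · have : x' * y = 0 := by linarith
    rcases mul_eq_zero.1 this with h | h
    · exact h1 (by omega) rfl
    · exact h2 rfl (by omega)
  · exact h2 rfl rfl

/-- The pigeonhole principle: if more than `3 n` elements of a set are distributed over `n`
classes, then four distinct ones lie in the same class. -/
theorem exists_four_of_lt_encard {α : Type*} {S : Set α} {n : ℕ} (c : α → Fin n)
    (hS : ((3 * n : ℕ) : ℕ∞) < S.encard) :
    ∃ (j : Fin n) (p : Fin 4 → α), Function.Injective p ∧ ∀ i, p i ∈ S ∧ c (p i) = j := by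
  classical
  obtain ⟨t, htS, ht⟩ := Set.exists_subset_encard_eq (Order.add_one_le_of_lt hS)
  have htfin : t.Finite := Set.finite_of_encard_eq_coe (k := 3 * n + 1) (by rw [ht]; norm_cast)
  have hcard : htfin.toFinset.card = 3 * n + 1 := by
    have := htfin.encard_eq_coe_toFinset_card
    rw [ht] at this
    exact_mod_cast this.symm
  obtain ⟨j, -, hj⟩ := Finset.exists_lt_card_fiber_of_mul_lt_card_of_maps_to
    (s := htfin.toFinset) (t := Finset.univ) (f := c) (n := 3) (fun _ _ => Finset.mem_univ _)
    (by rw [hcard, Finset.card_univ, Fintype.card_fin]; omega)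
  obtain ⟨p⟩ := Function.Embedding.nonempty_of_card_le (α := Fin 4)
    (β := {x // x ∈ htfin.toFinset.filter fun x => c x = j})
    (by rw [Fintype.card_fin, Fintype.card_coe]; exact hj)
  refine ⟨j, fun i => p i, Subtype.val_injective.comp p.injective, fun i => ?_⟩
  have := (p i).2
  rw [Finset.mem_filter, Set.Finite.mem_toFinset] at this
  exact ⟨htS this.1, this.2⟩

/-- The four octant classes of `exists_octant` contain at most three solutions each. -/
theorem encard_le_of_isAdmissibleStart {F : BinaryQuartic} {b k : ℤ} {A B C s : ℝ}
    (H : HasReducedCovariant F b k A B C) (hs : s ^ 2 = k) (hs0 : 0 < s) {h : ℕ} (hh : 0 < h)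
    (hstart : ∀ v ∈ F.largeSolutions h, ∀ a : ℝ,
      a ^ 2 = (A * v.1 ^ 2 + 2 * B * v.1 * v.2 + C * v.2 ^ 2) / s → IsAdmissibleStart s h a) :
    ((fun v : ℤ × ℤ => ({v, -v} : Set (ℤ × ℤ))) '' F.largeSolutions h).encard ≤ 12 := by
  obtain ⟨z, hnorm, hval, hpair⟩ := exists_resolvent H hs
  choose c ε θ hε hθ hz using fun v : ℤ × ℤ => exists_octant (z v.1 v.2)
  by_contra! hlt
  -- each unordered pair is represented by one of its points
  have hrep : ∀ P : Set (ℤ × ℤ), ∃ v : ℤ × ℤ,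
      P ∈ (fun v : ℤ × ℤ => ({v, -v} : Set (ℤ × ℤ))) '' F.largeSolutions h →
      v ∈ F.largeSolutions h ∧ ({v, -v} : Set (ℤ × ℤ)) = P := by
    intro P
    by_cases hP : P ∈ (fun v : ℤ × ℤ => ({v, -v} : Set (ℤ × ℤ))) '' F.largeSolutions h
    · obtain ⟨v, hv, hvP⟩ := hP
      exact ⟨v, fun _ => ⟨hv, hvP⟩⟩
    · exact ⟨0, fun h => absurd h hP⟩
  choose r hr using hrep
  obtain ⟨j, P, hP, hPj⟩ := exists_four_of_lt_encard (n := 4) (fun P => c (r P)) hlt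
  set v : Fin 4 → ℤ × ℤ := fun i => r (P i) with hv
  have hvS : ∀ i, v i ∈ F.largeSolutions h := fun i => (hr (P i) (hPj i).1).1
  have hvP : ∀ i, ({v i, -v i} : Set (ℤ × ℤ)) = P i := fun i => (hr (P i) (hPj i).1).2
  have hvj : ∀ i, c (v i) = j := fun i => (hPj i).2
  have hne : ∀ i i', i ≠ i' → v i ≠ v i' ∧ v i ≠ -v i' := by
    intro i i' hii
    constructor
    · intro h1
      apply hii
      apply hP
      rw [← hvP i, ← hvP i', h1]
    · intro h1
      apply hii
      apply hP
      rw [← hvP i, ← hvP i', h1, neg_neg, Set.pair_comm]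
  have hdet : ∀ i i', i ≠ i' → (v i').1 * (v i).2 - (v i).1 * (v i').2 ≠ 0 := fun i i' hii =>
    det_ne_zero_of_isCoprime (hvS i).1 (hvS i').1 (hne i i' hii).1 (hne i i' hii).2
  set X : Fin 4 → ℝ := fun i => ‖z (v i).1 (v i).2‖ with hX
  have hzj : ∀ i, z (v i).1 (v i).2 = ε (v i) * Complex.exp ((j : ℕ) * (Real.pi / 4) * Complex.I)
      * (X i * Complex.exp (θ (v i) * Complex.I)) := by
    intro i
    have := hz (v i)
    rwa [hvj i] at this
  have hXpos : ∀ i, 0 < X i := by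
    intro i
    refine norm_pos_iff.2 fun h0 => ?_
    obtain ⟨i', hi'⟩ : ∃ i', i ≠ i' := ⟨i + 1, by fin_cases i <;> decide⟩
    obtain ⟨M, -, hM⟩ := hpair (v i).1 (v i).2 (v i').1 (v i').2
    rw [h0, mul_zero] at hM
    have h1 := congrArg Complex.im hM
    have h2 : s * (((v i').1 * (v i).2 - (v i).1 * (v i').2 : ℤ) : ℝ) = 0 := by simpa using h1.symm
    exact mul_ne_zero hs0.ne' (by exact_mod_cast hdet i i' hi') h2
  set σ : Equiv.Perm (Fin 4) := Tuple.sort X with hσ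
  have hεne : ∀ w, ε w ≠ 0 := fun w h0 => by have := hε w; rw [h0] at this; norm_num at this
  have habs : ∀ n : ℕ, |((-1 : ℤ)) ^ n| = 1 := fun n => by simp
  refine false_of_four_in_class (hasIntegralProducts_covariantLattice H) hs hs0
    (X := X ∘ σ) (θ := fun i => θ (v (σ i)))
    (f := fun i => (-1) ^ (j : ℕ) * F.value (v (σ i)).1 (v (σ i)).2)
    (d := fun i i' => ε (v (σ i)) * ε (v (σ i')) *
      ((v (σ i')).1 * (v (σ i)).2 - (v (σ i)).1 * (v (σ i')).2)) hh (fun i => hXpos _)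
    (Tuple.monotone_sort X) ?_ ?_ ?_ ?_ (fun i => hθ _) ?_
  · intro i i' hii
    exact mul_ne_zero (mul_ne_zero (hεne _) (hεne _)) (hdet _ _ (σ.injective.ne hii.ne))
  · intro i
    exact (hval _ _).rotate (hε _) (hzj (σ i))
  · intro i i' _
    exact (hpair _ _ _ _).rotate (hε _) (hε _) (hzj (σ i)) (hzj (σ i'))
  · intro i
    rw [abs_mul, habs, one_mul]
    exact (hvS (σ i)).2.1
  · refine hstart (v (σ 0)) (hvS _) _ ?_
    rw [div_pow, Real.sq_sqrt hs0.le, ← hnorm]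
    rfl

theorem theorem1p2 (F : BinaryQuartic) (hirr : F.IsIrreducible) (hdisc : 0 < F.discriminant)
    (hsplit : F.SplitsOverReals) (hred : F.IsReduced) (hJ : F.invJ = 0) (h : ℕ) (hh : 0 < h) :
    ((fun v : ℤ × ℤ => ({v, -v} : Set (ℤ × ℤ))) '' F.largeSolutions h).encard ≤ 12 := by
  obtain ⟨b, k, A, B, C, H⟩ := exists_hasReducedCovariant hred hJ
  have hk : (0 : ℝ) < k := by exact_mod_cast H.k_pos
  have hs : √(k : ℝ) ^ 2 = k := Real.sq_sqrt hk.le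
  have hs0 : 0 < √(k : ℝ) := Real.sqrt_pos.2 hk
  by_cases h2 : h = 2 ∧ k < 36
  · obtain ⟨rfl, hk36⟩ := h2
    refine (Set.encard_le_encard (Set.image_mono (largeSolutions_two_subset hirr H hk36))).trans ?_
    exact encard_le_of_isAdmissibleStart H hs hs0 one_pos fun v hv a ha =>
      isAdmissibleStart_of_mem hirr H hs hs0 one_pos (by norm_num) hv ha
  · exact encard_le_of_isAdmissibleStart H hs hs0 hh fun v hv a ha =>
      isAdmissibleStart_of_mem hirr H hs hs0 hh (by omega) hv ha
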